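/- Let $r>\tfrac52$ and consider the equation \[ \ddot x=f(x)+\varepsilon^r\,g(x,\dot x,t;\varepsilon),\qquad g(x,\dot x,t;\varepsilon)=q\Big(\frac x\varepsilon,\dot x;\varepsilon\Big)\,F\Big(\frac{\omega t}\varepsilon\Big),\qquad \varepsilon>0, \] where $f:\mathbb R\to\mathbb R$ is of class $C^3$; $q(\xi,v;\varepsilon)$ is defined for $\xi,v\in\mathbb R$, $\varepsilon\ge 0$, is $2\pi$-periodic in $\xi$, of class $C^3$ in $(\xi,v)$ for each $\varepsilon\geq0$ and of class $C^1$ in $(\xi,v,\varepsilon)$ on $\mathbb R^2\times[0,\infty)$; $\omega\in\mathbb R^n$ is non-resonant ($m\cdot\omega\neq0$ for all $m\in\mathbb Z^n\setminus\{0\}$); and $F(\theta)=\sum_{m\in\mathcal Z}F_m e^{im\cdot\theta}$ is a real-valued trigonometric polynomial on $\mathbb T^n$ of zero mean, with $\mathcal Z\subset\mathbb Z^n\setminus\{0\}$ finite. Suppose that the unperturbed system $\ddot x=f(x)$ has a hyperbolic equilibrium $(\bar x,0)$ with a homoclinic connection described by an integral curve $x_0(t)$; write $z_0=(x_0,\dot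 x_0)$. For $k\in\mathbb Z\setminus\{0\}$ and $m\in\mathcal Z$ set \[ \mathcal C_{k,m}=\Big\{t^*\in\mathbb R:\ \dot x_0(t^*)=-\frac{m\cdot\omega}k\Big\}, \] and assume that $f(x_0(t^*))\neq0$ for all $t^*\in\mathcal C_{k,m}$, $k\in\mathbb Z\setminus\{0\}$, $m\in\mathcal Z$. Let $q_k(v)=\frac1{2\pi}\int_0^{2\pi}q(\xi,v;0)e^{-ik\xi}\,d\xi$. Let $\Sigma$ be the segment $\{z_0(0)+s\,(-f(x_0(0)),\dot x_0(0)):|s|\le1\}$, which is normal to the separatrix at $z_0(0)$. Then there is $\delta_0>0$ such that for each $\delta\in(0,\delta_0]$ and all small enough $\varepsilon>0$ the following holds. The perturbed system has exactly one trajectory $p_\varepsilon(t)$, $t\in\mathbb R$, that stays $\delta$-close to $(\bar x,0)$. For each $t_0\in\mathbb R$ there is exactly one point $Z^{\mathrm s}\in\Sigma$ such that the solution with $z(t_0)=Z^{\mathrm s}$ is asymptotic to $p_\varepsilon$ as $t\to+\infty$ and satisfies $|z(t)-z_0(t-t_0)|\le\delta$ for all $t\ge t_0$, and there is exactly one point $Z^{\mathrm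 u}\in\Sigma$ with the analogous property as $t\to-\infty$, for $t\le t_0$. These are the first intersections of the stable and unstable manifolds with $\Sigma$ in the time slice $t=t_0$. The displacement function \[ \mathcal D(t_0):=\dot x_0(0)\,(Z^{\mathrm u}-Z^{\mathrm s})_2-f(x_0(0))\,(Z^{\mathrm u}-Z^{\mathrm s})_1 \] (the signed distance from $Z^{\mathrm s}$ to $Z^{\mathrm u}$ along $\Sigma$, times $\alpha=[\dot x_0(0)^2+f(x_0(0))^2]^{1/2}$) satisfies \[ \mathcal D(t_0)=\varepsilon^{r+\frac12}\sum_{m\in\mathcal Z}\Big(\mathcal A_m\cos\frac{m\cdot\omega\,t_0}\varepsilon+\mathcal B_m\sin\frac{m\cdot\omega\,t_0}\varepsilon\Big)+O(\varepsilon^{r+1}+\varepsilon^{2r-2}), \] with an implied constant independent of $\varepsilon$, $\delta$ and $t_0$. Here $\mathcal A_m=\mathcal A_m(\varepsilon)$ and $\mathcal B_m=\mathcal B_m(\varepsilon)$ are the explicit real coefficients \[ \mathcal A_m=\sqrt{2\pi}\,\mathrm{Re}\,S_m,\qquad \mathcal B_m=-\sqrt{2\pi}\,\mathrm{Im}\,S_m,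 \] \[ S_m=F_m\sum_{k\in\mathbb Z\setminus\{0\}}\ \sum_{t^*\in\mathcal C_{k,m}}\frac{-(m\cdot\omega)\,q_k\big(-\tfrac{m\cdot\omega}k\big)}{k|k|^{1/2}|f(x_0(t^*))|^{1/2}}\;e^{\,i\left(\frac{k x_0(t^*)+m\cdot\omega\,t^*}{\varepsilon}+\frac{\sigma^*\pi}4\right)},\qquad \sigma^*=\frac{kf(x_0(t^*))}{|kf(x_0(t^*))|}. \] The sets $\mathcal C_{k,m}$ are finite, with cardinality bounded uniformly in $k$ (and $m\in\mathcal Z$), and for each $m\in\mathcal Z$ the sum over $k$ of the absolute values of the terms, which do not depend on $\varepsilon$, converges. -/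

import Mathlib

open Set Filter Topology

noncomputable section

namespace QPSplitting

/-! ### Planar nonautonomous systems and invariant manifolds -/

/-- `z` solves `z' = X(t, z)` on the set of times `S` (one-sided derivatives at end points). -/
def IsSolutionOn (X : ℝ → ℝ × ℝ → ℝ × ℝ) (S : Set ℝ) (z : ℝ → ℝ × ℝ) : Prop :=
  ∀ t ∈ S, HasDerivWithinAt z (X t (z t)) S t

/-- `p` is an entire trajectory of `z' = X(t, z)` that stays in the closed `δ`-ball around `e`.
For a small perturbation of an autonomous system with hyperbolic equilibrium `e`, and small `δ`,
this is the hyperbolic trajectory that continues the equilibrium. -/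
def IsTrajectoryNear (X : ℝ → ℝ × ℝ → ℝ × ℝ) (e : ℝ × ℝ) (δ : ℝ) (p : ℝ → ℝ × ℝ) : Prop :=
  IsSolutionOn X univ p ∧ ∀ t, dist (p t) e ≤ δ

/-- `Z` is the point where the stable manifold of the trajectory `p`, in the time slice `t = t₀`,
meets the section `Sec`, on the piece of the manifold that follows the separatrix `z₀`:
the trajectory through `(t₀, Z)` is asymptotic to `p` as `t → +∞`, and it stays `δ`-close to
`z₀(t - t₀)` for all `t ≥ t₀`.  The closeness singles out the first intersection:
at the later intersections the trajectory makes additional turns along the separatrix. -/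
def IsStableCrossing (X : ℝ → ℝ × ℝ → ℝ × ℝ) (p z₀ : ℝ → ℝ × ℝ) (Sec : Set (ℝ × ℝ))
    (δ t₀ : ℝ) (Z : ℝ × ℝ) : Prop :=
  Z ∈ Sec ∧ ∃ z : ℝ → ℝ × ℝ, IsSolutionOn X (Ici t₀) z ∧ z t₀ = Z ∧
    Tendsto (fun t => z t - p t) atTop (𝓝 0) ∧ ∀ t ∈ Ici t₀, dist (z t) (z₀ (t - t₀)) ≤ δ

/-- The analogue of `IsStableCrossing` for the unstable manifold of `p` (`t → -∞`). -/
def IsUnstableCrossing (X : ℝ → ℝ × ℝ → ℝ × ℝ) (p z₀ : ℝ → ℝ × ℝ) (Sec : Set (ℝ × ℝ))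
    (δ t₀ : ℝ) (Z : ℝ × ℝ) : Prop :=
  Z ∈ Sec ∧ ∃ z : ℝ → ℝ × ℝ, IsSolutionOn X (Iic t₀) z ∧ z t₀ = Z ∧
    Tendsto (fun t => z t - p t) atBot (𝓝 0) ∧ ∀ t ∈ Iic t₀, dist (z t) (z₀ (t - t₀)) ≤ δ

/-! ### The unperturbed system `x'' = f(x)` -/

/-- `(xe, 0)` is a hyperbolic equilibrium of `x' = v, v' = f(x)`: the linearization there has no
eigenvalue on the imaginary axis. -/
def IsHyperbolicEquilibrium (f : ℝ → ℝ) (xe : ℝ) : Prop :=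
  f xe = 0 ∧
    ∀ μ ∈ spectrum ℂ (!![0, 1; ((deriv f xe : ℝ) : ℂ), 0] : Matrix (Fin 2) (Fin 2) ℂ), μ.re ≠ 0

/-- `x₀` is a solution of `x'' = f(x)` that is homoclinic to the equilibrium `(xe, 0)`. -/
def IsHomoclinic (f : ℝ → ℝ) (xe : ℝ) (x₀ : ℝ → ℝ) : Prop :=
  (∀ t, HasDerivAt x₀ (deriv x₀ t) t) ∧ (∀ t, HasDerivAt (deriv x₀) (f (x₀ t)) t) ∧
  Tendsto x₀ atTop (𝓝 xe) ∧ Tendsto (deriv x₀) atTop (𝓝 0) ∧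
  Tendsto x₀ atBot (𝓝 xe) ∧ Tendsto (deriv x₀) atBot (𝓝 0) ∧
  ∃ t, x₀ t ≠ xe

/-- The separatrix in the phase plane, `z₀(t) = (x₀(t), x₀'(t))`. -/
def separatrix (x₀ : ℝ → ℝ) (t : ℝ) : ℝ × ℝ := (x₀ t, deriv x₀ t)

/-- The segment through `z₀(0)` parallel to the normal vector `(-f(x₀(0)), x₀'(0))`. -/
def normalSection (f x₀ : ℝ → ℝ) : Set (ℝ × ℝ) :=
  {z | ∃ s ∈ Icc (-1 : ℝ) 1, z = separatrix x₀ 0 + s • ((-f (x₀ 0), deriv x₀ 0) : ℝ × ℝ)}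

/-- The displacement between the crossing points `Zu` (unstable) and `Zs` (stable) on the normal
section: the signed distance from `Zs` to `Zu` along the unit vector in the direction
`(-f(x₀(0)), x₀'(0))`, multiplied by the constant `α = (x₀'(0)² + f(x₀(0))²)^(1/2)`.
Equivalently, the cross product `(x₀'(0), f(x₀(0))) × (Zu - Zs)`. -/
def displacement (f x₀ : ℝ → ℝ) (Zu Zs : ℝ × ℝ) : ℝ :=
  deriv x₀ 0 * (Zu.2 - Zs.2) - f (x₀ 0) * (Zu.1 - Zs.1)

/-! ### The perturbed system -/

/-- `m · y` for an integer vector `m` and a real vector `y`. -/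
def idot {n : ℕ} (m : Fin n → ℤ) (y : Fin n → ℝ) : ℝ := ∑ i, (m i : ℝ) * y i

/-- The frequency vector `ω` is non-resonant. -/
def NonResonant {n : ℕ} (ω : Fin n → ℝ) : Prop := ∀ m : Fin n → ℤ, m ≠ 0 → idot m ω ≠ 0

/-- The perturbation `g(x, v, t; ε) = q(x/ε, v; ε) F(ω t/ε)`. -/
def perturbation {n : ℕ} (q : ℝ → ℝ → ℝ → ℝ) (F : (Fin n → ℝ) → ℝ) (ω : Fin n → ℝ)
    (ε x v t : ℝ) : ℝ :=
  q (x / ε) v ε * F (fun i => ω i * t / ε)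

/-- The first-order form of `x'' = f(x) + ε^r g(x, x', t; ε)`. -/
def perturbedField {n : ℕ} (f : ℝ → ℝ) (q : ℝ → ℝ → ℝ → ℝ) (F : (Fin n → ℝ) → ℝ)
    (ω : Fin n → ℝ) (r ε t : ℝ) (z : ℝ × ℝ) : ℝ × ℝ :=
  (z.2, f z.1 + ε ^ r * perturbation q F ω ε z.1 z.2 t)

/-! ### The leading coefficients -/

/-- The Fourier coefficient `q_k(v)` of `ξ ↦ q(ξ, v; 0)`. -/
def fourierCoeffQ (q : ℝ → ℝ → ℝ → ℝ) (k : ℤ) (v : ℝ) : ℂ :=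
  (1 / (2 * Real.pi) : ℂ) *
    ∫ ξ in (0 : ℝ)..(2 * Real.pi), (q ξ v 0 : ℂ) * Complex.exp (-(Complex.I * k * ξ))

/-- The critical set `C_{k,m} = {t* : x₀'(t*) = -(m · ω)/k}` (used for `k ≠ 0`). -/
def critSet {n : ℕ} (x₀ : ℝ → ℝ) (ω : Fin n → ℝ) (k : ℤ) (m : Fin n → ℤ) : Set ℝ :=
  {t | deriv x₀ t = -idot m ω / k}

/-- The amplitude
`-(m · ω) q_k(-(m · ω)/k) exp(i σ* π/4) / (k |k|^(1/2) |f(x₀(t*))|^(1/2))` attached to a point `t*`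
of `C_{k,m}`, where `σ*` is the sign of `k f(x₀(t*))`. -/
def amplitude {n : ℕ} (f x₀ : ℝ → ℝ) (q : ℝ → ℝ → ℝ → ℝ) (ω : Fin n → ℝ)
    (k : ℤ) (m : Fin n → ℤ) (t : ℝ) : ℂ :=
  -(idot m ω : ℂ) * fourierCoeffQ q k (-idot m ω / k) *
      Complex.exp (Complex.I * (Real.sign (k * f (x₀ t)) * Real.pi / 4 : ℝ)) /
    ((k * √|(k : ℝ)| * √|f (x₀ t)| : ℝ) : ℂ)

/-- The phase `k x₀(t) + (m · ω) t`, whose critical points are the elements of `C_{k,m}`. -/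
def phase {n : ℕ} (x₀ : ℝ → ℝ) (ω : Fin n → ℝ) (k : ℤ) (m : Fin n → ℤ) (t : ℝ) : ℝ :=
  k * x₀ t + idot m ω * t

/-- `F_m ∑_{k ≠ 0} ∑_{t* ∈ C_{k,m}} amplitude(t*) exp(i phase(t*) / ε)`. -/
def stationarySum {n : ℕ} (f x₀ : ℝ → ℝ) (q : ℝ → ℝ → ℝ → ℝ) (ω : Fin n → ℝ)
    (Fc : (Fin n → ℤ) → ℂ) (ε : ℝ) (m : Fin n → ℤ) : ℂ :=
  Fc m * ∑' k : {k : ℤ // k ≠ 0}, ∑ᶠ t ∈ critSet x₀ ω k m,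
    amplitude f x₀ q ω k m t * Complex.exp (Complex.I * (phase x₀ ω k m t / ε : ℝ))

/-- The coefficient `A_m` of `cos(m · ω t₀ / ε)`. -/
def coeffA {n : ℕ} (f x₀ : ℝ → ℝ) (q : ℝ → ℝ → ℝ → ℝ) (ω : Fin n → ℝ)
    (Fc : (Fin n → ℤ) → ℂ) (ε : ℝ) (m : Fin n → ℤ) : ℝ :=
  √(2 * Real.pi) * (stationarySum f x₀ q ω Fc ε m).re

/-- The coefficient `B_m` of `sin(m · ω t₀ / ε)`. -/
def coeffB {n : ℕ} (f x₀ : ℝ → ℝ) (q : ℝ → ℝ → ℝ → ℝ) (ω : Fin n → ℝ)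
    (Fc : (Fin n → ℤ) → ℂ) (ε : ℝ) (m : Fin n → ℤ) : ℝ :=
  -√(2 * Real.pi) * (stationarySum f x₀ q ω Fc ε m).im

/-- The leading part of the displacement function. -/
def leadingTerm {n : ℕ} (f x₀ : ℝ → ℝ) (q : ℝ → ℝ → ℝ → ℝ) (ω : Fin n → ℝ)
    (modes : Finset (Fin n → ℤ)) (Fc : (Fin n → ℤ) → ℂ) (r ε t₀ : ℝ) : ℝ :=
  ε ^ (r + 1 / 2) * ∑ m ∈ modes,
    (coeffA f x₀ q ω Fc ε m * Real.cos (idot m ω * t₀ / ε) +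
      coeffB f x₀ q ω Fc ε m * Real.sin (idot m ω * t₀ / ε))

end QPSplitting

end

noncomputable section

namespace QPSplitting

open Set Filter Topology MeasureTheory

/-! ### The Fresnel integral and one-dimensional stationary phase -/

/-! The proof has two independent halves: a perturbation argument that reduces the displacement to a
Melnikov integral, and a stationary phase analysis of that integral which is uniform in the Fourier
index.

Perturbation half. Let `(V, W) = (x₀', f(x₀))` be the tangent of the separatrix. A solution that
starts on the normal section and follows the separatrix is `z₀ + d`, where `d` solves the equation
linearized along the orbit with an inhomogeneity `g` made of the quadratic remainder of `f` and the
forcing. If `d(0)` is orthogonal to the tangent, the linear problem on the half-line has exactly one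
bounded solution, with a gain that depends only on the orbit (`StableOrbit.exists_halfLineSolution`,
`HalfLineSolution.norm_le`). A contraction argument (`exists_unique_solution_of_contraction`) then
gives existence and uniqueness of the crossing point, together with `‖d‖ ≤ 2Γη`, where `η` bounds
the forcing. The wedge product `M = V d₂ - W d₁` satisfies `M' = V g` and tends to `0`, so `M(0) =
-∫ V g` over the half-line. Replacing `d` by `0` inside `g` costs `O(η² + ℓη)`, `ℓ` being the
Lipschitz constant of the forcing. The unstable side follows by time reversal, and the two half-line
integrals add up to the Melnikov integral over `ℝ` (`IsHomoclinic.exists_melnikov`). Here `η` is of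
order `ε^r` and `ℓ` of order `ε^(r-1)`, because the fast variable is `x/ε`.

Oscillatory half. Expanding `q` in its fast variable and `F` in its modes turns the Melnikov
integral into a sum of integrals of `V q_k(V) exp(i(k x₀ + μ s)/ε)` with `μ = m · ω ≠ 0`. The phase
is stationary where `kV + μ = 0`; there is no such point for `k = 0`. The difficulty is uniformity
as `|k| → ∞`, when the critical velocity `-μ/k` tends to `0` and critical points may escape towards
the equilibrium, where `f(x₀)` tends to `0` as well. The key is the scale-invariant nondegeneracy `c
|V| ≤ |W|` wherever `|kV + μ| ≤ c` (`exists_nondegeneracy`): it comes from the saddle cone near the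
equilibrium, from the nonvanishing speed for large `|k|`, and from the hypothesis and compactness
for the remaining `k`.

By this inequality and Grönwall, `V` and `W` are `O(|W(t)|)` on a window of fixed width around a
critical point `t`. Dividing the phase by `W(t)` yields a normalized phase with uniform bounds, the
amplitude is itself `O(|W(t)|)`, and the factors `|W(t)|` cancel in the error
(`DecayingOrbit.window_integral`). Away from the windows `|kV + μ|` is bounded below independently
of `k`, and one integration by parts suffices. Altogether the `k`-th error is `ε` times `|k|
sup|q_k| + sup|q_k'| + sup|q_k''|/|k|` (`DecayingOrbit.oscillatory_integral`), which is `O(ε/k²)`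
since `q` is `C³`, hence summable. -/

theorem norm_gaussian_tail_le {z : ℂ} (hz : 0 < z.re) {S : ℝ} (hS : 0 < S) :
    ‖∫ σ in Ioi S, Complex.exp (-z * (σ : ℂ) ^ 2)‖ ≤ 1 / (S * ‖z‖) := by
  have hz0 : z ≠ 0 := fun h => by simp [h] at hz
  have hzn : 0 < ‖z‖ := norm_pos_iff.2 hz0
  have hint : IntegrableOn (fun σ : ℝ => Complex.exp (-z * (σ : ℂ) ^ 2)) (Ioi S) :=
    (integrable_cexp_neg_mul_sq hz).integrableOn
  have hle : ∀ σ : ℝ, ‖Complex.exp (-z * (σ : ℂ) ^ 2)‖ ≤ 1 := fun σ => by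
    rw [Complex.norm_exp]
    have : (-z * (σ : ℂ) ^ 2).re = -(z.re * σ ^ 2) := by
      rw [← Complex.ofReal_pow, Complex.re_mul_ofReal]; simp
    rw [this]
    exact Real.exp_le_one_iff.2 (neg_nonpos.2 (by positivity))
  have hpow : IntegrableOn (fun σ : ℝ => σ ^ (-2 : ℝ)) (Ioi S) :=
    integrableOn_Ioi_rpow_of_lt (by norm_num) hS
  have hpowv : ∫ σ in Ioi S, σ ^ (-2 : ℝ) = 1 / S := by
    rw [integral_Ioi_rpow_of_lt (by norm_num) hS]
    norm_num [Real.rpow_neg_one]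
  have hb : ∀ σ ∈ Ioi S, ‖Complex.exp (-z * (σ : ℂ) ^ 2) / (2 * z * (σ : ℂ) ^ 2)‖ ≤
      1 / (2 * ‖z‖) * σ ^ (-2 : ℝ) := fun σ hσ => by
    have hσ0 : 0 < σ := hS.trans hσ
    rw [norm_div, norm_mul, norm_mul, norm_pow, Complex.norm_real, Real.norm_of_nonneg hσ0.le,
      Real.rpow_neg hσ0.le]
    simp only [Complex.norm_ofNat, Real.rpow_two]
    rw [div_le_iff₀ (by positivity)]
    calc _ ≤ (1 : ℝ) := hle σ
      _ = _ := by field_simp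
  have hcont : ContinuousOn (fun σ : ℝ => Complex.exp (-z * (σ : ℂ) ^ 2) / (2 * z * (σ : ℂ) ^ 2))
      (Ioi S) := by
    apply ContinuousOn.div
    · fun_prop
    · fun_prop
    · intro σ hσ
      have : (σ : ℂ) ≠ 0 := Complex.ofReal_ne_zero.2 (hS.trans hσ).ne'
      exact mul_ne_zero (mul_ne_zero two_ne_zero hz0) (pow_ne_zero 2 this)
  have hint2 : IntegrableOn
      (fun σ : ℝ => Complex.exp (-z * (σ : ℂ) ^ 2) / (2 * z * (σ : ℂ) ^ 2)) (Ioi S) :=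
    (hpow.const_mul (1 / (2 * ‖z‖))).mono' (hcont.aestronglyMeasurable measurableSet_Ioi)
      ((ae_restrict_mem measurableSet_Ioi).mono hb)
  -- Integration by parts: this primitive yields the integrand plus an absolutely integrable
  -- remainder. The boundary term and the remainder contribute `1 / (2 ‖z‖ S)` each, a bound that
  -- survives as the real part of `z` tends to `0`.
  have hd : ∀ σ ∈ Ici S, HasDerivAt
      (fun σ : ℝ => -Complex.exp (-z * (σ : ℂ) ^ 2) / (2 * z * (σ : ℂ)))
      (Complex.exp (-z * (σ : ℂ) ^ 2) + Complex.exp (-z * (σ : ℂ) ^ 2) / (2 * z * (σ : ℂ) ^ 2))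
      σ := fun σ hσ => by
    have hσ0 : (σ : ℂ) ≠ 0 := Complex.ofReal_ne_zero.2 (hS.trans_le hσ).ne'
    have h1 : HasDerivAt (fun w : ℂ => -Complex.exp (-z * w ^ 2) / (2 * z * w))
        (Complex.exp (-z * (σ : ℂ) ^ 2) + Complex.exp (-z * (σ : ℂ) ^ 2) / (2 * z * (σ : ℂ) ^ 2))
        (σ : ℂ) := by
      have := ((((hasDerivAt_pow 2 (σ : ℂ)).const_mul (-z)).cexp).neg).div
        ((hasDerivAt_id (σ : ℂ)).const_mul (2 * z)) (by simp [hz0, hσ0])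
      convert! this using 1
      simp only [id, Pi.neg_apply]
      field_simp
      push_cast
      ring
    exact h1.comp_ofReal
  have hlim : Tendsto (fun σ : ℝ => -Complex.exp (-z * (σ : ℂ) ^ 2) / (2 * z * (σ : ℂ)))
      atTop (𝓝 0) := by
    have h2 : Tendsto (fun σ : ℝ => 1 / (2 * ‖z‖) * σ⁻¹) atTop (𝓝 0) := by
      simpa using tendsto_inv_atTop_zero.const_mul (1 / (2 * ‖z‖))
    refine squeeze_zero_norm' ?_ h2
    filter_upwards [eventually_gt_atTop 0] with σ hσ
    rw [norm_div, norm_neg, norm_mul, norm_mul, Complex.norm_real, Real.norm_of_nonneg hσ.le]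
    simp only [Complex.norm_ofNat]
    rw [div_le_iff₀ (by positivity)]
    calc _ ≤ (1 : ℝ) := hle σ
      _ = _ := by field_simp
  have hftc := integral_Ioi_of_hasDerivAt_of_tendsto' hd (hint.add hint2) hlim
  rw [integral_add hint hint2] at hftc
  have e1 : ∫ σ in Ioi S, Complex.exp (-z * (σ : ℂ) ^ 2) =
      Complex.exp (-z * (S : ℂ) ^ 2) / (2 * z * (S : ℂ)) -
        ∫ σ in Ioi S, Complex.exp (-z * (σ : ℂ) ^ 2) / (2 * z * (σ : ℂ) ^ 2) := by
    rw [eq_sub_iff_add_eq, hftc]; ring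
  have e2 : ‖Complex.exp (-z * (S : ℂ) ^ 2) / (2 * z * (S : ℂ))‖ ≤ 1 / (2 * ‖z‖) * (1 / S) := by
    rw [norm_div, norm_mul, norm_mul, Complex.norm_real, Real.norm_of_nonneg hS.le]
    simp only [Complex.norm_ofNat]
    rw [div_le_iff₀ (by positivity)]
    calc _ ≤ (1 : ℝ) := hle S
      _ = _ := by field_simp
  have e3 : ‖∫ σ in Ioi S, Complex.exp (-z * (σ : ℂ) ^ 2) / (2 * z * (σ : ℂ) ^ 2)‖ ≤
      1 / (2 * ‖z‖) * (1 / S) := by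
    rw [← hpowv, ← integral_const_mul]
    exact norm_integral_le_of_norm_le (hpow.const_mul _)
      ((ae_restrict_mem measurableSet_Ioi).mono hb)
  rw [e1]
  calc _ ≤ _ := norm_sub_le _ _
    _ ≤ 1 / (2 * ‖z‖) * (1 / S) + 1 / (2 * ‖z‖) * (1 / S) := add_le_add e2 e3
    _ = _ := by field_simp; norm_num

/-- The value at infinity of the Fresnel integral, `(1/2) (2π/κ)^(1/2) e^{iπ/4}`. -/
theorem fresnel_constant {κ : ℝ} (hκ : 0 < κ) :
    ((Real.pi : ℂ) / (-(Complex.I * κ) / 2)) ^ (1 / 2 : ℂ) =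
      (√(2 * Real.pi / κ) : ℝ) * Complex.exp (Complex.I * (Real.pi / 4 : ℝ)) := by
  have h1 : (Real.pi : ℂ) / (-(Complex.I * κ) / 2) = ((2 * Real.pi / κ : ℝ) : ℂ) * Complex.I := by
    have : (κ : ℂ) ≠ 0 := Complex.ofReal_ne_zero.2 hκ.ne'
    push_cast
    field_simp
    linear_combination (-1 : ℂ) * Complex.I_sq
  have hp : 0 ≤ 2 * Real.pi / κ := by positivity
  rw [h1, Complex.cpow_def_of_ne_zero (mul_ne_zero (Complex.ofReal_ne_zero.2 (by positivity))
    Complex.I_ne_zero), Complex.log_ofReal_mul (by positivity) Complex.I_ne_zero, add_mul,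
    Complex.exp_add, Complex.log_I, Real.sqrt_eq_rpow, Complex.ofReal_cpow hp,
    Complex.cpow_def_of_ne_zero (Complex.ofReal_ne_zero.2 (by positivity)),
    ← Complex.ofReal_log hp]
  congr 2
  · push_cast; ring
  · push_cast; ring

/-- The Fresnel integral converges only conditionally, so it is regularized to a Gaussian with
parameter `(α - iκ)/2`, `α > 0`. The tail bound depends on the modulus of the parameter alone, which
is at least `κ/2`; hence it passes to the limit `α → 0`. -/
theorem norm_fresnel_sub_le {κ S : ℝ} (hκ : 0 < κ) (hS : 0 < S) :
    ‖(∫ σ in (0 : ℝ)..S, Complex.exp (Complex.I * (κ * (σ ^ 2 / 2) : ℝ))) -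
      (√(2 * Real.pi / κ) : ℝ) * Complex.exp (Complex.I * (Real.pi / 4 : ℝ)) / 2‖ ≤
        2 / (S * κ) := by
  set b : ℝ → ℂ := fun α => (α - Complex.I * κ) / 2 with hb
  have hbre : ∀ α, (b α).re = α / 2 := fun α => by simp [hb]
  have hbn : ∀ α, κ / 2 ≤ ‖b α‖ := fun α => by
    have : |(b α).im| ≤ ‖b α‖ := Complex.abs_im_le_norm _
    have h2 : |(b α).im| = κ / 2 := by simp [hb, abs_div, abs_of_pos hκ]
    linarith
  have key : ∀ α : ℝ, 0 < α → ‖(∫ σ in (0 : ℝ)..S, Complex.exp (-b α * (σ : ℂ) ^ 2)) -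
      ((Real.pi : ℂ) / b α) ^ (1 / 2 : ℂ) / 2‖ ≤ 2 / (S * κ) := fun α hα => by
    have hre : 0 < (b α).re := by rw [hbre]; linarith
    have hint := integrable_cexp_neg_mul_sq hre
    rw [← integral_gaussian_complex_Ioi hre,
      ← intervalIntegral.integral_interval_add_Ioi (b := S) hint.integrableOn hint.integrableOn]
    rw [sub_add_cancel_left, norm_neg]
    refine (norm_gaussian_tail_le hre hS).trans ?_
    rw [div_le_div_iff₀ (mul_pos hS (lt_of_lt_of_le (by linarith) (hbn α))) (by positivity)]
    nlinarith [hbn α]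
  have hc1 : Continuous fun α : ℝ => ∫ σ in (0 : ℝ)..S, Complex.exp (-b α * (σ : ℂ) ^ 2) := by
    apply intervalIntegral.continuous_parametric_intervalIntegral_of_continuous'
    simp only [hb, Function.uncurry_def]
    fun_prop
  -- At `α = 0` the base of the power is a positive multiple of `i`, off the branch cut, so the
  -- principal square root is continuous there.
  have hc2 : ContinuousAt (fun α : ℝ => ((Real.pi : ℂ) / b α) ^ (1 / 2 : ℂ) / 2) 0 := by
    have h0 : b 0 ≠ 0 := norm_pos_iff.1 (lt_of_lt_of_le (by linarith) (hbn 0))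
    have hcb : ContinuousAt b 0 := by simp only [hb]; fun_prop
    refine ((continuousAt_const.div hcb h0).cpow continuousAt_const ?_).div_const 2
    refine Complex.mem_slitPlane_iff.2 (Or.inr ?_)
    have : (Real.pi : ℂ) / b 0 = ((2 * Real.pi / κ : ℝ) : ℂ) * Complex.I := by
      have : (κ : ℂ) ≠ 0 := Complex.ofReal_ne_zero.2 hκ.ne'
      simp only [hb]
      push_cast
      rw [zero_sub]
      field_simp
      linear_combination (-1 : ℂ) * Complex.I_sq
    show ((Real.pi : ℂ) / b 0).im ≠ 0
    rw [this, Complex.im_ofReal_mul, Complex.I_im, mul_one]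
    positivity
  have hlim := ((hc1.continuousAt (x := 0)).sub hc2).norm
  have hle := le_of_tendsto (hlim.tendsto.mono_left (nhdsWithin_le_nhds (s := Ioi 0)))
    (by filter_upwards [self_mem_nhdsWithin] with α hα using key α hα)
  have hb0 : b 0 = -(Complex.I * κ) / 2 := by simp [hb]
  simp only [Pi.sub_apply] at hle
  rw [hb0, fresnel_constant hκ] at hle
  convert! hle using 6
  push_cast
  ring_nf

/-- The mean value inequality on `[0, t]`, without the gain `1/(n+1)`. Iterating it gives all Taylor
estimates for the phase and the amplitude with one and the same constant. -/
theorem norm_sub_le_pow_succ {E : Type*} [NormedAddCommGroup E] [NormedSpace ℝ E] {g g' : ℝ → E}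
    {C h : ℝ} (n : ℕ) (hC : 0 ≤ C) (hg : ∀ t ∈ Icc 0 h, HasDerivAt g (g' t) t)
    (hb : ∀ t ∈ Icc 0 h, ‖g' t‖ ≤ C * t ^ n) {t : ℝ} (ht : t ∈ Icc 0 h) :
    ‖g t - g 0‖ ≤ C * t ^ (n + 1) := by
  have := (convex_Icc 0 t).norm_image_sub_le_of_norm_hasDerivWithin_le (C := C * t ^ n)
    (fun s hs => (hg s ⟨hs.1, hs.2.trans ht.2⟩).hasDerivWithinAt)
    (fun s hs => (hb s ⟨hs.1, hs.2.trans ht.2⟩).trans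
      (mul_le_mul_of_nonneg_left (pow_le_pow_left₀ hs.1 hs.2 n) hC))
    (left_mem_Icc.2 ht.1) (right_mem_Icc.2 ht.1)
  rwa [sub_zero, Real.norm_of_nonneg ht.1, mul_assoc, ← pow_succ] at this

/-- The expansion is in `σ² - 1` rather than `σ - 1` because in the application `σ² = 2y(t)/t²` is
the quantity with an explicit Taylor expansion. -/
theorem abs_inv_cube_sub_le {σ : ℝ} (h1 : 1 / 2 ≤ σ) :
    |1 / σ ^ 3 - 1 + 3 / 2 * (σ ^ 2 - 1)| ≤ 24 * (σ - 1) ^ 2 := by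
  have h0 : 0 < σ := by linarith
  have e : 1 / σ ^ 3 - 1 + 3 / 2 * (σ ^ 2 - 1) =
      (σ - 1) ^ 2 * ((3 / 2 * σ ^ 3 + 3 * σ ^ 2 + 2 * σ + 1) / σ ^ 3) := by
    field_simp; ring
  have e2 : (3 / 2 * σ ^ 3 + 3 * σ ^ 2 + 2 * σ + 1) / σ ^ 3 ≤ 24 := by
    rw [div_le_iff₀ (by positivity)]
    have a1 : 0 ≤ σ - 1 / 2 := by linarith
    nlinarith [mul_nonneg a1 a1, mul_nonneg (mul_nonneg a1 a1) a1]
  rw [e, abs_of_nonneg (by positivity)]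
  nlinarith [sq_nonneg (σ - 1)]

/-- Pointwise consequences of the third order Taylor expansion of a normalized phase at its
critical point; `p` and `σ` stand for `y'(t)/t` and `(2y(t))^(1/2)/t`. -/
theorem phase_ratio_bounds {M t β p σ y2 : ℝ} (hM : 1 ≤ M) (ht : 0 < t) (ht1 : t * M ≤ 1 / 8)
    (hβ : |β| ≤ M) (hp : |p - 1 - β * t / 2| ≤ M * t ^ 2) (hσ0 : 0 ≤ σ)
    (hσ : |σ ^ 2 - 1 - β * t / 3| ≤ 2 * M * t ^ 2) (hy2 : |y2 - 1 - β * t| ≤ M * t ^ 2) :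
    |p - 1| ≤ 3 / 2 * M * t ∧ |σ - 1| ≤ 3 * M * t ∧ |y2 - 1| ≤ 2 * M * t ∧
      |p ^ 3 * (1 / σ ^ 3) - 1 - β * t| ≤ 600 * M ^ 2 * t ^ 2 ∧ t ≤ 1 / 8 := by
  have t8 : t ≤ 1 / 8 := (le_mul_of_one_le_right ht.le hM).trans ht1
  have hβt : |β * t| ≤ M * t := by rw [abs_mul, abs_of_pos ht]; gcongr
  have hx : M * t ≤ 1 / 8 := by linarith
  have hx0 : 0 < M * t := by positivity
  have hq : M * t ^ 2 ≤ M * t / 8 := by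
    calc M * t ^ 2 = M * t * t := by ring
      _ ≤ M * t * (1 / 8) := by gcongr
      _ = _ := by ring
  have hMM : M * t ^ 2 ≤ (M * t) ^ 2 := by
    calc M * t ^ 2 = 1 * (M * t ^ 2) := (one_mul _).symm
      _ ≤ M * (M * t ^ 2) := by gcongr
      _ = _ := by ring
  set x := M * t with hxdef
  set b := β * t with hbdef
  set w := M * t ^ 2 with hwdef
  rw [show 3 / 2 * M * t = 3 / 2 * x by ring, show 3 * M * t = 3 * x by ring,
    show 2 * M * t = 2 * x by ring, show 600 * M ^ 2 * t ^ 2 = 600 * x ^ 2 by rw [hxdef]; ring]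
  rw [show 2 * M * t ^ 2 = 2 * w by rw [hwdef]; ring] at hσ
  have hw0 : 0 ≤ w := by positivity
  rw [abs_le] at hβt hp hσ hy2
  have h1 : |p - 1| ≤ 3 / 2 * x := abs_le.2 ⟨by linarith, by linarith⟩
  have hs2 : |σ ^ 2 - 1| ≤ 3 * x := abs_le.2 ⟨by linarith, by linarith⟩
  have h2 : |σ - 1| ≤ 3 * x := by
    refine le_trans ?_ hs2
    rw [show σ ^ 2 - 1 = (σ - 1) * (σ + 1) by ring, abs_mul]
    exact le_mul_of_one_le_right (abs_nonneg _) (by rw [abs_of_nonneg (by linarith)]; linarith)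
  have h3 : |y2 - 1| ≤ 2 * x := abs_le.2 ⟨by linarith, by linarith⟩
  refine ⟨h1, h2, h3, ?_, t8⟩
  have h1' := abs_le.1 h1
  have h2' := abs_le.1 h2
  have hσl : 1 / 2 ≤ σ := by linarith
  have hQ := abs_le.1 (abs_inv_cube_sub_le hσl)
  have hs3 : (σ - 1) ^ 2 ≤ 9 * x ^ 2 := by
    rw [show 9 * x ^ 2 = (3 * x) ^ 2 by ring]; exact sq_le_sq' h2'.1 h2'.2
  set Q := 1 / σ ^ 3 with hQdef
  have hQ0 : 0 ≤ Q := by positivity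
  have hQ1 : |Q - 1 + b / 2| ≤ 219 * x ^ 2 := abs_le.2 ⟨by linarith, by linarith⟩
  have hQ2 : |Q| ≤ 8 := by
    rw [abs_of_nonneg hQ0]
    have := (abs_le.1 hQ1).2
    have hx2 : x ^ 2 ≤ (1 / 8) ^ 2 := pow_le_pow_left₀ hx0.le hx 2
    linarith
  have hp3 : |p ^ 3 - 1 - 3 / 2 * b| ≤ 12 * x ^ 2 := by
    have e : p ^ 3 - 1 - 3 / 2 * b = 3 * (p - 1 - b / 2) + (p - 1) ^ 2 * (p + 2) := by ring
    have s2 : (p - 1) ^ 2 ≤ 9 / 4 * x ^ 2 := by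
      rw [show 9 / 4 * x ^ 2 = (3 / 2 * x) ^ 2 by ring]; exact sq_le_sq' h1'.1 h1'.2
    have s3 : |(p - 1) ^ 2 * (p + 2)| ≤ 9 / 4 * x ^ 2 * 4 := by
      rw [abs_mul, abs_of_nonneg (sq_nonneg (p - 1))]
      exact mul_le_mul s2 (abs_le.2 ⟨by linarith, by linarith⟩) (abs_nonneg _) (by positivity)
    have := abs_le.1 s3
    rw [e]
    exact abs_le.2 ⟨by linarith, by linarith⟩
  -- With `b = βt` one has `p³ ≈ 1 + 3b/2` and `σ⁻³ ≈ 1 - b/2`, so the product is `1 + b` to first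
  -- order. This agrees with the first-order expansion of `y''`, the agreement on which the
  -- cancellation of the poles rests.
  have e : p ^ 3 * Q - 1 - b = (p ^ 3 - 1 - 3 / 2 * b) * Q + (1 + 3 / 2 * b) * (Q - 1 + b / 2)
      - 3 / 4 * b ^ 2 := by ring
  have u1 : |(p ^ 3 - 1 - 3 / 2 * b) * Q| ≤ 12 * x ^ 2 * 8 := by
    rw [abs_mul]; gcongr
  have u2 : |(1 + 3 / 2 * b) * (Q - 1 + b / 2)| ≤ 2 * (219 * x ^ 2) := by
    rw [abs_mul]
    gcongr
    exact abs_le.2 ⟨by linarith, by linarith⟩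
  have u3 : b ^ 2 ≤ x ^ 2 := sq_le_sq' hβt.1 hβt.2
  rw [e]
  have u1' := abs_le.1 u1
  have u2' := abs_le.1 u2
  have := sq_nonneg b
  exact abs_le.2 ⟨by linarith, by linarith⟩

/-- The two expressions are `a/y' - a(0)/s` and its derivative, where `s = (2y)^(1/2)`. Each term
has a pole at the critical point; subtracting the model term `a(0)/s` removes the poles. -/
theorem stationary_quotient_bounds {M A t β p σ y2 : ℝ} {a a' a0 a1 : ℂ} (hM : 1 ≤ M)
    (ht : 0 < t) (ht1 : t * M ≤ 1 / 8) (hβ : |β| ≤ M) (hp : |p - 1 - β * t / 2| ≤ M * t ^ 2)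
    (hσ0 : 0 ≤ σ) (hσ : |σ ^ 2 - 1 - β * t / 3| ≤ 2 * M * t ^ 2)
    (hy2 : |y2 - 1 - β * t| ≤ M * t ^ 2) (ha0 : ‖a0‖ ≤ A) (ha1 : ‖a1‖ ≤ A)
    (haa : ‖a - a0‖ ≤ A * t) (ha' : ‖a' - a1‖ ≤ A * t) (ha2 : ‖a - a0 - t * a1‖ ≤ A * t ^ 2) :
    ‖a / (t * p : ℝ) - a0 / (t * σ : ℝ)‖ ≤ 2500 * M ^ 2 * A ∧
    ‖a' / (t * p : ℝ) - a * y2 / ((t * p) ^ 2 : ℝ) + a0 * (t * p : ℝ) / ((t * σ) ^ 3 : ℝ)‖ ≤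
      2500 * M ^ 2 * A := by
  obtain ⟨h1, h2, h3, h4, t8⟩ := phase_ratio_bounds hM ht ht1 hβ hp hσ0 hσ hy2
  have hA : 0 ≤ A := (norm_nonneg _).trans ha0
  have h1' := abs_le.1 h1
  have h2' := abs_le.1 h2
  have h3' := abs_le.1 h3
  have hp0 : 1 / 2 ≤ p := by linarith
  have hσ1 : 1 / 2 ≤ σ := by linarith
  have hσ2 : σ ≤ 3 / 2 := by linarith
  have tc : (t : ℂ) ≠ 0 := Complex.ofReal_ne_zero.2 ht.ne'
  have pc : (p : ℂ) ≠ 0 := Complex.ofReal_ne_zero.2 (by linarith)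
  have sc : (σ : ℂ) ≠ 0 := Complex.ofReal_ne_zero.2 (by linarith)
  have hMA : M * A ≤ M ^ 2 * A := by gcongr; exact le_self_pow₀ hM two_ne_zero
  have hMA0 : A ≤ M * A := le_mul_of_one_le_left hA hM
  constructor
  · have e : a / (t * p : ℝ) - a0 / (t * σ : ℝ) =
        ((a - a0) * σ + a0 * ((σ - p : ℝ) : ℂ)) / ((t * p * σ : ℝ) : ℂ) := by
      push_cast; field_simp; ring
    have n1 : ‖(a - a0) * σ + a0 * ((σ - p : ℝ) : ℂ)‖ ≤ A * t * (3 / 2) + A * (5 * M * t) := by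
      refine (norm_add_le _ _).trans ?_
      rw [norm_mul, norm_mul, Complex.norm_real, Complex.norm_real, Real.norm_of_nonneg hσ0]
      gcongr
      rw [Real.norm_eq_abs]
      exact abs_le.2 ⟨by linarith, by linarith⟩
    rw [e, norm_div, Complex.norm_real, Real.norm_of_nonneg (by positivity),
      div_le_iff₀ (by positivity)]
    refine n1.trans ?_
    have : t * (1 / 2) * (1 / 2) ≤ t * p * σ := by gcongr
    calc _ = (3 / 2 * A + 5 * (M * A)) * t := by ring
      _ ≤ (625 * (M ^ 2 * A)) * t := by gcongr; linarith
      _ = 2500 * M ^ 2 * A * (t * (1 / 2) * (1 / 2)) := by ring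
      _ ≤ _ := by gcongr
  -- In the common numerator the terms of order `0` and `1` in `t` cancel. What is left is grouped
  -- so that each summand is visibly `O(t²)`, matching the denominator.
  · have e : a' / (t * p : ℝ) - a * y2 / ((t * p) ^ 2 : ℝ) + a0 * (t * p : ℝ) / ((t * σ) ^ 3 : ℝ) =
        (t * ((a' - a1) * p + a1 * ((p - 1 : ℝ) : ℂ)) - (a - a0 - t * a1) * y2
          - a1 * ((t * (y2 - 1) : ℝ) : ℂ) - a0 * ((y2 - 1 - β * t : ℝ) : ℂ)
          + a0 * ((p ^ 3 * (1 / σ ^ 3) - 1 - β * t : ℝ) : ℂ)) / ((t ^ 2 * p ^ 2 : ℝ) : ℂ) := by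
      push_cast; field_simp; ring
    have v1 : ‖(t : ℂ) * ((a' - a1) * p + a1 * ((p - 1 : ℝ) : ℂ))‖ ≤
        t * (A * t * 2 + A * (3 / 2 * M * t)) := by
      rw [norm_mul, Complex.norm_real, Real.norm_of_nonneg ht.le]
      gcongr
      refine (norm_add_le _ _).trans ?_
      rw [norm_mul, norm_mul, Complex.norm_real, Complex.norm_real,
        Real.norm_of_nonneg (by linarith : 0 ≤ p)]
      gcongr
      · linarith
      · exact h1
    have v2 : ‖(a - a0 - t * a1) * y2‖ ≤ A * t ^ 2 * 2 := by
      rw [norm_mul, Complex.norm_real, Real.norm_of_nonneg (by linarith)]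
      have : 2 * M * t ≤ 1 := by linarith
      exact mul_le_mul ha2 (by linarith) (by linarith) (by positivity)
    have v3 : ‖a1 * ((t * (y2 - 1) : ℝ) : ℂ)‖ ≤ A * (t * (2 * M * t)) := by
      rw [norm_mul, Complex.norm_real, norm_mul, Real.norm_of_nonneg ht.le]
      gcongr
      exact h3
    have v4 : ‖a0 * ((y2 - 1 - β * t : ℝ) : ℂ)‖ ≤ A * (M * t ^ 2) := by
      rw [norm_mul, Complex.norm_real]; gcongr; exact hy2
    have v5 : ‖a0 * ((p ^ 3 * (1 / σ ^ 3) - 1 - β * t : ℝ) : ℂ)‖ ≤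
        A * (600 * M ^ 2 * t ^ 2) := by
      rw [norm_mul, Complex.norm_real]; gcongr; exact h4
    rw [e, norm_div, Complex.norm_real, Real.norm_of_nonneg (by positivity),
      div_le_iff₀ (by positivity)]
    have hsum := (norm_add_le_of_le (norm_sub_le_of_le (norm_sub_le_of_le
      (norm_sub_le_of_le v1 v2) v3) v4) v5)
    refine hsum.trans ?_
    have hp2 : (1 / 2) ^ 2 ≤ p ^ 2 := by gcongr
    calc _ = (4 * A + 3 / 2 * (M * A) + 2 * (M * A) + M * A + 600 * (M ^ 2 * A)) * t ^ 2 := by ring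
      _ ≤ (625 * (M ^ 2 * A)) * t ^ 2 := by gcongr; linarith
      _ = 2500 * M ^ 2 * A * (t ^ 2 * (1 / 2) ^ 2) := by ring
      _ ≤ _ := by gcongr

theorem hasDerivAt_comp_neg {E : Type*} [NormedAddCommGroup E] [NormedSpace ℝ E] {g : ℝ → E}
    {g' : E} {t : ℝ} (hg : HasDerivAt g g' (-t)) : HasDerivAt (fun t => g (-t)) (-g') t := by
  have := hg.scomp t (hasDerivAt_neg t)
  rwa [neg_one_smul] at this

/-- In the Morse coordinate `s = (2y)^(1/2)` the phase is exactly quadratic, so the model amplitude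
`a(0) s'` produces a Fresnel integral. The difference of the amplitudes is `y'` times a function `G`
with bounded derivative, and one integration by parts gains the factor `1/κ`. -/
theorem half_stationary_phase_of_pos {M h κ A : ℝ} (hM : 1 ≤ M) (hh : 0 < h)
    (hhM : h * M ≤ 1 / 8) (hκ : 0 < κ) {y y1 y2 y3 : ℝ → ℝ} {a a1 : ℝ → ℂ}
    (hy : ∀ t, HasDerivAt y (y1 t) t) (hy1 : ∀ t, HasDerivAt y1 (y2 t) t)
    (hy2 : ∀ t, HasDerivAt y2 (y3 t) t) (y0 : y 0 = 0) (y10 : y1 0 = 0) (y20 : y2 0 = 1)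
    (hβ : |y3 0| ≤ M) (hy3 : ∀ t ∈ Icc 0 h, |y3 t - y3 0| ≤ M * t)
    (ha : ∀ t, HasDerivAt a (a1 t) t) (ha1c : Continuous a1) (ha0 : ‖a 0‖ ≤ A)
    (ha1 : ∀ t ∈ Icc 0 h, ‖a1 t‖ ≤ A) (ha2 : ∀ t ∈ Icc 0 h, ‖a1 t - a1 0‖ ≤ A * t) :
    ‖(∫ t in (0 : ℝ)..h, a t * Complex.exp (Complex.I * (κ * y t : ℝ))) -
      a 0 * ((√(2 * Real.pi / κ) : ℝ) * Complex.exp (Complex.I * (Real.pi / 4 : ℝ)) / 2)‖ ≤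
      (7500 * M ^ 2 + 4 / h) * A / κ := by
  have hA : 0 ≤ A := (norm_nonneg _).trans ha0
  have hM0 : 0 < M := by linarith
  have hac : Continuous a := continuous_iff_continuousAt.2 fun t => (ha t).continuousAt
  have hyc : Continuous y := continuous_iff_continuousAt.2 fun t => (hy t).continuousAt
  have hy1c : Continuous y1 := continuous_iff_continuousAt.2 fun t => (hy1 t).continuousAt
  have hy2c : Continuous y2 := continuous_iff_continuousAt.2 fun t => (hy2 t).continuousAt
  set β := y3 0 with hβdef
  -- Taylor expansions of the phase
  have T2 : ∀ t ∈ Icc 0 h, |y2 t - 1 - β * t| ≤ M * t ^ 2 := fun t ht => by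
    have := norm_sub_le_pow_succ (g := fun t => y2 t - 1 - β * t) (g' := fun t => y3 t - β) 1
      hM0.le (fun t _ => by
        convert! ((hy2 t).sub_const 1).sub ((hasDerivAt_id t).const_mul β) using 1
        ring)
      (fun t ht => by simpa using hy3 t ht) ht
    simpa [y20] using this
  have T1 : ∀ t ∈ Icc 0 h, |y1 t - t - β * t ^ 2 / 2| ≤ M * t ^ 3 := fun t ht => by
    have := norm_sub_le_pow_succ (g := fun t => y1 t - t - β * t ^ 2 / 2)
      (g' := fun t => y2 t - 1 - β * t) 2 hM0.le (fun t _ => by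
        convert! ((hy1 t).sub (hasDerivAt_id t)).sub
          (((hasDerivAt_pow 2 t).const_mul β).div_const 2) using 1
        norm_num; ring) T2 ht
    simpa [y10] using this
  have T0 : ∀ t ∈ Icc 0 h, |y t - t ^ 2 / 2 - β * t ^ 3 / 6| ≤ M * t ^ 4 := fun t ht => by
    have := norm_sub_le_pow_succ (g := fun t => y t - t ^ 2 / 2 - β * t ^ 3 / 6)
      (g' := fun t => y1 t - t - β * t ^ 2 / 2) 3 hM0.le (fun t _ => by
        convert! ((hy t).sub ((hasDerivAt_pow 2 t).div_const 2)).sub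
          (((hasDerivAt_pow 3 t).const_mul β).div_const 6) using 1
        norm_num; ring) T1 ht
    simpa [y0] using this
  have A1 : ∀ t ∈ Icc 0 h, ‖a t - a 0‖ ≤ A * t := fun t ht => by
    simpa using norm_sub_le_pow_succ (g := a) 0 hA (fun t _ => ha t)
      (fun t ht => by simpa using ha1 t ht) ht
  have A2 : ∀ t ∈ Icc 0 h, ‖a t - a 0 - t * a1 0‖ ≤ A * t ^ 2 := fun t ht => by
    have := norm_sub_le_pow_succ (g := fun t : ℝ => a t - a 0 - t * a1 0)
      (g' := fun t => a1 t - a1 0) 1 hA (fun t _ => by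
        convert! ((ha t).sub_const (a 0)).sub
          ((hasDerivAt_id (t : ℂ)).comp_ofReal.mul_const (a1 0)) using 1
        ring)
      (fun t ht => by simpa using ha2 t ht) ht
    simpa using this
  -- the Morse coordinate
  set s : ℝ → ℝ := fun t => √(2 * y t) with hs
  have hsc : Continuous s := by simp only [hs]; fun_prop
  have hs0 : s 0 = 0 := by simp [hs, y0]
  have tM : ∀ t ∈ Ioc 0 h, t * M ≤ 1 / 8 := fun t ht =>
    (mul_le_mul_of_nonneg_right ht.2 hM0.le).trans hhM
  have ratios : ∀ t ∈ Ioc 0 h, |y1 t / t - 1 - β * t / 2| ≤ M * t ^ 2 ∧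
      |(s t / t) ^ 2 - 1 - β * t / 3| ≤ 2 * M * t ^ 2 ∧ 0 < y t ∧ 0 < y1 t ∧ t / 2 ≤ s t := by
    intro t ht
    have t0 := ht.1
    have ht' : t ∈ Icc 0 h := ⟨ht.1.le, ht.2⟩
    have t1 := T1 t ht'
    have t2 := T0 t ht'
    have tm := tM t ht
    have t8 : t ≤ 1 / 8 := (le_mul_of_one_le_right t0.le hM).trans tm
    have r1 : |y1 t / t - 1 - β * t / 2| ≤ M * t ^ 2 := by
      have e : y1 t / t - 1 - β * t / 2 = (y1 t - t - β * t ^ 2 / 2) / t := by field_simp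
      rw [e, abs_div, abs_of_pos t0, div_le_iff₀ t0]
      exact t1.trans_eq (by ring)
    have r2 : |2 * y t / t ^ 2 - 1 - β * t / 3| ≤ 2 * M * t ^ 2 := by
      have e : 2 * y t / t ^ 2 - 1 - β * t / 3 =
          2 * (y t - t ^ 2 / 2 - β * t ^ 3 / 6) / t ^ 2 := by field_simp; ring
      rw [e, abs_div, abs_of_pos (by positivity : 0 < t ^ 2), div_le_iff₀ (by positivity),
        abs_mul, abs_two]
      calc _ ≤ 2 * (M * t ^ 4) := by gcongr
        _ = _ := by ring
    have hβt : |β * t| ≤ 1 / 8 := by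
      rw [abs_mul, abs_of_pos t0]
      calc _ ≤ M * t := by gcongr
        _ ≤ _ := by linarith
    have hMt : M * t ^ 2 ≤ 1 / 64 := by
      calc M * t ^ 2 = (t * M) * t := by ring
        _ ≤ 1 / 8 * (1 / 8) := by gcongr
        _ = _ := by norm_num
    have hβt' := abs_le.1 hβt
    have q2 : 1 / 4 ≤ 2 * y t / t ^ 2 := by
      have := (abs_le.1 r2).1
      linarith
    have q1 : 0 < y1 t / t := by
      have := (abs_le.1 r1).1
      linarith
    have hypos : 0 < y t := by
      have : 0 < 2 * y t / t ^ 2 := by linarith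
      have := (div_pos_iff_of_pos_right (by positivity : 0 < t ^ 2)).1 this
      linarith
    refine ⟨r1, ?_, hypos, (div_pos_iff_of_pos_right t0).1 q1, ?_⟩
    · rw [div_pow, Real.sq_sqrt (by positivity)]; exact r2
    · apply Real.le_sqrt_of_sq_le
      rw [le_div_iff₀ (by positivity)] at q2
      linarith [q2, (by ring : (t / 2) ^ 2 = 1 / 4 * t ^ 2)]
  have hsd : ∀ t ∈ Ioc 0 h, HasDerivAt s (y1 t / s t) t := fun t ht => by
    have := ((hy t).const_mul 2).sqrt (by have := (ratios t ht).2.2.1; positivity)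
    convert! this using 1
    rw [mul_div_mul_left _ _ two_ne_zero]
  have hspos : ∀ t ∈ Ioc 0 h, 0 < s t := fun t ht =>
    lt_of_lt_of_le (by linarith [ht.1]) (ratios t ht).2.2.2.2
  -- Since `s' = y'/s`, the product `G y'` equals `a - a(0) s'`, the amplitude minus its model.
  set G : ℝ → ℂ := fun t => a t / (y1 t : ℂ) - a 0 / (s t : ℂ) with hG
  set G' : ℝ → ℂ := fun t => a1 t / (y1 t : ℂ) - a t * y2 t / (y1 t : ℂ) ^ 2
    + a 0 * y1 t / (s t : ℂ) ^ 3 with hG'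
  have hGd : ∀ t ∈ Ioc 0 h, HasDerivAt G (G' t) t := fun t ht => by
    have n1 : (y1 t : ℂ) ≠ 0 := Complex.ofReal_ne_zero.2 (ratios t ht).2.2.2.1.ne'
    have n2 : (s t : ℂ) ≠ 0 := Complex.ofReal_ne_zero.2 (hspos t ht).ne'
    have := ((ha t).div (hy1 t).ofReal_comp n1).sub
      ((hasDerivAt_const t (a 0)).div (hsd t ht).ofReal_comp n2)
    convert! this using 1
    simp only [hG']
    push_cast
    field_simp
    ring
  have hGb : ∀ t ∈ Ioc 0 h, ‖G t‖ ≤ 2500 * M ^ 2 * A ∧ ‖G' t‖ ≤ 2500 * M ^ 2 * A := by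
    intro t ht
    have ht' : t ∈ Icc 0 h := ⟨ht.1.le, ht.2⟩
    obtain ⟨r1, r2, -, -, -⟩ := ratios t ht
    have := stationary_quotient_bounds (a := a t) (a' := a1 t) hM ht.1 (tM t ht) hβ r1
      (div_nonneg (hspos t ht).le ht.1.le) r2 (T2 t ht') ha0 (ha1 0 ⟨le_rfl, hh.le⟩)
      (A1 t ht') (ha2 t ht') (A2 t ht')
    rw [mul_div_cancel₀ _ ht.1.ne', mul_div_cancel₀ _ ht.1.ne'] at this
    simpa [hG, hG'] using this
  set E : ℝ → ℂ := fun t => Complex.exp (Complex.I * (κ * y t : ℝ)) with hE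
  have hEd : ∀ t, HasDerivAt E (E t * (Complex.I * (κ * y1 t : ℝ))) t := fun t =>
    (((hy t).const_mul κ).ofReal_comp.const_mul Complex.I).cexp
  have hEn : ∀ t, ‖E t‖ = 1 := fun t => by
    simp only [hE]; rw [mul_comm]; exact Complex.norm_exp_ofReal_mul_I _
  have hEc : Continuous E := by simp only [hE]; fun_prop
  have hκc : (κ : ℂ) ≠ 0 := Complex.ofReal_ne_zero.2 hκ.ne'
  -- integration by parts away from the critical point
  have main : ∀ η ∈ Ioc 0 h, ‖(∫ t in η..h, a t * E t) -
      a 0 * ∫ σ in s η..s h, Complex.exp (Complex.I * (κ * (σ ^ 2 / 2) : ℝ))‖ ≤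
        7500 * M ^ 2 * A / κ := by
    intro η hη
    have hsub : ∀ t ∈ uIcc η h, t ∈ Ioc 0 h := fun t ht => by
      rw [uIcc_of_le hη.2] at ht
      exact ⟨hη.1.trans_le ht.1, ht.2⟩
    have n1 : ∀ t ∈ uIcc η h, (y1 t : ℂ) ≠ 0 := fun t ht =>
      Complex.ofReal_ne_zero.2 (ratios t (hsub t ht)).2.2.2.1.ne'
    have n2 : ∀ t ∈ uIcc η h, (s t : ℂ) ≠ 0 := fun t ht =>
      Complex.ofReal_ne_zero.2 (hspos t (hsub t ht)).ne'
    have cG : ContinuousOn G (uIcc η h) := fun t ht =>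
      (hGd t (hsub t ht)).continuousAt.continuousWithinAt
    have cG' : ContinuousOn G' (uIcc η h) := by
      simp only [hG']
      refine ContinuousOn.add (ContinuousOn.sub (ContinuousOn.div ?_ ?_ n1)
        (ContinuousOn.div ?_ ?_ fun t ht => pow_ne_zero 2 (n1 t ht)))
        (ContinuousOn.div ?_ ?_ fun t ht => pow_ne_zero 3 (n2 t ht)) <;> fun_prop
    have csd : ContinuousOn (fun t => y1 t / s t) (uIcc η h) :=
      hy1c.continuousOn.div hsc.continuousOn fun t ht => (hspos t (hsub t ht)).ne'
    have i1 : IntervalIntegrable (fun t => G' t * E t) volume η h :=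
      (cG'.mul hEc.continuousOn).intervalIntegrable
    have i2 : IntervalIntegrable (fun t => G t * (E t * (Complex.I * (κ * y1 t : ℝ))))
        volume η h := by
      refine (cG.mul ?_).intervalIntegrable
      fun_prop
    have ftc := intervalIntegral.integral_eq_sub_of_hasDerivAt
      (fun t ht => (hGd t (hsub t ht)).mul (hEd t)) (i1.add i2)
    rw [intervalIntegral.integral_add i1 i2] at ftc
    have subst : ∫ t in η..h, (y1 t / s t : ℝ) • E t =
        ∫ σ in s η..s h, Complex.exp (Complex.I * (κ * (σ ^ 2 / 2) : ℝ)) := by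
      rw [← intervalIntegral.integral_deriv_smul_comp (f := s) (f' := fun t => y1 t / s t)
        (g := fun σ : ℝ => Complex.exp (Complex.I * (κ * (σ ^ 2 / 2) : ℝ)))
        (fun t ht => hsd t (hsub t ht)) csd (by fun_prop)]
      refine intervalIntegral.integral_congr fun t ht => ?_
      simp only [Function.comp, hE, hs]
      rw [Real.sq_sqrt (by have := (ratios t (hsub t ht)).2.2.1; positivity)]
      congr 5
      ring
    have split : (∫ t in η..h, G t * (E t * (Complex.I * (κ * y1 t : ℝ)))) = Complex.I * κ *
        ((∫ t in η..h, a t * E t) - a 0 * ∫ t in η..h, (y1 t / s t : ℝ) • E t) := by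
      rw [← intervalIntegral.integral_const_mul, ← intervalIntegral.integral_sub,
        ← intervalIntegral.integral_const_mul]
      · refine intervalIntegral.integral_congr fun t ht => ?_
        have := n1 t ht
        have := n2 t ht
        simp only [hG, Complex.real_smul]
        push_cast
        field_simp
      · exact (hac.mul hEc).intervalIntegrable _ _
      · exact ((csd.smul hEc.continuousOn).intervalIntegrable).const_mul _
    rw [← subst]
    have b1 : ‖∫ t in η..h, G' t * E t‖ ≤ 2500 * M ^ 2 * A := by
      have := intervalIntegral.norm_integral_le_of_norm_le_const (a := η) (b := h)
        (f := fun t => G' t * E t) (C := 2500 * M ^ 2 * A) (fun t ht => by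
          rw [norm_mul, hEn, mul_one]
          exact (hGb t (hsub t (uIoc_subset_uIcc ht))).2)
      refine this.trans (mul_le_of_le_one_right (by positivity) ?_)
      rw [abs_of_nonneg (by linarith [hη.2])]
      have : h ≤ h * M := le_mul_of_one_le_right hh.le hM
      linarith [hη.1]
    have b2 : ‖G h * E h - G η * E η‖ ≤ 2500 * M ^ 2 * A + 2500 * M ^ 2 * A := by
      refine norm_sub_le_of_le ?_ ?_ <;> rw [norm_mul, hEn, mul_one]
      exacts [(hGb h ⟨hh, le_rfl⟩).1, (hGb η hη).1]
    have e1 : Complex.I * κ * ((∫ t in η..h, a t * E t) -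
        a 0 * ∫ t in η..h, (y1 t / s t : ℝ) • E t) =
        (G h * E h - G η * E η) - ∫ t in η..h, G' t * E t := by
      rw [← split]
      exact eq_sub_of_add_eq' ftc
    have e2 := norm_sub_le_of_le b2 b1
    rw [← e1, norm_mul, norm_mul, Complex.norm_I, one_mul, Complex.norm_real,
      Real.norm_of_nonneg hκ.le] at e2
    rw [le_div_iff₀ hκ]
    linarith
  -- passage to the critical point
  have lim : ‖(∫ t in (0 : ℝ)..h, a t * E t) -
      a 0 * ∫ σ in (0 : ℝ)..s h, Complex.exp (Complex.I * (κ * (σ ^ 2 / 2) : ℝ))‖ ≤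
        7500 * M ^ 2 * A / κ := by
    have c1 : Continuous fun η => ∫ t in η..h, a t * E t := by
      simp_rw [intervalIntegral.integral_symm h]
      exact (intervalIntegral.continuous_primitive
        (fun _ _ => (hac.mul hEc).intervalIntegrable _ _) h).neg
    have cg : Continuous fun σ : ℝ => Complex.exp (Complex.I * (κ * (σ ^ 2 / 2) : ℝ)) := by
      fun_prop
    have c2 : Continuous fun η =>
        ∫ σ in s η..s h, Complex.exp (Complex.I * (κ * (σ ^ 2 / 2) : ℝ)) := by
      simp_rw [intervalIntegral.integral_symm (s h)]
      exact ((intervalIntegral.continuous_primitive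
        (fun _ _ => cg.intervalIntegrable _ _) (s h)).comp hsc).neg
    have c3 := (c1.sub (c2.const_mul (a 0))).norm.continuousAt (x := 0)
    have := le_of_tendsto (c3.tendsto.mono_left (nhdsWithin_le_nhds (s := Ioi 0)))
      (by filter_upwards [Ioc_mem_nhdsGT hh] with η hη using main η hη)
    simpa only [Pi.sub_apply, hs0] using this
  have hsh := hspos h ⟨hh, le_rfl⟩
  have fr := norm_fresnel_sub_le hκ hsh
  have fr2 : 2 / (s h * κ) ≤ 4 / h / κ := by
    have := (ratios h ⟨hh, le_rfl⟩).2.2.2.2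
    rw [div_div, div_le_div_iff₀ (by positivity) (by positivity)]
    nlinarith
  have := norm_add_le_of_le lim ((norm_mul_le (a 0) _).trans
    (mul_le_mul ha0 (fr.trans fr2) (norm_nonneg _) hA))
  refine le_trans (le_of_eq ?_) (this.trans (le_of_eq ?_))
  · congr 1; ring
  · field_simp

/-- One-sided stationary phase for a normalized phase (`y(0) = y'(0) = 0`, `y''(0) = 1`), with
an error bound that depends only on bounds for the third derivative and its variation. -/
theorem half_stationary_phase {M h κ A : ℝ} (hM : 1 ≤ M) (hh : 0 < h)
    (hhM : h * M ≤ 1 / 8) (hκ : κ ≠ 0) {y y1 y2 y3 : ℝ → ℝ} {a a1 : ℝ → ℂ}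
    (hy : ∀ t, HasDerivAt y (y1 t) t) (hy1 : ∀ t, HasDerivAt y1 (y2 t) t)
    (hy2 : ∀ t, HasDerivAt y2 (y3 t) t) (y0 : y 0 = 0) (y10 : y1 0 = 0) (y20 : y2 0 = 1)
    (hβ : |y3 0| ≤ M) (hy3 : ∀ t ∈ Icc 0 h, |y3 t - y3 0| ≤ M * t)
    (ha : ∀ t, HasDerivAt a (a1 t) t) (ha1c : Continuous a1) (ha0 : ‖a 0‖ ≤ A)
    (ha1 : ∀ t ∈ Icc 0 h, ‖a1 t‖ ≤ A) (ha2 : ∀ t ∈ Icc 0 h, ‖a1 t - a1 0‖ ≤ A * t) :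
    ‖(∫ t in (0 : ℝ)..h, a t * Complex.exp (Complex.I * (κ * y t : ℝ))) -
      a 0 * ((√(2 * Real.pi / |κ|) : ℝ) *
        Complex.exp (Complex.I * (Real.sign κ * Real.pi / 4 : ℝ)) / 2)‖ ≤
      (7500 * M ^ 2 + 4 / h) * A / |κ| := by
  rcases lt_or_gt_of_ne hκ with hneg | hpos
  -- Complex conjugation of the integral changes the sign of `κ` and replaces the amplitude by its
  -- conjugate, which satisfies the same bounds.
  · have conj_d : ∀ {g g' : ℝ → ℂ}, (∀ t, HasDerivAt g (g' t) t) → ∀ t, HasDerivAt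
        (fun t => (starRingEnd ℂ) (g t)) ((starRingEnd ℂ) (g' t)) t := fun hg t =>
      Complex.conjCLE.hasFDerivAt.comp_hasDerivAt t (hg t)
    have key := half_stationary_phase_of_pos (κ := -κ) hM hh hhM (by linarith) hy hy1 hy2 y0 y10
      y20 hβ hy3 (conj_d ha) (Complex.continuous_conj.comp ha1c)
      (by rwa [RCLike.norm_conj] : _ ≤ A) (fun t ht => by rw [RCLike.norm_conj]; exact ha1 t ht)
      (fun t ht => by rw [← map_sub, RCLike.norm_conj]; exact ha2 t ht)
    rw [← RCLike.norm_conj] at key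
    rw [abs_of_neg hneg, Real.sign_of_neg hneg]
    convert! key using 2
    simp only [map_sub, map_mul, map_div₀, Complex.conj_conj, Complex.conj_ofReal, map_ofNat,
      ← Complex.exp_conj, Complex.conj_I]
    congr 1
    · rw [intervalIntegral.intervalIntegral_eq_integral_uIoc, intervalIntegral.intervalIntegral_eq_integral_uIoc]
      simp only [if_pos hh.le, one_smul]
      rw [← integral_conj]
      refine integral_congr_ae (Eventually.of_forall fun t => ?_)
      simp only [map_mul, Complex.conj_conj, ← Complex.exp_conj, Complex.conj_I,
        Complex.conj_ofReal]
      congr 2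
      push_cast
      ring
    · congr 4
      push_cast
      ring
  · rw [abs_of_pos hpos, Real.sign_of_pos hpos, one_mul]
    exact half_stationary_phase_of_pos hM hh hhM hpos hy hy1 hy2 y0 y10 y20 hβ hy3 ha ha1c ha0
      ha1 ha2

/-- Two-sided stationary phase for a normalized phase. -/
theorem stationary_phase {M h κ A : ℝ} (hM : 1 ≤ M) (hh : 0 < h)
    (hhM : h * M ≤ 1 / 8) (hκ : κ ≠ 0) {y y1 y2 y3 : ℝ → ℝ} {a a1 : ℝ → ℂ}
    (hy : ∀ t, HasDerivAt y (y1 t) t) (hy1 : ∀ t, HasDerivAt y1 (y2 t) t)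
    (hy2 : ∀ t, HasDerivAt y2 (y3 t) t) (y0 : y 0 = 0) (y10 : y1 0 = 0) (y20 : y2 0 = 1)
    (hβ : |y3 0| ≤ M) (hy3 : ∀ t ∈ Icc (-h) h, |y3 t - y3 0| ≤ M * |t|)
    (ha : ∀ t, HasDerivAt a (a1 t) t) (ha1c : Continuous a1) (ha0 : ‖a 0‖ ≤ A)
    (ha1 : ∀ t ∈ Icc (-h) h, ‖a1 t‖ ≤ A) (ha2 : ∀ t ∈ Icc (-h) h, ‖a1 t - a1 0‖ ≤ A * |t|) :
    ‖(∫ t in (-h)..h, a t * Complex.exp (Complex.I * (κ * y t : ℝ))) -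
      a 0 * ((√(2 * Real.pi / |κ|) : ℝ) *
        Complex.exp (Complex.I * (Real.sign κ * Real.pi / 4 : ℝ)))‖ ≤
      2 * ((7500 * M ^ 2 + 4 / h) * A / |κ|) := by
  have hsub : ∀ t ∈ Icc 0 h, t ∈ Icc (-h) h := fun t ht => ⟨by linarith [ht.1], ht.2⟩
  have hneg : ∀ t ∈ Icc 0 h, -t ∈ Icc (-h) h := fun t ht =>
    ⟨by linarith [ht.2], by linarith [ht.1]⟩
  have right := half_stationary_phase hM hh hhM hκ hy hy1 hy2 y0 y10 y20 hβ
    (fun t ht => by simpa [abs_of_nonneg ht.1] using hy3 t (hsub t ht)) ha ha1c ha0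
    (fun t ht => ha1 t (hsub t ht))
    (fun t ht => by simpa [abs_of_nonneg ht.1] using ha2 t (hsub t ht))
  have left := half_stationary_phase (y := fun t => y (-t)) (y1 := fun t => -y1 (-t))
    (y2 := fun t => y2 (-t)) (y3 := fun t => -y3 (-t)) (a := fun t => a (-t))
    (a1 := fun t => -a1 (-t)) (A := A) hM hh hhM hκ
    (fun t => hasDerivAt_comp_neg (hy (-t)))
    (fun t => by simpa using (hasDerivAt_comp_neg (hy1 (-t))).fun_neg)
    (fun t => hasDerivAt_comp_neg (hy2 (-t))) (by simpa) (by simpa) (by simpa)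
    (by simpa) (fun t ht => by
      have := hy3 (-t) (hneg t ht)
      rw [abs_neg, abs_of_nonneg ht.1] at this
      rw [neg_zero, neg_sub_neg, abs_sub_comm]
      exact this) (fun t => hasDerivAt_comp_neg (ha (-t))) (by fun_prop) (by simpa)
    (fun t ht => by rw [norm_neg]; exact ha1 (-t) (hneg t ht)) (fun t ht => by
      have := ha2 (-t) (hneg t ht)
      rw [abs_neg, abs_of_nonneg ht.1] at this
      rw [neg_zero, neg_sub_neg, norm_sub_rev]
      exact this)
  have hac : Continuous a := continuous_iff_continuousAt.2 fun t => (ha t).continuousAt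
  have hyc : Continuous y := continuous_iff_continuousAt.2 fun t => (hy t).continuousAt
  have hcont : Continuous fun t => a t * Complex.exp (Complex.I * (κ * y t : ℝ)) := by fun_prop
  have e := intervalIntegral.integral_comp_neg (a := 0) (b := h)
    (fun t => a t * Complex.exp (Complex.I * (κ * y t : ℝ)))
  rw [e, neg_zero] at left
  rw [← intervalIntegral.integral_add_adjacent_intervals (b := 0)
    (hcont.intervalIntegrable _ _) (hcont.intervalIntegrable _ _)]
  refine le_trans (le_of_eq ?_) ((norm_add_le_of_le left right).trans (le_of_eq (two_mul _).symm))
  congr 1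
  ring

/-! ### Oscillatory integrals along a decaying orbit -/

/-- Integration by parts for an oscillatory integral whose amplitude vanishes near the points
where the phase is close to stationary. -/
theorem norm_nonstationary_le {b b' : ℝ → ℂ} {ψ g g' D : ℝ → ℝ} {c ε : ℝ} (hc : 0 < c)
    (hε : 0 < ε) (hb : ∀ t, HasDerivAt b (b' t) t) (hb' : Continuous b')
    (hψ : ∀ t, HasDerivAt ψ (g t) t) (hg : ∀ t, HasDerivAt g (g' t) t) (hg' : Continuous g')
    (hsmall : ∀ t, |g t| < c → b =ᶠ[𝓝 t] 0) (hD : Integrable D)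
    (hbD : ∀ t, ‖b' t‖ / c + ‖b t‖ * |g' t| / c ^ 2 ≤ D t) (hbi : Integrable b)
    (htop : Tendsto b atTop (𝓝 0)) (hbot : Tendsto b atBot (𝓝 0)) :
    ‖∫ t, b t * Complex.exp (Complex.I * (ψ t / ε : ℝ))‖ ≤ ε * ∫ t, D t := by
  have hbc : Continuous b := continuous_iff_continuousAt.2 fun t => (hb t).continuousAt
  have hψc : Continuous ψ := continuous_iff_continuousAt.2 fun t => (hψ t).continuousAt
  have hgc : Continuous g := continuous_iff_continuousAt.2 fun t => (hg t).continuousAt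
  set E : ℝ → ℂ := fun t => Complex.exp (Complex.I * (ψ t / ε : ℝ)) with hE
  have hEd : ∀ t, HasDerivAt E (E t * (Complex.I * (g t / ε : ℝ))) t := fun t =>
    (((hψ t).div_const ε).ofReal_comp.const_mul Complex.I).cexp
  have hEn : ∀ t, ‖E t‖ = 1 := fun t => by
    simp only [hE]; rw [mul_comm]; exact Complex.norm_exp_ofReal_mul_I _
  have hEc : Continuous E := by simp only [hE]; fun_prop
  set H : ℝ → ℂ := fun t => b t / g t with hH
  set H' : ℝ → ℂ := fun t => b' t / g t - b t * g' t / (g t : ℂ) ^ 2 with hH'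
  -- Where `|g| < c` the amplitude vanishes on a neighbourhood. Hence `b / g` is differentiable on
  -- the whole line, the zeros of `g` included, where division by zero returns the correct value
  -- `0`.
  have zero_of_small : ∀ t, |g t| < c → b t = 0 ∧ b' t = 0 := fun t ht =>
    ⟨(hsmall t ht).self_of_nhds, (hb t).unique
      ((hasDerivAt_const t (0 : ℂ)).congr_of_eventuallyEq (hsmall t ht))⟩
  have hHd : ∀ t, HasDerivAt H (H' t) t := fun t => by
    rcases lt_or_ge |g t| c with ht | ht
    · have h0 := zero_of_small t ht
      have : H' t = 0 := by simp [hH', h0]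
      rw [this]
      refine (hasDerivAt_const t (0 : ℂ)).congr_of_eventuallyEq ?_
      filter_upwards [hsmall t ht] with s hs
      simp [hH, hs]
    · have hgt : (g t : ℂ) ≠ 0 := Complex.ofReal_ne_zero.2 (abs_pos.1 (hc.trans_le ht))
      convert! (hb t).fun_div (hg t).ofReal_comp hgt using 1
      simp only [hH']
      field_simp
  have hH'n : ∀ t, ‖H' t‖ ≤ D t := fun t => by
    refine le_trans ?_ (hbD t)
    rcases lt_or_ge |g t| c with ht | ht
    · have h0 := zero_of_small t ht
      simp [hH', h0]
    · refine norm_sub_le_of_le ?_ ?_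
      · rw [norm_div, Complex.norm_real, Real.norm_eq_abs]; gcongr
      · rw [norm_div, norm_mul, norm_pow, Complex.norm_real, Complex.norm_real,
          Real.norm_eq_abs, Real.norm_eq_abs]
        gcongr
  have hHn : ∀ t, ‖H t‖ ≤ ‖b t‖ / c := fun t => by
    rcases lt_or_ge |g t| c with ht | ht
    · have h0 := zero_of_small t ht
      simp [hH, h0]
    · rw [norm_div, Complex.norm_real, Real.norm_eq_abs]; gcongr
  have hHg : ∀ t, H t * g t = b t := fun t => by
    rcases eq_or_ne (g t) 0 with ht | ht
    · rw [(zero_of_small t (by rwa [ht, abs_zero])).1, ht]; simp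
    · exact div_mul_cancel₀ _ (Complex.ofReal_ne_zero.2 ht)
  have mH' : AEStronglyMeasurable H' volume := by
    refine Measurable.aestronglyMeasurable ?_
    have m1 := hb'.measurable
    have m2 := Complex.measurable_ofReal.comp hgc.measurable
    have m3 := Complex.measurable_ofReal.comp hg'.measurable
    exact (m1.div m2).sub ((hbc.measurable.mul m3).div (m2.pow_const 2))
  have iH' : Integrable H' := hD.mono' mH' (Eventually.of_forall hH'n)
  have i1 : Integrable fun t => H' t * E t :=
    iH'.mono (mH'.mul hEc.aestronglyMeasurable)
      (Eventually.of_forall fun t => by rw [norm_mul, hEn, mul_one])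
  have i2 : Integrable fun t => b t * E t :=
    hbi.mono (hbc.mul hEc).aestronglyMeasurable
      (Eventually.of_forall fun t => by rw [norm_mul, hEn, mul_one])
  have i3 : Integrable fun t => (Complex.I / ε) * (b t * E t) := i2.const_mul _
  have hεc : (ε : ℂ) ≠ 0 := Complex.ofReal_ne_zero.2 hε.ne'
  have hd : ∀ t, HasDerivAt (fun t => H t * E t)
      (H' t * E t + (Complex.I / ε) * (b t * E t)) t := fun t => by
    convert! (hHd t).fun_mul (hEd t) using 1
    rw [← hHg t]
    push_cast
    ring
  have lim : ∀ l : Filter ℝ, Tendsto b l (𝓝 0) → Tendsto (fun t => H t * E t) l (𝓝 0) :=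
    fun l hl => by
      have : Tendsto (fun t => ‖b t‖ / c) l (𝓝 0) := by simpa using hl.norm.div_const c
      refine squeeze_zero_norm (fun t => ?_) this
      rw [norm_mul, hEn, mul_one]
      exact hHn t
  have ftc := integral_of_hasDerivAt_of_tendsto hd (i1.add i3) (lim _ hbot) (lim _ htop)
  rw [integral_add i1 i3, integral_const_mul, sub_zero] at ftc
  have e : ∫ t, b t * E t = (Complex.I * ε) * ∫ t, H' t * E t := by
    rw [eq_neg_of_add_eq_zero_left ftc]
    field_simp
    linear_combination (∫ t, b t * E t) * Complex.I_sq
  rw [e, norm_mul, norm_mul, Complex.norm_I, one_mul, Complex.norm_real,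
    Real.norm_of_nonneg hε.le]
  gcongr
  exact norm_integral_le_of_norm_le hD (Eventually.of_forall fun t => by
    rw [norm_mul, hEn, mul_one]; exact hH'n t)

/-- A smooth cutoff function with its first two derivatives and a common bound. -/
theorem exists_cutoff {h : ℝ} (hh : 0 < h) : ∃ χ χ1 χ2 : ℝ → ℝ, ∃ B : ℝ, 1 ≤ B ∧
    (∀ t, HasDerivAt χ (χ1 t) t) ∧ (∀ t, HasDerivAt χ1 (χ2 t) t) ∧ Continuous χ2 ∧
    (∀ t, |t| ≤ h / 4 → χ t = 1) ∧ (∀ t, h / 2 ≤ |t| → χ t = 0) ∧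
    (∀ t, |χ t| ≤ B ∧ |χ1 t| ≤ B ∧ |χ2 t| ≤ B) := by
  let φ : ContDiffBump (0 : ℝ) := ⟨h / 4, h / 2, by positivity, by linarith⟩
  have hφ : ContDiff ℝ 3 φ := φ.contDiff
  have h1 : ContDiff ℝ 2 (deriv φ) := (contDiff_succ_iff_deriv.1 hφ).2.2
  have h2 : ContDiff ℝ 1 (deriv (deriv φ)) := (contDiff_succ_iff_deriv.1 h1).2.2
  have c0 : HasCompactSupport φ := φ.hasCompactSupport
  have c1 : HasCompactSupport (deriv φ) := c0.deriv
  have c2 : HasCompactSupport (deriv (deriv φ)) := c1.deriv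
  obtain ⟨B0, hB0⟩ := c0.exists_bound_of_continuous hφ.continuous
  obtain ⟨B1, hB1⟩ := c1.exists_bound_of_continuous h1.continuous
  obtain ⟨B2, hB2⟩ := c2.exists_bound_of_continuous h2.continuous
  refine ⟨φ, deriv φ, deriv (deriv φ), max 1 (max B0 (max B1 B2)), le_max_left _ _,
    fun t => ((hφ.differentiable (by norm_num)) t).hasDerivAt,
    fun t => ((h1.differentiable (by norm_num)) t).hasDerivAt, h2.continuous,
    fun t ht => φ.one_of_mem_closedBall (by simpa [φ] using ht),
    fun t ht => φ.zero_of_le_dist (by simpa [φ] using ht), fun t => ⟨?_, ?_, ?_⟩⟩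
  · exact (hB0 t).trans (by simp)
  · exact (hB1 t).trans (by simp)
  · exact (hB2 t).trans (by simp)

/-- A bounded, integrable solution of `x' = v`, `v' = w`, `w' = a v` that comes to rest at `±∞`;
for an orbit of `x'' = f(x)`, `w = f(x)` and `a = f'(x)`. -/
structure DecayingOrbit (X V W a a1 : ℝ → ℝ) (L : ℝ) : Prop where
  hX : ∀ t, HasDerivAt X (V t) t
  hV : ∀ t, HasDerivAt V (W t) t
  hW : ∀ t, HasDerivAt W (a t * V t) t
  ha : ∀ t, HasDerivAt a (a1 t) t
  ha1 : Continuous a1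
  one_le : 1 ≤ L
  bV : ∀ t, |V t| ≤ L
  bW : ∀ t, |W t| ≤ L
  ba : ∀ t, |a t| ≤ L
  ba1 : ∀ t, |a1 t| ≤ L
  iV : Integrable V
  iW : Integrable W
  top : Tendsto V atTop (𝓝 0)
  bot : Tendsto V atBot (𝓝 0)

/-- Grönwall's inequality in both directions of time: the derivative of `V² + W²` is at most `1 + L`
times `V² + W²` in absolute value. It makes the speeds at nearby times comparable, however small
they are. -/
theorem sq_add_sq_le_exp {V W a : ℝ → ℝ} {L : ℝ} (hV : ∀ t, HasDerivAt V (W t) t)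
    (hW : ∀ t, HasDerivAt W (a t * V t) t) (ba : ∀ t, |a t| ≤ L) (s t : ℝ) :
    V t ^ 2 + W t ^ 2 ≤ Real.exp ((1 + L) * |t - s|) * (V s ^ 2 + W s ^ 2) := by
  have hR : ∀ t, HasDerivAt (fun t => V t ^ 2 + W t ^ 2) (2 * V t * W t * (1 + a t)) t :=
    fun t => by
      convert! ((hV t).fun_pow 2).fun_add ((hW t).fun_pow 2) using 1
      push_cast
      ring
  have hb : ∀ t, |2 * V t * W t * (1 + a t)| ≤ (1 + L) * (V t ^ 2 + W t ^ 2) := fun t => by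
    rw [abs_mul, mul_comm]
    have h1 : |1 + a t| ≤ 1 + L := (abs_add_le _ _).trans (by simpa using ba t)
    have h2 : |2 * V t * W t| ≤ V t ^ 2 + W t ^ 2 :=
      abs_le.2 ⟨by nlinarith [sq_nonneg (V t + W t)], by nlinarith [sq_nonneg (V t - W t)]⟩
    exact mul_le_mul h1 h2 (abs_nonneg _) ((abs_nonneg _).trans h1)
  have hexp : ∀ σ t : ℝ, HasDerivAt (fun t => (V t ^ 2 + W t ^ 2) * Real.exp (σ * t))
      ((2 * V t * W t * (1 + a t) + σ * (V t ^ 2 + W t ^ 2)) * Real.exp (σ * t)) t :=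
    fun σ t => by
      convert! (hR t).fun_mul (((hasDerivAt_id t).const_mul σ).exp) using 1
      simp only [id]
      ring
  rcases le_total s t with h | h
  · have anti : Antitone fun t => (V t ^ 2 + W t ^ 2) * Real.exp (-(1 + L) * t) :=
      antitone_of_hasDerivAt_nonpos (hexp _) fun t =>
        mul_nonpos_of_nonpos_of_nonneg (by linarith [(abs_le.1 (hb t)).2]) (Real.exp_pos _).le
    have := anti h
    simp only at this
    rw [abs_of_nonneg (by linarith)]
    have e : Real.exp ((1 + L) * (t - s)) = Real.exp (-(1 + L) * s) / Real.exp (-(1 + L) * t) := by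
      rw [← Real.exp_sub]; congr 1; ring
    rw [e, div_mul_eq_mul_div, le_div_iff₀ (Real.exp_pos _)]
    linarith
  · have mono : Monotone fun t => (V t ^ 2 + W t ^ 2) * Real.exp ((1 + L) * t) :=
      monotone_of_hasDerivAt_nonneg (hexp _) fun t =>
        mul_nonneg (by linarith [(abs_le.1 (hb t)).1])
          (Real.exp_pos _).le
    have := mono h
    simp only at this
    rw [abs_of_nonpos (by linarith)]
    have e : Real.exp ((1 + L) * -(t - s)) = Real.exp ((1 + L) * s) / Real.exp ((1 + L) * t) := by
      rw [← Real.exp_sub]; congr 1; ring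
    rw [e, div_mul_eq_mul_div, le_div_iff₀ (Real.exp_pos _)]
    linarith

/-- A function whose derivative is at least `m` near `t` vanishes near `t` if it is small there. -/
theorem exists_zero_near {g g' : ℝ → ℝ} {t d m : ℝ} (hd : 0 ≤ d)
    (hg : ∀ s, HasDerivAt g (g' s) s) (hm : ∀ s, |s - t| ≤ d → m ≤ g' s) (ht : |g t| ≤ m * d) :
    ∃ s, |s - t| ≤ d ∧ g s = 0 := by
  have hgc : Continuous g := continuous_iff_continuousAt.2 fun t => (hg t).continuousAt
  have h := abs_le.1 ht
  have mvt : ∀ x y, t - d ≤ x → x ≤ y → y ≤ t + d → m * (y - x) ≤ g y - g x := by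
    intro x y hx hxy hy
    refine (convex_Icc x y).mul_sub_le_image_sub_of_le_deriv hgc.continuousOn
      (fun s _ => (hg s).differentiableAt.differentiableWithinAt) (fun s hs => ?_) x
      (left_mem_Icc.2 hxy) y (right_mem_Icc.2 hxy) hxy
    rw [(hg s).deriv]
    rw [interior_Icc] at hs
    exact hm s (abs_le.2 ⟨by linarith [hs.1], by linarith [hs.2]⟩)
  have h1 := mvt (t - d) t le_rfl (by linarith) (by linarith)
  have h2 := mvt t (t + d) (by linarith) (by linarith) le_rfl
  obtain ⟨s, hs, hs0⟩ := intermediate_value_Icc (by linarith : t - d ≤ t + d) hgc.continuousOn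
    (show (0 : ℝ) ∈ Icc (g (t - d)) (g (t + d)) from ⟨by linarith, by linarith⟩)
  exact ⟨s, abs_le.2 ⟨by linarith [hs.1], by linarith [hs.2]⟩, hs0⟩

namespace DecayingOrbit

variable {X V W a a1 : ℝ → ℝ} {L : ℝ}

/-- Grönwall compares the speed on the window with the speed at `t`, and the nondegeneracy
inequality bounds the latter by `|W t|`. The scale `|W t|` thus governs the orbit on the whole
window, uniformly in the position of `t` along the tail. -/
theorem window (o : DecayingOrbit X V W a a1 L) {c t : ℝ} (hc : 0 < c) (hc1 : c ≤ 1)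
    (ht : c * |V t| ≤ |W t|) {s : ℝ} (hs : |s - t| ≤ 1) :
    |V s| ≤ 2 * Real.exp (1 + L) / c * |W t| ∧ |W s| ≤ 2 * Real.exp (1 + L) / c * |W t| := by
  have hL := o.one_le
  have h1 := sq_add_sq_le_exp o.hV o.hW o.ba t s
  have h2 : Real.exp ((1 + L) * |s - t|) ≤ Real.exp (1 + L) :=
    Real.exp_le_exp.2 (mul_le_of_le_one_right (by linarith) hs)
  have h3 : V t ^ 2 + W t ^ 2 ≤ 2 / c ^ 2 * |W t| ^ 2 := by
    have : (c * |V t|) ^ 2 ≤ |W t| ^ 2 := by gcongr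
    rw [mul_pow, sq_abs] at this
    have hW2 : c ^ 2 * |W t| ^ 2 ≤ |W t| ^ 2 :=
      mul_le_of_le_one_left (by positivity) (pow_le_one₀ hc.le hc1)
    rw [div_mul_eq_mul_div, le_div_iff₀ (by positivity), ← sq_abs (W t)]
    linarith
  have he : 1 ≤ Real.exp (1 + L) := Real.one_le_exp (by linarith)
  have h4 : V s ^ 2 + W s ^ 2 ≤ (2 * Real.exp (1 + L) / c * |W t|) ^ 2 := by
    calc _ ≤ Real.exp (1 + L) * (2 / c ^ 2 * |W t| ^ 2) :=
          h1.trans (mul_le_mul h2 h3 (by positivity) (by positivity))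
      _ ≤ (2 * Real.exp (1 + L) ^ 2) * (2 / c ^ 2 * |W t| ^ 2) := by
          gcongr
          nlinarith
      _ = _ := by ring
  have h5 : 0 ≤ 2 * Real.exp (1 + L) / c * |W t| := by positivity
  exact ⟨abs_le_of_sq_le_sq (by nlinarith [sq_nonneg (W s)]) h5,
    abs_le_of_sq_le_sq (by nlinarith [sq_nonneg (V s)]) h5⟩

/-- Since `W' = a V` is `O(|W t|)` on the window, a width `h` chosen independently of `t` keeps the
relative change of `W` below one half. In particular `W` keeps its sign, which separates critical
points and locates zeros of the phase derivative. -/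
theorem window_W (o : DecayingOrbit X V W a a1 L) {c t h : ℝ} (hc : 0 < c) (hc1 : c ≤ 1)
    (ht : c * |V t| ≤ |W t|) (h1 : h ≤ 1)
    (hh : h * (L * (2 * Real.exp (1 + L) / c)) ≤ 1 / 2) {s : ℝ} (hs : |s - t| ≤ h) :
    |W s - W t| ≤ |W t| / 2 := by
  have h0 : 0 ≤ h := (abs_nonneg _).trans hs
  have := (convex_Icc (t - h) (t + h)).norm_image_sub_le_of_norm_hasDerivWithin_le
    (C := L * (2 * Real.exp (1 + L) / c * |W t|)) (x := t) (y := s)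
    (fun x _ => (o.hW x).hasDerivWithinAt) (fun x hx => by
      rw [norm_mul, Real.norm_eq_abs, Real.norm_eq_abs]
      exact mul_le_mul (o.ba x) (o.window hc hc1 ht
        ((abs_le.2 ⟨by linarith [hx.1], by linarith [hx.2]⟩ : |x - t| ≤ h).trans h1)).1
        (abs_nonneg _) (by linarith [o.one_le]))
    ⟨by linarith, by linarith⟩ ⟨by linarith [(abs_le.1 hs).1], by linarith [(abs_le.1 hs).2]⟩
  rw [Real.norm_eq_abs, Real.norm_eq_abs] at this
  refine this.trans ?_
  have hL := o.one_le
  calc _ ≤ L * (2 * Real.exp (1 + L) / c * |W t|) * h := by gcongr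
    _ = h * (L * (2 * Real.exp (1 + L) / c)) * |W t| := by ring
    _ ≤ 1 / 2 * |W t| := by gcongr
    _ = _ := by ring

/-- Two points with the same velocity are separated. -/
theorem separated (o : DecayingOrbit X V W a a1 L) {c h t t' : ℝ} (hc : 0 < c) (hc1 : c ≤ 1)
    (h1 : h ≤ 1) (hh : h * (L * (2 * Real.exp (1 + L) / c)) ≤ 1 / 2)
    (ht : c * |V t| ≤ |W t|) (hV0 : V t ≠ 0) (hV : V t = V t') (hne : t ≠ t') : h < |t' - t| := by
  by_contra hle
  rw [not_lt] at hle
  have hVc : Continuous V := continuous_iff_continuousAt.2 fun t => (o.hV t).continuousAt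
  have hW0 : W t ≠ 0 := fun h0 => by
    rw [h0, abs_zero] at ht
    exact absurd ht (not_le.2 (mul_pos hc (abs_pos.2 hV0)))
  have hz : ∃ s, |s - t| ≤ h ∧ W s = 0 := by
    have hle' := abs_le.1 hle
    rcases lt_or_gt_of_ne hne with hlt | hlt
    · obtain ⟨s, hs, hs0⟩ := exists_hasDerivAt_eq_zero hlt hVc.continuousOn hV fun x _ => o.hV x
      exact ⟨s, abs_le.2 ⟨by linarith [hs.1], by linarith [hs.2]⟩, hs0⟩
    · obtain ⟨s, hs, hs0⟩ := exists_hasDerivAt_eq_zero hlt hVc.continuousOn hV.symm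
        fun x _ => o.hV x
      exact ⟨s, abs_le.2 ⟨by linarith [hs.1], by linarith [hs.2]⟩, hs0⟩
  obtain ⟨s, hs, hs0⟩ := hz
  have := o.window_W hc hc1 ht h1 hh hs
  rw [hs0, zero_sub, abs_neg] at this
  linarith [abs_pos.2 hW0]

/-- A point where the phase `k X + μ t` is close to stationary is close to a critical point. -/
theorem near_critical (o : DecayingOrbit X V W a a1 L) {c h k μ μ0 t : ℝ} (hc : 0 < c)
    (hc1 : c ≤ 1) (h0 : 0 < h) (h1 : h ≤ 1)
    (hh : h * (L * (2 * Real.exp (1 + L) / c)) ≤ 1 / 2) (hμ : μ0 ≤ |μ|)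
    (hU : ∀ t, |k * V t + μ| ≤ c → c * |V t| ≤ |W t|)
    (ht : |k * V t + μ| < min c (min (μ0 / 2) (c * μ0 * h / 32))) :
    ∃ s, |s - t| < h / 4 ∧ k * V s + μ = 0 := by
  obtain ⟨b1, b2⟩ := lt_min_iff.1 ht
  obtain ⟨b2, b3⟩ := lt_min_iff.1 b2
  have hg := hU t b1.le
  have hkV : μ0 / 2 ≤ |k| * |V t| := by
    rw [← abs_mul]
    have := abs_sub_abs_le_abs_add μ (k * V t)
    rw [add_comm μ] at this
    linarith
  have hkW : c * μ0 / 2 ≤ |k * W t| := by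
    rw [abs_mul]
    have := mul_le_mul_of_nonneg_left hg (abs_nonneg k)
    nlinarith
  have hder : ∀ s, HasDerivAt (fun s => k * V s + μ) (k * W s) s := fun s =>
    ((o.hV s).const_mul k).add_const μ
  have hnear : ∀ s, |s - t| ≤ h / 8 → |k * W s - k * W t| ≤ |k * W t| / 2 := fun s hs => by
    rw [← mul_sub, abs_mul, abs_mul, mul_div_assoc]
    exact mul_le_mul_of_nonneg_left (o.window_W hc hc1 hg h1 hh (by linarith)) (abs_nonneg _)
  -- On this interval the slope of `k V + μ` has constant sign and modulus at least `c * μ0 / 4`.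
  -- The threshold `c * μ0 * h / 32` is this slope times `h / 8`.
  have hz : ∃ s, |s - t| ≤ h / 8 ∧ k * V s + μ = 0 := by
    rcases le_total 0 (k * W t) with hp | hp
    · refine exists_zero_near (m := |k * W t| / 2) (by linarith) hder (fun s hs => ?_) ?_
      · have := (abs_le.1 (hnear s hs)).1
        rw [abs_of_nonneg hp] at this ⊢
        linarith
      · nlinarith
    · have hlow : ∀ s, |s - t| ≤ h / 8 → |k * W t| / 2 ≤ -(k * W s) := fun s hs => by
        have := (abs_le.1 (hnear s hs)).2
        rw [abs_of_nonpos hp] at this ⊢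
        linarith
      obtain ⟨s, hs, hs0⟩ := exists_zero_near (by linarith) (fun s => (hder s).fun_neg) hlow
        (by rw [abs_neg]; nlinarith)
      exact ⟨s, hs, neg_eq_zero.1 hs0⟩
  obtain ⟨s, hs, hs0⟩ := hz
  exact ⟨s, by linarith, hs0⟩

end DecayingOrbit

/-- The stationary phase contribution of the critical point `t` of the phase `k X + μ t` to the
integral of `V Q(V)`. -/
def criticalContribution (X V W : ℝ → ℝ) (Q : ℝ → ℂ) (k μ ε t : ℝ) : ℂ :=
  V t * Q (V t) * ((√(2 * Real.pi / |k * W t / ε|) : ℝ) *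
    Complex.exp (Complex.I * (Real.sign (k * W t / ε) * Real.pi / 4 : ℝ))) *
    Complex.exp (Complex.I * ((k * X t + μ * t) / ε : ℝ))

namespace DecayingOrbit

variable {X V W a a1 : ℝ → ℝ} {L : ℝ}

theorem amplitude_deriv (o : DecayingOrbit X V W a a1 L) {Q Q1 : ℝ → ℂ}
    (hQ : ∀ v, HasDerivAt Q (Q1 v) v) (s : ℝ) :
    HasDerivAt (fun s => V s * Q (V s)) (W s * (Q (V s) + V s * Q1 (V s))) s := by
  have hQV : HasDerivAt (fun s => Q (V s)) (W s * Q1 (V s)) s := by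
    have := (hQ (V s)).scomp s (o.hV s)
    rwa [Complex.real_smul] at this
  convert! (o.hV s).ofReal_comp.fun_mul hQV using 1
  ring

theorem amplitude_deriv_deriv (o : DecayingOrbit X V W a a1 L) {Q Q1 Q2 : ℝ → ℂ}
    (hQ : ∀ v, HasDerivAt Q (Q1 v) v) (hQ1 : ∀ v, HasDerivAt Q1 (Q2 v) v) (s : ℝ) :
    HasDerivAt (fun s => W s * (Q (V s) + V s * Q1 (V s)))
      ((a s * V s : ℝ) * (Q (V s) + V s * Q1 (V s)) +
        W s * (W s * (2 * Q1 (V s) + V s * Q2 (V s)))) s := by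
  have hQV : HasDerivAt (fun s => Q (V s)) (W s * Q1 (V s)) s := by
    have := (hQ (V s)).scomp s (o.hV s)
    rwa [Complex.real_smul] at this
  convert! (o.hW s).ofReal_comp.fun_mul (hQV.fun_add (o.amplitude_deriv hQ1 s)) using 1
  ring

/-- Dividing the phase by `W t` normalizes its second derivative at `t`, with large parameter `k W t
/ ε`. The amplitude and its first two derivatives are `O(|W t|)`, so in the stationary phase error
`A / |κ|` the factor `|W t|` drops out and `ε / |k|` remains. -/
theorem window_integral (o : DecayingOrbit X V W a a1 L) {c h k μ ε t K : ℝ} (hc : 0 < c)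
    (hc1 : c ≤ 1) (h0 : 0 < h) (h1 : h ≤ 1) (hK : K = 2 * Real.exp (1 + L) / c)
    (hh : h * (L * K) ≤ 1 / 8) (hk : k ≠ 0) (hε : 0 < ε)
    (ht : k * V t + μ = 0) (hW0 : W t ≠ 0) (hVW : c * |V t| ≤ |W t|)
    {χ χ1 χ2 : ℝ → ℝ} {B : ℝ} (hχ : ∀ t, HasDerivAt χ (χ1 t) t)
    (hχ1 : ∀ t, HasDerivAt χ1 (χ2 t) t) (χeq1 : ∀ t, |t| ≤ h / 4 → χ t = 1)
    (χeq0 : ∀ t, h / 2 ≤ |t| → χ t = 0) (χB : ∀ t, |χ t| ≤ B ∧ |χ1 t| ≤ B ∧ |χ2 t| ≤ B)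
    {Q Q1 Q2 : ℝ → ℂ} {B0 B1 B2 : ℝ} (hQ : ∀ v, HasDerivAt Q (Q1 v) v)
    (hQ1 : ∀ v, HasDerivAt Q1 (Q2 v) v) (hB0 : ∀ v, |v| ≤ L → ‖Q v‖ ≤ B0)
    (hB1 : ∀ v, |v| ≤ L → ‖Q1 v‖ ≤ B1) (hB2 : ∀ v, |v| ≤ L → ‖Q2 v‖ ≤ B2) :
    ‖(∫ s, V s * Q (V s) * χ (s - t) * Complex.exp (Complex.I * ((k * X s + μ * s) / ε : ℝ))) -
      criticalContribution X V W Q k μ ε t‖ ≤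
      ε * (2 * (7500 * (2 * L * K) ^ 2 + 8 / h) * (12 * B * L ^ 2 * K) * (B0 + B1 + B2) / |k|) := by
  have hL := o.one_le
  have hB : 0 ≤ B := (abs_nonneg _).trans (χB 0).1
  have hBB0 : 0 ≤ B0 := (norm_nonneg _).trans (hB0 0 (by simpa using by linarith))
  have hBB1 : 0 ≤ B1 := (norm_nonneg _).trans (hB1 0 (by simpa using by linarith))
  have hBB2 : 0 ≤ B2 := (norm_nonneg _).trans (hB2 0 (by simpa using by linarith))
  have hK1 : 1 ≤ K := by
    rw [hK, le_div_iff₀ hc]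
    have := Real.one_le_exp (by linarith : 0 ≤ 1 + L)
    linarith
  set w := |W t| with hw
  have hwpos : 0 < w := abs_pos.2 hW0
  have win : ∀ s, |s| ≤ 1 → |V (t + s)| ≤ K * w ∧ |W (t + s)| ≤ K * w := fun s hs => by
    rw [hK]; exact o.window hc hc1 hVW (by simpa using hs)
  -- the amplitude in the window
  set S := B0 + B1 + B2 with hS
  have hS0 : 0 ≤ S := by positivity
  set U := 3 * L ^ 2 * K * w * S with hU
  have hU0 : 0 ≤ U := by positivity
  have LL : L ≤ L ^ 2 := by nlinarith
  have nu : ∀ s, |s| ≤ 1 → ‖(V (t + s) : ℂ) * Q (V (t + s))‖ ≤ U := fun s hs => by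
    rw [norm_mul, Complex.norm_real]
    calc _ ≤ K * w * B0 := mul_le_mul (win s hs).1 (hB0 _ (o.bV _)) (norm_nonneg _) (by positivity)
      _ ≤ K * w * (3 * L ^ 2 * S) := by
        gcongr
        calc B0 ≤ 1 * S := by linarith
          _ ≤ 3 * L ^ 2 * S := by gcongr; linarith
      _ = U := by ring
  have nQ : ∀ s, ‖Q (V (t + s)) + V (t + s) * Q1 (V (t + s))‖ ≤ B0 + L * B1 := fun s => by
    refine norm_add_le_of_le (hB0 _ (o.bV _)) ?_
    rw [norm_mul, Complex.norm_real]
    exact mul_le_mul (o.bV _) (hB1 _ (o.bV _)) (norm_nonneg _) (by linarith)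
  have sum1 : B0 + L * B1 ≤ L * S := by
    have : 1 * B0 ≤ L * B0 := by gcongr
    have : 0 ≤ L * B2 := by positivity
    rw [hS]; linarith
  have nu1 : ∀ s, |s| ≤ 1 → ‖(W (t + s) : ℂ) * (Q (V (t + s)) + V (t + s) * Q1 (V (t + s)))‖ ≤ U :=
    fun s hs => by
    rw [norm_mul, Complex.norm_real]
    calc _ ≤ K * w * (L * S) :=
          mul_le_mul (win s hs).2 ((nQ s).trans sum1) (norm_nonneg _) (by positivity)
      _ ≤ K * w * (3 * L ^ 2 * S) := by gcongr; linarith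
      _ = U := by ring
  have nu2 : ∀ s, |s| ≤ 1 → ‖((a (t + s) * V (t + s) : ℝ) : ℂ) *
      (Q (V (t + s)) + V (t + s) * Q1 (V (t + s))) + W (t + s) * (W (t + s) *
        (2 * Q1 (V (t + s)) + V (t + s) * Q2 (V (t + s))))‖ ≤ U := fun s hs => by
    have p1 : ‖((a (t + s) * V (t + s) : ℝ) : ℂ) *
        (Q (V (t + s)) + V (t + s) * Q1 (V (t + s)))‖ ≤ L * (K * w) * (L * S) := by
      rw [norm_mul, Complex.norm_real, norm_mul]
      exact mul_le_mul (mul_le_mul (o.ba _) (win s hs).1 (norm_nonneg _) (by linarith))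
        ((nQ s).trans sum1) (norm_nonneg _) (by positivity)
    have p2 : ‖(W (t + s) : ℂ) * (W (t + s) *
        (2 * Q1 (V (t + s)) + V (t + s) * Q2 (V (t + s))))‖ ≤ K * w * (L * (2 * B1 + L * B2)) := by
      rw [norm_mul, norm_mul, Complex.norm_real]
      refine mul_le_mul (win s hs).2 (mul_le_mul (o.bW _) ?_ (norm_nonneg _) (by linarith))
        (by positivity) (by positivity)
      refine norm_add_le_of_le ?_ ?_
      · rw [norm_mul, Complex.norm_ofNat]
        exact mul_le_mul_of_nonneg_left (hB1 _ (o.bV _)) (by norm_num)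
      · rw [norm_mul, Complex.norm_real]
        exact mul_le_mul (o.bV _) (hB2 _ (o.bV _)) (norm_nonneg _) (by linarith)
    have sum2 : 2 * B1 + L * B2 ≤ 2 * L * S := by
      have : 1 * B1 ≤ L * B1 := by gcongr
      have : 0 ≤ L * B2 := by positivity
      have : 0 ≤ L * B0 := by positivity
      rw [hS]; linarith
    refine (norm_add_le_of_le p1 p2).trans ?_
    calc _ ≤ L * (K * w) * (L * S) + K * w * (L * (2 * L * S)) := by gcongr
      _ = U := by ring
  have hVc : Continuous V := continuous_iff_continuousAt.2 fun t => (o.hV t).continuousAt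
  have hWc : Continuous W := continuous_iff_continuousAt.2 fun t => (o.hW t).continuousAt
  have hQc : Continuous Q := continuous_iff_continuousAt.2 fun t => (hQ t).continuousAt
  have hQ1c : Continuous Q1 := continuous_iff_continuousAt.2 fun t => (hQ1 t).continuousAt
  have hχc : Continuous χ := continuous_iff_continuousAt.2 fun t => (hχ t).continuousAt
  have hχ1c : Continuous χ1 := continuous_iff_continuousAt.2 fun t => (hχ1 t).continuousAt
  have shift : ∀ {E : Type} [NormedAddCommGroup E] [NormedSpace ℝ E] {g g' : ℝ → E},
      (∀ s, HasDerivAt g (g' s) s) → ∀ s, HasDerivAt (fun s => g (t + s)) (g' (t + s)) s :=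
    fun hg s => (hg (t + s)).comp_const_add t s
  set A0 : ℝ → ℂ := fun s => V (t + s) * Q (V (t + s)) * χ s with hA0
  set A1 : ℝ → ℂ := fun s => W (t + s) * (Q (V (t + s)) + V (t + s) * Q1 (V (t + s))) * χ s +
    V (t + s) * Q (V (t + s)) * χ1 s with hA1
  have dA0 : ∀ s, HasDerivAt A0 (A1 s) s := fun s =>
    (shift (o.amplitude_deriv hQ) s).fun_mul (hχ s).ofReal_comp
  have dA1 : ∀ s, HasDerivAt A1 _ s := fun s =>
    ((shift (o.amplitude_deriv_deriv hQ hQ1) s).fun_mul (hχ s).ofReal_comp).fun_add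
      ((shift (o.amplitude_deriv hQ) s).fun_mul (hχ1 s).ofReal_comp)
  have mulB : ∀ {z : ℂ} {x : ℝ}, ‖z‖ ≤ U → |x| ≤ B → ‖z * (x : ℂ)‖ ≤ U * B := fun hz hx => by
    rw [norm_mul, Complex.norm_real]
    exact mul_le_mul hz hx (norm_nonneg _) hU0
  have hA4 : U * B ≤ 4 * (U * B) := by linarith [mul_nonneg hU0 hB]
  have hh2 : ∀ s ∈ Icc (-(h / 2)) (h / 2), |s| ≤ 1 := fun s hs =>
    abs_le.2 ⟨by linarith [hs.1], by linarith [hs.2]⟩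
  have bA0 : ‖A0 0‖ ≤ 4 * (U * B) := (mulB (nu 0 (by simp)) (χB 0).1).trans hA4
  have bA1 : ∀ s ∈ Icc (-(h / 2)) (h / 2), ‖A1 s‖ ≤ 4 * (U * B) := fun s hs => by
    refine (norm_add_le_of_le (mulB (nu1 s (hh2 s hs)) (χB s).1)
      (mulB (nu s (hh2 s hs)) (χB s).2.1)).trans (by linarith [mul_nonneg hU0 hB])
  have bA2 : ∀ s ∈ Icc (-(h / 2)) (h / 2), ‖A1 s - A1 0‖ ≤ 4 * (U * B) * |s| := fun s hs => by
    have := (convex_Icc (-(h / 2)) (h / 2)).norm_image_sub_le_of_norm_hasDerivWithin_le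
      (C := 4 * (U * B)) (x := 0) (y := s) (fun x _ => (dA1 x).hasDerivWithinAt)
      (fun x hx => (norm_add_le_of_le
        (norm_add_le_of_le (mulB (nu2 x (hh2 x hx)) (χB x).1) (mulB (nu1 x (hh2 x hx)) (χB x).2.1))
        (norm_add_le_of_le (mulB (nu1 x (hh2 x hx)) (χB x).2.1)
          (mulB (nu x (hh2 x hx)) (χB x).2.2))).trans (by linarith))
      ⟨by linarith, by linarith⟩ hs
    simpa using this
  -- the normalized phase
  set y : ℝ → ℝ := fun s => (X (t + s) - X t - V t * s) / W t with hy
  have bdiv : ∀ {x C : ℝ}, |x| ≤ C * w → |x / W t| ≤ C := fun hx => by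
    rw [abs_div, div_le_iff₀ hwpos]; exact hx
  have by3 : ∀ s, |s| ≤ 1 → |a (t + s) * V (t + s) / W t| ≤ 2 * L * K := fun s hs => bdiv (by
    rw [abs_mul]
    calc _ ≤ L * (K * w) := mul_le_mul (o.ba _) (win s hs).1 (abs_nonneg _) (by linarith)
      _ ≤ _ := by have : 0 ≤ L * (K * w) := by positivity
                  linarith)
  have by4 : ∀ s, |s| ≤ 1 →
      |(a1 (t + s) * V (t + s) + a (t + s) * W (t + s)) / W t| ≤ 2 * L * K := fun s hs =>
    bdiv (by
      refine (abs_add_le _ _).trans ?_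
      rw [abs_mul, abs_mul]
      have u1 := mul_le_mul (o.ba1 (t + s)) (win s hs).1 (abs_nonneg _) (by linarith)
      have u2 := mul_le_mul (o.ba (t + s)) (win s hs).2 (abs_nonneg _) (by linarith)
      linarith)
  -- The normalized third derivative `a V / W t` and its derivative are at most `2 L K` on the
  -- window, and `h / 2 * (2 L K) ≤ 1 / 8` is the smallness required of the half-width.
  have key := stationary_phase (M := 2 * L * K) (h := h / 2) (κ := k * W t / ε) (A := 4 * (U * B))
    (y := y) (y1 := fun s => (V (t + s) - V t) / W t) (y2 := fun s => W (t + s) / W t)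
    (y3 := fun s => a (t + s) * V (t + s) / W t) (a := A0) (a1 := A1)
    (by nlinarith) (by linarith) (by linarith) (by positivity)
    (fun s => by
      convert! (((shift o.hX s).sub_const (X t)).fun_sub
        ((hasDerivAt_id s).const_mul (V t))).div_const (W t) using 1
      simp)
    (fun s => ((shift o.hV s).sub_const (V t)).div_const _) (fun s => (shift o.hW s).div_const _)
    (by simp [hy]) (by simp) (by simp [hW0]) (by3 0 (by simp))
    (fun s hs => by
      have := (convex_Icc (-(h / 2)) (h / 2)).norm_image_sub_le_of_norm_hasDerivWithin_le
        (C := 2 * L * K) (x := 0) (y := s)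
        (fun x _ => (((shift o.ha x).fun_mul (shift o.hV x)).div_const (W t)).hasDerivWithinAt)
        (fun x hx => by4 x (hh2 x hx)) ⟨by linarith, by linarith⟩ hs
      simpa using this)
    dA0 (by simp only [hA1]; fun_prop) bA0 bA1 bA2
  -- back to the original variables
  have hphase : ∀ s, (k * X (t + s) + μ * (t + s)) / ε =
      (k * X t + μ * t) / ε + k * W t / ε * y s := fun s => by
    have : μ = -(k * V t) := by linarith
    simp only [hy, this]
    field_simp
    ring
  have hint : (∫ s, V s * Q (V s) * χ (s - t) *
      Complex.exp (Complex.I * ((k * X s + μ * s) / ε : ℝ))) =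
      Complex.exp (Complex.I * ((k * X t + μ * t) / ε : ℝ)) *
        ∫ s in (-(h / 2))..(h / 2), A0 s * Complex.exp (Complex.I * (k * W t / ε * y s : ℝ)) := by
    rw [← integral_add_left_eq_self _ t, ← intervalIntegral.integral_const_mul,
      intervalIntegral.integral_eq_integral_of_support_subset]
    · refine integral_congr_ae (Eventually.of_forall fun s => ?_)
      simp only [hA0]
      rw [add_sub_cancel_left, hphase, Complex.ofReal_add, mul_add, Complex.exp_add]
      ring
    · intro s hs
      by_contra hs'
      refine hs ?_
      have : h / 2 ≤ |s| := by
        rw [mem_Ioc, not_and_or, not_lt, not_le] at hs'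
        rcases hs' with h' | h'
        · exact (by linarith : h / 2 ≤ -s).trans (neg_le_abs s)
        · exact h'.le.trans (le_abs_self s)
      simp [hA0, χeq0 s this]
  have hA00 : A0 0 = V t * Q (V t) := by simp [hA0, χeq1 0 (by simp; linarith)]
  rw [hint, criticalContribution, mul_comm _ (Complex.exp (Complex.I * ((k * X t + μ * t) / ε : ℝ))),
    ← mul_sub, norm_mul, mul_comm Complex.I, Complex.norm_exp_ofReal_mul_I, one_mul, ← hA00]
  refine key.trans (le_of_eq ?_)
  rw [abs_div, abs_mul, abs_of_pos hε, ← hw, hU]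
  have : |k| ≠ 0 := abs_ne_zero.2 hk
  field_simp
  ring

end DecayingOrbit

namespace DecayingOrbit

variable {X V W a a1 : ℝ → ℝ} {L : ℝ}

theorem exists_window_width (L : ℝ) (hL : 1 ≤ L) {c : ℝ} (hc : 0 < c) (hc1 : c ≤ 1) :
    ∃ h, 0 < h ∧ h ≤ 1 ∧ h * (L * (2 * Real.exp (1 + L) / c)) ≤ 1 / 8 := by
  have hK1 : 1 ≤ 2 * Real.exp (1 + L) / c := by
    rw [le_div_iff₀ hc]
    have := Real.one_le_exp (by linarith : 0 ≤ 1 + L)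
    linarith
  have hLK : 1 ≤ L * (2 * Real.exp (1 + L) / c) := one_le_mul_of_one_le_of_one_le hL hK1
  refine ⟨1 / (8 * (L * (2 * Real.exp (1 + L) / c))), by positivity, ?_, ?_⟩
  · rw [div_le_one (by positivity)]; linarith
  · rw [div_mul_eq_mul_div, div_le_div_iff₀ (by positivity) (by norm_num)]; linarith

/-- Stationary phase along a decaying orbit, uniformly in the wave number `k` and in the amplitude
`Q`.  The constant depends only on the orbit, on the lower bound `μ0` for `|μ|`, on the
nondegeneracy constant `c` and on the number `N` of critical points. -/
theorem oscillatory_integral (o : DecayingOrbit X V W a a1 L) {c μ0 : ℝ} (hc : 0 < c)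
    (hc1 : c ≤ 1) (hμ0 : 0 < μ0) (N : ℕ) : ∃ C : ℝ, 0 ≤ C ∧ ∀ k μ : ℝ, 1 ≤ |k| → μ0 ≤ |μ| →
      (∀ t, |k * V t + μ| ≤ c → c * |V t| ≤ |W t|) →
      ∀ T : Finset ℝ, (∀ t, t ∈ T ↔ k * V t + μ = 0) → T.card ≤ N →
      ∀ (Q Q1 Q2 : ℝ → ℂ) (B0 B1 B2 : ℝ), (∀ v, HasDerivAt Q (Q1 v) v) →
      (∀ v, HasDerivAt Q1 (Q2 v) v) → (∀ v, |v| ≤ L → ‖Q v‖ ≤ B0) →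
      (∀ v, |v| ≤ L → ‖Q1 v‖ ≤ B1) → (∀ v, |v| ≤ L → ‖Q2 v‖ ≤ B2) → ∀ ε : ℝ, 0 < ε →
      ‖(∫ s, V s * Q (V s) * Complex.exp (Complex.I * ((k * X s + μ * s) / ε : ℝ))) -
        ∑ t ∈ T, criticalContribution X V W Q k μ ε t‖ ≤ ε * (C * (|k| * B0 + B1 + B2 / |k|)) := by
  have hL := o.one_le
  obtain ⟨h, h0, h1, hh⟩ := exists_window_width L hL hc hc1
  set K := 2 * Real.exp (1 + L) / c with hK
  have hh' : h * (L * K) ≤ 1 / 2 := hh.trans (by norm_num)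
  have hK0 : 0 ≤ K := by positivity
  obtain ⟨χ, χ1, χ2, B, hB, hχ, hχ1, -, χeq1, χeq0, χB⟩ := exists_cutoff h0
  -- This threshold does not depend on `k`. Below it a critical point lies within `h / 4`, in the
  -- region where the corresponding cutoff equals `1`.
  set c' := min c (min (μ0 / 2) (c * μ0 * h / 32)) with hc'
  have hc'0 : 0 < c' := by positivity
  set Cw := 2 * (7500 * (2 * L * K) ^ 2 + 8 / h) * (12 * B * L ^ 2 * K) with hCw
  set In := ∫ s, (|V s| + |W s|) with hIn
  have hIn0 : 0 ≤ In := integral_nonneg fun s => by positivity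
  set Cn := (1 + 2 * N * B) * L * (1 / c' + 1 / c' ^ 2) with hCn
  have hCw0 : 0 ≤ Cw := by positivity
  have hCn0 : 0 ≤ Cn := by positivity
  refine ⟨N * Cw + Cn * In, by positivity, ?_⟩
  intro k μ hk hμ hU T hT hcard Q Q1 Q2 B0 B1 B2 hQ hQ1 hB0 hB1 hB2 ε hε
  have hk0 : k ≠ 0 := abs_pos.1 (by linarith)
  have hkp : 0 < |k| := by linarith
  have hBB0 : 0 ≤ B0 := (norm_nonneg _).trans (hB0 0 (by simpa using by linarith))
  have hBB1 : 0 ≤ B1 := (norm_nonneg _).trans (hB1 0 (by simpa using by linarith))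
  have hBB2 : 0 ≤ B2 := (norm_nonneg _).trans (hB2 0 (by simpa using by linarith))
  have hXc : Continuous X := continuous_iff_continuousAt.2 fun t => (o.hX t).continuousAt
  have hVc : Continuous V := continuous_iff_continuousAt.2 fun t => (o.hV t).continuousAt
  have hWc : Continuous W := continuous_iff_continuousAt.2 fun t => (o.hW t).continuousAt
  have hQc : Continuous Q := continuous_iff_continuousAt.2 fun t => (hQ t).continuousAt
  have hQ1c : Continuous Q1 := continuous_iff_continuousAt.2 fun t => (hQ1 t).continuousAt
  have hχc : Continuous χ := continuous_iff_continuousAt.2 fun t => (hχ t).continuousAt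
  have hχ1c : Continuous χ1 := continuous_iff_continuousAt.2 fun t => (hχ1 t).continuousAt
  have crit : ∀ t ∈ T, k * V t + μ = 0 ∧ V t ≠ 0 ∧ c * |V t| ≤ |W t| ∧ W t ≠ 0 := fun t ht => by
    have e := (hT t).1 ht
    have hV0 : V t ≠ 0 := fun h => by
      rw [h, mul_zero, zero_add] at e
      rw [e, abs_zero] at hμ
      linarith
    have hg := hU t (by rw [e, abs_zero]; exact hc.le)
    refine ⟨e, hV0, hg, fun h => ?_⟩
    rw [h, abs_zero] at hg
    exact absurd hg (not_le.2 (mul_pos hc (abs_pos.2 hV0)))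
  have sep : ∀ t ∈ T, ∀ t' ∈ T, t ≠ t' → h < |t' - t| := fun t ht t' ht' hne => by
    obtain ⟨e, hV0, hg, -⟩ := crit t ht
    refine o.separated hc hc1 h1 hh' hg hV0 ?_ hne
    have e' := (crit t' ht').1
    have : k * V t = k * V t' := by linarith
    exact mul_left_cancel₀ hk0 this
  set E : ℝ → ℂ := fun s => Complex.exp (Complex.I * ((k * X s + μ * s) / ε : ℝ)) with hE
  have hEn : ∀ s, ‖E s‖ = 1 := fun s => by
    simp only [hE]; rw [mul_comm]; exact Complex.norm_exp_ofReal_mul_I _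
  have hEc : Continuous E := by simp only [hE]; fun_prop
  set u : ℝ → ℂ := fun s => V s * Q (V s) with hu
  have huc : Continuous u := by simp only [hu]; fun_prop
  have hun : ∀ s, ‖u s‖ ≤ |V s| * B0 := fun s => by
    rw [norm_mul, Complex.norm_real]
    exact mul_le_mul_of_nonneg_left (hB0 _ (o.bV _)) (norm_nonneg _)
  set Λ : ℝ → ℝ := fun s => ∑ t ∈ T, χ (s - t) with hΛ
  set Λ1 : ℝ → ℝ := fun s => ∑ t ∈ T, χ1 (s - t) with hΛ1
  have hΛd : ∀ s, HasDerivAt Λ (Λ1 s) s := fun s =>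
    HasDerivAt.fun_sum fun t _ => (hχ (s - t)).comp_sub_const s t
  have hΛc : Continuous Λ := continuous_iff_continuousAt.2 fun t => (hΛd t).continuousAt
  have hΛ1c : Continuous Λ1 := by simp only [hΛ1]; fun_prop
  have sumB : ∀ φ : ℝ → ℝ, (∀ s, |φ s| ≤ B) → ∀ s, |∑ t ∈ T, φ (s - t)| ≤ N * B := fun φ hφ s =>
    calc _ ≤ ∑ t ∈ T, |φ (s - t)| := Finset.abs_sum_le_sum_abs _ _
      _ ≤ ∑ t ∈ T, B := Finset.sum_le_sum fun t _ => hφ _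
      _ = T.card * B := by simp
      _ ≤ N * B := by gcongr
  have bΛ : ∀ s, |1 - Λ s| ≤ 1 + N * B := fun s => by
    refine (abs_sub _ _).trans ?_
    rw [abs_one]
    linarith [sumB χ (fun s => (χB s).1) s]
  have bΛ1 : ∀ s, |Λ1 s| ≤ N * B := sumB χ1 fun s => (χB s).2.1
  -- the amplitude away from the critical points
  set b : ℝ → ℂ := fun s => u s * (1 - Λ s : ℝ) with hb
  set b' : ℝ → ℂ := fun s => W s * (Q (V s) + V s * Q1 (V s)) * (1 - Λ s : ℝ) +
    u s * (-Λ1 s : ℝ) with hb'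
  have hbd : ∀ s, HasDerivAt b (b' s) s := fun s =>
    (o.amplitude_deriv hQ s).fun_mul ((hΛd s).const_sub 1).ofReal_comp
  have hbn : ∀ s, ‖b s‖ ≤ |V s| * (B0 * (1 + N * B)) := fun s => by
    rw [norm_mul, Complex.norm_real, ← mul_assoc]
    exact mul_le_mul (hun s) (bΛ s) (norm_nonneg _) (by positivity)
  have hbc : Continuous b := by simp only [hb]; fun_prop
  -- Near `s` exactly one bump is active: the one centred at the nearby critical point equals `1`,
  -- and every other centre is more than `h` away from that point, beyond the reach `h / 2` of its
  -- bump.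
  have hsmall : ∀ s, |k * V s + μ| < c' → b =ᶠ[𝓝 s] 0 := fun s hs => by
    obtain ⟨t, hts, ht0⟩ := o.near_critical hc hc1 h0 h1 hh' hμ hU hs
    have htT := (hT t).2 ht0
    have : ∀ᶠ x in 𝓝 s, |t - x| < h / 4 :=
      (by fun_prop : ContinuousAt (fun x => |t - x|) s).eventually (gt_mem_nhds hts)
    filter_upwards [this] with x hx
    have : Λ x = 1 := by
      simp only [hΛ]
      rw [Finset.sum_eq_single_of_mem t htT, χeq1 _ (by rw [abs_sub_comm]; exact hx.le)]
      intro t' ht' hne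
      apply χeq0
      have h3 := sep t htT t' ht' hne.symm
      have h4 := abs_sub_le t' x t
      rw [abs_sub_comm] at hx
      rw [abs_sub_comm t' x] at h4
      linarith
    simp [hb, this]
  have iVW : Integrable fun s => |V s| + |W s| := o.iV.abs.add o.iW.abs
  have lims : ∀ l : Filter ℝ, Tendsto V l (𝓝 0) → Tendsto b l (𝓝 0) := fun l hl => by
    have : Tendsto (fun s => |V s| * (B0 * (1 + N * B))) l (𝓝 0) := by
      simpa using hl.abs.mul_const (B0 * (1 + N * B))
    exact squeeze_zero_norm hbn this
  -- The factor `|k|` comes from differentiating `1 / (k V + μ)` in the integration by parts; the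
  -- derivative of the amplitude contributes no such factor.
  set G := |k| * B0 + B1 with hG
  have hG0 : 0 ≤ G := by positivity
  have hBG : B0 + B1 ≤ G := by
    have : 1 * B0 ≤ |k| * B0 := by gcongr
    linarith
  have hNB : 0 ≤ N * B := by positivity
  have hb'n : ∀ s, ‖b' s‖ ≤ (|V s| + |W s|) * ((1 + 2 * N * B) * L * G) := fun s => by
    have p1 : ‖(W s : ℂ) * (Q (V s) + V s * Q1 (V s)) * (1 - Λ s : ℝ)‖ ≤
        |W s| * (L * G) * (1 + N * B) := by
      rw [norm_mul, norm_mul, Complex.norm_real, Complex.norm_real]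
      refine mul_le_mul (mul_le_mul_of_nonneg_left ?_ (norm_nonneg _)) (bΛ s) (norm_nonneg _)
        (by positivity)
      refine (norm_add_le_of_le (hB0 _ (o.bV s)) (r₂ := L * B1) ?_).trans ?_
      · rw [norm_mul, Complex.norm_real]
        exact mul_le_mul (o.bV _) (hB1 _ (o.bV _)) (norm_nonneg _) (by linarith)
      · have : 1 * B0 ≤ L * B0 := by gcongr
        calc _ ≤ L * (B0 + B1) := by linarith
          _ ≤ _ := by gcongr
    have p2 : ‖u s * (-Λ1 s : ℝ)‖ ≤ |V s| * (L * G) * (N * B) := by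
      rw [norm_mul, Complex.norm_real, norm_neg]
      refine mul_le_mul ((hun s).trans (mul_le_mul_of_nonneg_left ?_ (abs_nonneg _))) (bΛ1 s)
        (norm_nonneg _) (by positivity)
      calc B0 ≤ 1 * G := by linarith
        _ ≤ L * G := by gcongr
    refine (norm_add_le_of_le p1 p2).trans ?_
    have q1 : 0 ≤ |W s| * (L * G) * (N * B) := by positivity
    have q2 : 0 ≤ |V s| * (L * G) * (N * B) := by positivity
    have q3 : 0 ≤ |V s| * (L * G) := by positivity
    linarith
  have nonstat := norm_nonstationary_le (b := b) (b' := b') (ψ := fun s => k * X s + μ * s)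
    (g := fun s => k * V s + μ) (g' := fun s => k * W s)
    (D := fun s => (|V s| + |W s|) * (Cn * G)) hc'0 hε hbd
    (by simp only [hb', hu]; fun_prop)
    (fun s => by simpa using ((o.hX s).const_mul k).fun_add ((hasDerivAt_id s).const_mul μ))
    (fun s => ((o.hV s).const_mul k).add_const μ) (by fun_prop) hsmall (iVW.mul_const _)
    (fun s => by
      have q1 : ‖b' s‖ / c' ≤ (|V s| + |W s|) * ((1 + 2 * N * B) * L * G) / c' := by
        gcongr; exact hb'n s
      have q2 : ‖b s‖ * |k * W s| / c' ^ 2 ≤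
          (|V s| + |W s|) * ((1 + 2 * N * B) * L * G) / c' ^ 2 := by
        refine div_le_div_of_nonneg_right ?_ (by positivity)
        rw [abs_mul]
        calc _ ≤ |V s| * (B0 * (1 + N * B)) * (|k| * L) := by
              gcongr
              · exact hbn s
              · exact o.bW s
          _ = |V s| * ((1 + N * B) * L * (|k| * B0)) := by ring
          _ ≤ (|V s| + |W s|) * ((1 + 2 * N * B) * L * G) := by
              gcongr
              · linarith [abs_nonneg (W s)]
              · linarith
              · linarith
      refine (add_le_add q1 q2).trans (le_of_eq ?_)
      rw [hCn]
      ring)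
    ((o.iV.abs.mul_const (B0 * (1 + N * B))).mono' hbc.aestronglyMeasurable
      (Eventually.of_forall hbn)) (lims _ o.top) (lims _ o.bot)
  rw [integral_mul_const] at nonstat
  have stat : ∀ t ∈ T, ‖(∫ s, u s * χ (s - t) * E s) - criticalContribution X V W Q k μ ε t‖ ≤
      ε * (Cw * (B0 + B1 + B2) / |k|) := fun t ht =>
    o.window_integral hc hc1 h0 h1 hK hh hk0 hε (crit t ht).1 (crit t ht).2.2.2 (crit t ht).2.2.1
      hχ hχ1 χeq1 χeq0 χB hQ hQ1 hB0 hB1 hB2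
  have iu : ∀ φ : ℝ → ℝ, Continuous φ → ∀ Bφ, (∀ s, |φ s| ≤ Bφ) →
      Integrable fun s => u s * φ s * E s := fun φ hφ Bφ hφB => by
    refine (o.iV.abs.mul_const (B0 * Bφ)).mono' (by fun_prop) (Eventually.of_forall fun s => ?_)
    rw [norm_mul, norm_mul, hEn, mul_one, Complex.norm_real, ← mul_assoc]
    exact mul_le_mul (hun s) (hφB s) (norm_nonneg _) (by positivity)
  -- The partition `1 = (1 - Λ) + ∑ χ(s - t)` separates the nonstationary part from the windows.
  have split : ∫ s, u s * E s = (∫ s, b s * E s) + ∑ t ∈ T, ∫ s, u s * χ (s - t) * E s := by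
    rw [← integral_finsetSum _ fun t _ => iu (fun s => χ (s - t)) (by fun_prop) B
      fun s => (χB _).1, ← integral_add]
    · refine integral_congr_ae (Eventually.of_forall fun s => ?_)
      simp only [hb, hΛ]
      rw [← Finset.sum_mul, ← Finset.mul_sum]
      push_cast
      ring
    · exact iu (fun s => 1 - Λ s) (by fun_prop) _ bΛ
    · exact integrable_finsetSum _ fun t _ => iu (fun s => χ (s - t)) (by fun_prop) B
        fun s => (χB _).1
  have total : ‖(∫ s, u s * E s) - ∑ t ∈ T, criticalContribution X V W Q k μ ε t‖ ≤
      ε * (In * (Cn * G)) + N * (ε * (Cw * (B0 + B1 + B2) / |k|)) := by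
    rw [split, add_sub_assoc, ← Finset.sum_sub_distrib]
    refine norm_add_le_of_le nonstat ((norm_sum_le_of_le _ stat).trans ?_)
    rw [Finset.sum_const, nsmul_eq_mul]
    gcongr
  refine total.trans ?_
  have f1 : (B0 + B1 + B2) / |k| ≤ G + B2 / |k| := by
    rw [add_div]
    have : (B0 + B1) / |k| ≤ B0 + B1 := div_le_self (by positivity) hk
    linarith
  have f2 : G ≤ G + B2 / |k| := le_add_of_nonneg_right (by positivity)
  calc _ = ε * (Cn * In * G + N * Cw * ((B0 + B1 + B2) / |k|)) := by ring
    _ ≤ ε * (Cn * In * (G + B2 / |k|) + N * Cw * (G + B2 / |k|)) := by gcongr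
    _ = _ := by ring

/-- The mean mode: there are no critical points if `k = 0`. -/
theorem oscillatory_integral_zero (o : DecayingOrbit X V W a a1 L) {μ0 : ℝ} (hμ0 : 0 < μ0) :
    ∃ C : ℝ, 0 ≤ C ∧ ∀ μ : ℝ, μ0 ≤ |μ| → ∀ (Q Q1 : ℝ → ℂ) (B0 B1 : ℝ),
      (∀ v, HasDerivAt Q (Q1 v) v) → Continuous Q1 → (∀ v, |v| ≤ L → ‖Q v‖ ≤ B0) →
      (∀ v, |v| ≤ L → ‖Q1 v‖ ≤ B1) → ∀ ε : ℝ, 0 < ε →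
      ‖∫ s, V s * Q (V s) * Complex.exp (Complex.I * (μ * s / ε : ℝ))‖ ≤
        ε * (C * (B0 + B1)) := by
  have hL := o.one_le
  set In := ∫ s, |W s| with hIn
  have hIn0 : 0 ≤ In := integral_nonneg fun s => abs_nonneg _
  refine ⟨L * In / μ0, by positivity, ?_⟩
  intro μ hμ Q Q1 B0 B1 hQ hQ1c hB0 hB1 ε hε
  have hBB0 : 0 ≤ B0 := (norm_nonneg _).trans (hB0 0 (by simpa using by linarith))
  have hBB1 : 0 ≤ B1 := (norm_nonneg _).trans (hB1 0 (by simpa using by linarith))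
  have hVc : Continuous V := continuous_iff_continuousAt.2 fun t => (o.hV t).continuousAt
  have hWc : Continuous W := continuous_iff_continuousAt.2 fun t => (o.hW t).continuousAt
  have hQc : Continuous Q := continuous_iff_continuousAt.2 fun t => (hQ t).continuousAt
  have hbn : ∀ s, ‖(V s : ℂ) * Q (V s)‖ ≤ |V s| * B0 := fun s => by
    rw [norm_mul, Complex.norm_real]
    exact mul_le_mul_of_nonneg_left (hB0 _ (o.bV _)) (norm_nonneg _)
  have lims : ∀ l : Filter ℝ, Tendsto V l (𝓝 0) →
      Tendsto (fun s => (V s : ℂ) * Q (V s)) l (𝓝 0) := fun l hl => by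
    have : Tendsto (fun s => |V s| * B0) l (𝓝 0) := by simpa using hl.abs.mul_const B0
    exact squeeze_zero_norm hbn this
  have key := norm_nonstationary_le (ψ := fun s => μ * s) (g := fun _ => μ) (g' := fun _ => 0)
    (D := fun s => |W s| * (L * (B0 + B1) / μ0)) hμ0 hε (o.amplitude_deriv hQ) (by fun_prop)
    (fun s => by simpa using (hasDerivAt_id s).const_mul μ) (fun s => hasDerivAt_const s μ)
    continuous_const (fun s hs => absurd hμ (not_le.2 hs)) (o.iW.abs.mul_const _)
    (fun s => by
      rw [abs_zero, mul_zero, zero_div, add_zero, norm_mul, Complex.norm_real, ← mul_div_assoc]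
      have : ‖Q (V s) + V s * Q1 (V s)‖ ≤ L * (B0 + B1) := by
        refine (norm_add_le_of_le (hB0 _ (o.bV s)) (r₂ := L * B1) ?_).trans ?_
        · rw [norm_mul, Complex.norm_real]
          exact mul_le_mul (o.bV _) (hB1 _ (o.bV _)) (norm_nonneg _) (by linarith)
        · have : 1 * B0 ≤ L * B0 := by gcongr
          linarith
      exact div_le_div_of_nonneg_right (mul_le_mul_of_nonneg_left this (norm_nonneg _)) hμ0.le)
    ((o.iV.abs.mul_const B0).mono' (by fun_prop) (Eventually.of_forall hbn))
    (lims _ o.top) (lims _ o.bot)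
  rw [integral_mul_const] at key
  refine key.trans (le_of_eq ?_)
  rw [← hIn]
  ring

end DecayingOrbit

/-! ### Fourier coefficients of a function that is periodic in its first variable -/

/-- The `k`-th Fourier coefficient of `ξ ↦ g (ξ, v)`. -/
def partialFourier (g : ℝ × ℝ → ℝ) (k : ℤ) (v : ℝ) : ℂ :=
  (1 / (2 * Real.pi) : ℂ) *
    ∫ ξ in (0 : ℝ)..(2 * Real.pi), (g (ξ, v) : ℂ) * Complex.exp (-(Complex.I * k * ξ))

/-- The partial derivative in the direction `e`. -/
def dirDeriv (e : ℝ × ℝ) (g : ℝ × ℝ → ℝ) (y : ℝ × ℝ) : ℝ := fderiv ℝ g y e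

theorem norm_exp_neg_I_mul (k : ℤ) (ξ : ℝ) : ‖Complex.exp (-(Complex.I * k * ξ))‖ = 1 := by
  have : -(Complex.I * k * ξ) = ((-(k * ξ) : ℝ) : ℂ) * Complex.I := by push_cast; ring
  rw [this, Complex.norm_exp_ofReal_mul_I]

theorem norm_partialFourier_le {g : ℝ × ℝ → ℝ} {B v : ℝ}
    (hB : ∀ ξ ∈ Icc 0 (2 * Real.pi), |g (ξ, v)| ≤ B) (k : ℤ) : ‖partialFourier g k v‖ ≤ B := by
  have hpi : 0 < 2 * Real.pi := by positivity
  have := intervalIntegral.norm_integral_le_of_norm_le_const (a := 0) (b := 2 * Real.pi) (C := B)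
    (f := fun ξ => (g (ξ, v) : ℂ) * Complex.exp (-(Complex.I * k * ξ))) (fun ξ hξ => by
      rw [norm_mul, norm_exp_neg_I_mul, mul_one, Complex.norm_real]
      rw [uIoc_of_le hpi.le] at hξ
      exact hB ξ ⟨hξ.1.le, hξ.2⟩)
  rw [partialFourier, norm_mul, norm_div, norm_one, norm_mul, Complex.norm_ofNat,
    Complex.norm_real, Real.norm_of_nonneg Real.pi_pos.le, one_div, inv_mul_le_iff₀ hpi]
  rw [sub_zero, abs_of_pos hpi] at this
  linarith

theorem contDiff_dirDeriv {g : ℝ × ℝ → ℝ} {n : ℕ} (hg : ContDiff ℝ (n + 1) g) (e : ℝ × ℝ) :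
    ContDiff ℝ n (dirDeriv e g) :=
  (hg.fderiv_right le_rfl).clm_apply contDiff_const

theorem periodic_dirDeriv {g : ℝ × ℝ → ℝ} (e : ℝ × ℝ) {c : ℝ × ℝ}
    (hg : ∀ y, g (y + c) = g y) (y : ℝ × ℝ) : dirDeriv e g (y + c) = dirDeriv e g y := by
  rw [dirDeriv, dirDeriv, ← fderiv_comp_add_right]
  simp_rw [hg]

theorem hasDerivAt_fst {g : ℝ × ℝ → ℝ} (hg : ContDiff ℝ 1 g) (ξ v : ℝ) :
    HasDerivAt (fun ξ => g (ξ, v)) (dirDeriv (1, 0) g (ξ, v)) ξ :=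
  ((hg.differentiable one_ne_zero) (ξ, v)).hasFDerivAt.comp_hasDerivAt ξ
    ((hasDerivAt_id ξ).prodMk (hasDerivAt_const ξ v))

theorem hasDerivAt_snd {g : ℝ × ℝ → ℝ} (hg : ContDiff ℝ 1 g) (ξ v : ℝ) :
    HasDerivAt (fun v => g (ξ, v)) (dirDeriv (0, 1) g (ξ, v)) v :=
  ((hg.differentiable one_ne_zero) (ξ, v)).hasFDerivAt.comp_hasDerivAt v
    ((hasDerivAt_const v ξ).prodMk (hasDerivAt_id v))

theorem exists_bound_of_continuous {g : ℝ × ℝ → ℝ} (hg : Continuous g) (L : ℝ) :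
    ∃ B, 0 ≤ B ∧ ∀ v, |v| ≤ L → ∀ ξ ∈ Icc 0 (2 * Real.pi), |g (ξ, v)| ≤ B := by
  obtain ⟨B, hB⟩ := ((isCompact_Icc (a := (0 : ℝ)) (b := 2 * Real.pi)).prod
    (isCompact_Icc (a := -L) (b := L))).exists_bound_of_continuousOn hg.continuousOn
  refine ⟨max B 0, le_max_right _ _, fun v hv ξ hξ => (hB (ξ, v) ⟨hξ, abs_le.1 hv⟩).trans
    (le_max_left _ _)⟩

theorem hasDerivAt_partialFourier {g : ℝ × ℝ → ℝ} (hg : ContDiff ℝ 1 g) (k : ℤ) (v : ℝ) :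
    HasDerivAt (partialFourier g k) (partialFourier (dirDeriv (0, 1) g) k v) v := by
  have hgc := hg.continuous
  have hdc : Continuous (dirDeriv (0, 1) g) := (contDiff_dirDeriv (n := 0) (by simpa) _).continuous
  obtain ⟨B, -, hB⟩ := exists_bound_of_continuous hdc (|v| + 1)
  refine HasDerivAt.const_mul _ ?_
  refine (intervalIntegral.hasDerivAt_integral_of_dominated_loc_of_deriv_le
    (F := fun v ξ => (g (ξ, v) : ℂ) * Complex.exp (-(Complex.I * k * ξ)))
    (F' := fun v ξ => (dirDeriv (0, 1) g (ξ, v) : ℂ) * Complex.exp (-(Complex.I * k * ξ)))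
    (bound := fun _ => B) (Metric.ball_mem_nhds v one_pos)
    (Eventually.of_forall fun x => ?_) ?_ ?_ (Eventually.of_forall fun ξ hξ x hx => ?_)
    (by simp) (Eventually.of_forall fun ξ hξ x hx => ?_)).2
  · exact Continuous.aestronglyMeasurable (by fun_prop)
  · exact Continuous.intervalIntegrable (by fun_prop) _ _
  · exact Continuous.aestronglyMeasurable (by fun_prop)
  · rw [norm_mul, norm_exp_neg_I_mul, mul_one, Complex.norm_real]
    rw [uIoc_of_le (by positivity)] at hξ
    refine hB x ?_ ξ ⟨hξ.1.le, hξ.2⟩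
    rw [Metric.mem_ball, Real.dist_eq] at hx
    linarith [abs_sub_abs_le_abs_sub x v]
  · exact (hasDerivAt_snd hg ξ x).ofReal_comp.mul_const _

theorem partialFourier_eq_deriv {g : ℝ × ℝ → ℝ} (hg : ContDiff ℝ 1 g)
    (hper : ∀ y, g (y + (2 * Real.pi, 0)) = g y) {k : ℤ} (hk : k ≠ 0) (v : ℝ) :
    partialFourier g k v = 1 / (Complex.I * k) * partialFourier (dirDeriv (1, 0) g) k v := by
  have hgc := hg.continuous
  have hdc : Continuous (dirDeriv (1, 0) g) := (contDiff_dirDeriv (n := 0) (by simpa) _).continuous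
  have hk' : (k : ℂ) ≠ 0 := Int.cast_ne_zero.2 hk
  have hE : ∀ ξ : ℝ, HasDerivAt (fun ξ : ℝ => Complex.exp (-(Complex.I * k * ξ)))
      (Complex.exp (-(Complex.I * k * ξ)) * -(Complex.I * k)) ξ := fun ξ => by
    have := (((hasDerivAt_id (ξ : ℂ)).const_mul (Complex.I * k)).fun_neg.cexp).comp_ofReal
    simpa using this
  have i1 : IntervalIntegrable (fun ξ : ℝ => (dirDeriv (1, 0) g (ξ, v) : ℂ) *
      Complex.exp (-(Complex.I * k * ξ))) volume 0 (2 * Real.pi) :=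
    Continuous.intervalIntegrable (by fun_prop) _ _
  have i2 : IntervalIntegrable (fun ξ : ℝ => (g (ξ, v) : ℂ) *
      (Complex.exp (-(Complex.I * k * ξ)) * -(Complex.I * k))) volume 0 (2 * Real.pi) :=
    Continuous.intervalIntegrable (by fun_prop) _ _
  have ftc := intervalIntegral.integral_eq_sub_of_hasDerivAt
    (fun ξ _ => (hasDerivAt_fst hg ξ v).ofReal_comp.fun_mul (hE ξ)) (i1.add i2)
  rw [intervalIntegral.integral_add i1 i2] at ftc
  have e1 : g (2 * Real.pi, v) = g (0, v) := by simpa using hper (0, v)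
  have e2 : Complex.exp (-(Complex.I * k * (2 * Real.pi : ℝ))) = 1 := by
    rw [Complex.exp_eq_one_iff]
    exact ⟨-k, by push_cast; ring⟩
  have e3 : Complex.exp (-(Complex.I * k * (0 : ℝ))) = 1 := by simp
  rw [e1, e2, e3, sub_self] at ftc
  simp_rw [← mul_assoc] at ftc
  rw [intervalIntegral.integral_mul_const] at ftc
  rw [partialFourier, partialFourier, eq_neg_of_add_eq_zero_left ftc]
  field_simp

theorem norm_partialFourier_deriv {g : ℝ × ℝ → ℝ} (hg : ContDiff ℝ 1 g)
    (hper : ∀ y, g (y + (2 * Real.pi, 0)) = g y) {k : ℤ} (hk : k ≠ 0) (v : ℝ) :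
    ‖partialFourier g k v‖ = ‖partialFourier (dirDeriv (1, 0) g) k v‖ / |(k : ℝ)| := by
  rw [partialFourier_eq_deriv hg hper hk v, norm_mul, norm_div, norm_mul, Complex.norm_I, one_mul,
    norm_one, Complex.norm_intCast, div_mul_eq_mul_div, one_mul]

/-- Decay of the Fourier coefficients of a `C³` function and of their derivatives. -/
theorem exists_partialFourier_bound {g : ℝ × ℝ → ℝ} (hg : ContDiff ℝ 3 g)
    (hper : ∀ y, g (y + (2 * Real.pi, 0)) = g y) (L : ℝ) : ∃ B, 0 ≤ B ∧ ∀ k : ℤ, ∀ v, |v| ≤ L →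
      (‖partialFourier g k v‖ ≤ B ∧ ‖partialFourier (dirDeriv (0, 1) g) k v‖ ≤ B) ∧
      (k ≠ 0 → ‖partialFourier g k v‖ ≤ B / |(k : ℝ)| ^ 3 ∧
        ‖partialFourier (dirDeriv (0, 1) g) k v‖ ≤ B / |(k : ℝ)| ^ 2 ∧
        ‖partialFourier (dirDeriv (0, 1) (dirDeriv (0, 1) g)) k v‖ ≤ B / |(k : ℝ)|) := by
  have cg1 : ∀ e, ContDiff ℝ 2 (dirDeriv e g) := fun e => contDiff_dirDeriv (n := 2) hg e
  have cg2 : ∀ e e', ContDiff ℝ 1 (dirDeriv e' (dirDeriv e g)) := fun e e' =>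
    contDiff_dirDeriv (n := 1) (cg1 e) e'
  have cg3 : ∀ e e' e'', Continuous (dirDeriv e'' (dirDeriv e' (dirDeriv e g))) :=
    fun e e' e'' => (contDiff_dirDeriv (n := 0) (cg2 e e') e'').continuous
  obtain ⟨b0, h0, hb0⟩ := exists_bound_of_continuous hg.continuous L
  obtain ⟨b1, h1, hb1⟩ := exists_bound_of_continuous (cg1 (0, 1)).continuous L
  -- Every derivative bounded from here on has total order three: each derivative spent on `v`
  -- leaves one fewer for the integration by parts in `ξ`. This is the source of the rates `|k|⁻³`,
  -- `|k|⁻²` and `|k|⁻¹`.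
  obtain ⟨b2, h2, hb2⟩ := exists_bound_of_continuous (cg3 (1, 0) (1, 0) (1, 0)) L
  obtain ⟨b3, h3, hb3⟩ := exists_bound_of_continuous (cg3 (0, 1) (1, 0) (1, 0)) L
  obtain ⟨b4, h4, hb4⟩ := exists_bound_of_continuous (cg3 (0, 1) (0, 1) (1, 0)) L
  refine ⟨b0 + b1 + b2 + b3 + b4, by positivity, fun k v hv => ⟨⟨?_, ?_⟩, fun hk => ⟨?_, ?_, ?_⟩⟩⟩
  · exact (norm_partialFourier_le (hb0 v hv) k).trans (by linarith)
  · exact (norm_partialFourier_le (hb1 v hv) k).trans (by linarith)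
  · rw [norm_partialFourier_deriv (hg.of_le (by norm_num)) hper hk,
      norm_partialFourier_deriv ((cg1 _).of_le (by norm_num)) (periodic_dirDeriv _ hper) hk,
      norm_partialFourier_deriv (cg2 _ _) (periodic_dirDeriv _ (periodic_dirDeriv _ hper)) hk,
      div_div, div_div]
    rw [show |(k : ℝ)| * (|(k : ℝ)| * |(k : ℝ)|) = |(k : ℝ)| ^ 3 by ring]
    gcongr
    exact (norm_partialFourier_le (hb2 v hv) k).trans (by linarith)
  · rw [norm_partialFourier_deriv ((cg1 _).of_le (by norm_num)) (periodic_dirDeriv _ hper) hk,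
      norm_partialFourier_deriv (cg2 _ _) (periodic_dirDeriv _ (periodic_dirDeriv _ hper)) hk,
      div_div, ← sq]
    gcongr
    exact (norm_partialFourier_le (hb3 v hv) k).trans (by linarith)
  · rw [norm_partialFourier_deriv (cg2 _ _) (periodic_dirDeriv _ (periodic_dirDeriv _ hper)) hk]
    gcongr
    exact (norm_partialFourier_le (hb4 v hv) k).trans (by linarith)

theorem summable_const_div_int_pow (B : ℝ) {p : ℕ} (hp : 1 < p) :
    Summable fun k : ℤ => B / |(k : ℝ)| ^ p := by
  have h := Real.summable_abs_int_rpow (b := p) (by exact_mod_cast hp)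
  refine (h.mul_left B).congr fun k => ?_
  rw [Real.rpow_neg (abs_nonneg _), Real.rpow_natCast, div_eq_mul_inv]

/-- The cubic decay makes the coefficients summable, and a continuous function on the circle with
summable Fourier coefficients is the pointwise sum of its series. The scalar `v` is a parameter
throughout. -/
theorem hasSum_partialFourier {g : ℝ × ℝ → ℝ} (hg : ContDiff ℝ 3 g)
    (hper : ∀ y, g (y + (2 * Real.pi, 0)) = g y) (ξ v : ℝ) :
    HasSum (fun k : ℤ => partialFourier g k v * Complex.exp (Complex.I * k * ξ)) (g (ξ, v)) := by
  have hpi : 0 < 2 * Real.pi := by positivity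
  have : Fact (0 < 2 * Real.pi) := ⟨hpi⟩
  have hP : Function.Periodic (fun ξ => (g (ξ, v) : ℂ)) (2 * Real.pi) := fun ξ => by
    simpa using hper (ξ, v)
  have hgc := hg.continuous
  let f : C(AddCircle (2 * Real.pi), ℂ) :=
    ⟨hP.lift, continuous_coinduced_dom.2 (by
      show Continuous fun ξ => (g (ξ, v) : ℂ)
      fun_prop)⟩
  have hpc : (Real.pi : ℂ) ≠ 0 := Complex.ofReal_ne_zero.2 Real.pi_ne_zero
  have hcoef : ∀ k : ℤ, fourierCoeff f k = partialFourier g k v := fun k => by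
    rw [fourierCoeff_eq_intervalIntegral _ _ 0, partialFourier, zero_add, Complex.real_smul]
    push_cast
    congr 1
    refine intervalIntegral.integral_congr fun ξ _ => ?_
    simp only [smul_eq_mul, fourier_coe_apply]
    rw [mul_comm]
    congr 2
    push_cast
    field_simp
  obtain ⟨B, hB0, hB⟩ := exists_partialFourier_bound hg hper |v|
  have hsum : Summable (fourierCoeff f) := by
    refine Summable.of_norm_bounded_eventually
      (summable_const_div_int_pow B (p := 3) (by norm_num)) ?_
    filter_upwards [(finite_singleton (0 : ℤ)).compl_mem_cofinite] with k hk
    rw [hcoef]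
    exact ((hB k v le_rfl).2 hk).1
  have := has_pointwise_sum_fourier_series_of_summable hsum (ξ : AddCircle (2 * Real.pi))
  convert! this using 2 with k
  rw [hcoef, fourier_coe_apply, smul_eq_mul]
  congr 2
  push_cast
  field_simp

/-! ### The separatrix -/

/-- The eigenvalues of the linearization are the square roots of `f'(xe)`. If `f'(xe) ≤ 0` they lie
on the imaginary axis, so a hyperbolic equilibrium of a second-order equation is a saddle. -/
theorem IsHyperbolicEquilibrium.deriv_pos {f : ℝ → ℝ} {xe : ℝ}
    (h : IsHyperbolicEquilibrium f xe) : 0 < deriv f xe := by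
  by_contra hneg
  rw [not_lt] at hneg
  set a := deriv f xe
  have hsq : ((√(-a) : ℝ) : ℂ) ^ 2 = -a := by
    rw [← Complex.ofReal_pow, Real.sq_sqrt (by linarith)]; push_cast; rfl
  obtain ⟨z, hz⟩ : ∃ z : ℂ, z = Complex.I * (√(-a) : ℝ) := ⟨_, rfl⟩
  have hz2 : z * z = a := by
    rw [hz]; linear_combination Complex.I_sq * (-a : ℂ) + Complex.I ^ 2 * hsq
  refine h.2 z ?_ (by simp [hz])
  rw [spectrum.mem_iff, Matrix.isUnit_iff_isUnit_det, Matrix.det_fin_two, isUnit_iff_ne_zero,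
    not_not]
  simp [Matrix.algebraMap_matrix_apply, hz2, a]

theorem exists_abs_le_of_tendsto {g : ℝ → ℝ} (hg : Continuous g) {a b : ℝ}
    (ha : Tendsto g atTop (𝓝 a)) (hb : Tendsto g atBot (𝓝 b)) : ∃ B, ∀ t, |g t| ≤ B := by
  obtain ⟨T1, h1⟩ := eventually_atTop.1 (ha.abs.eventually (ge_mem_nhds (lt_add_one |a|)))
  obtain ⟨T2, h2⟩ := eventually_atBot.1 (hb.abs.eventually (ge_mem_nhds (lt_add_one |b|)))
  obtain ⟨B, hB⟩ := (isCompact_Icc (a := T2) (b := T1)).exists_bound_of_continuousOn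
    hg.continuousOn
  refine ⟨max B (max (|a| + 1) (|b| + 1)), fun t => ?_⟩
  rcases le_total T1 t with h | h
  · exact (h1 t h).trans (by simp)
  rcases le_total t T2 with h' | h'
  · exact (h2 t h').trans (by simp)
  · exact (hB t ⟨h', h⟩).trans (by simp)

/-- Bounded solutions near a saddle: they lie in a cone around the stable direction, and decay. -/
theorem cone_decay {y v e : ℝ → ℝ} {l κ T B : ℝ} (hl : 0 < l)
    (hy : ∀ t, T ≤ t → HasDerivAt y (v t) t)
    (hv : ∀ t, T ≤ t → HasDerivAt v (l ^ 2 * y t + e t) t)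
    (he : ∀ t, T ≤ t → |e t| ≤ κ * (|y t| + |v t|)) (hκ0 : 0 ≤ κ)
    (hκ : κ * (1 / (2 * l) + 1 / 2) ≤ l / 4)
    (hB : ∀ t, T ≤ t → |y t| ≤ B ∧ |v t| ≤ B) :
    (∀ t, T ≤ t → 2 * |v t + l * y t| ≤ |v t - l * y t|) ∧
    ∀ s t, T ≤ s → s ≤ t →
      (v t - l * y t) ^ 2 ≤ Real.exp (-l * (t - s)) * (v s - l * y s) ^ 2 := by
  -- The coordinates that diagonalize the linear part: `u` expands and `w` contracts at rate `l`.
  set u : ℝ → ℝ := fun t => v t + l * y t with hu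
  set w : ℝ → ℝ := fun t => v t - l * y t with hw
  have hud : ∀ t, T ≤ t → HasDerivAt u (l * u t + e t) t := fun t ht => by
    convert! (hv t ht).fun_add ((hy t ht).const_mul l) using 1
    simp only [hu]; ring
  have hwd : ∀ t, T ≤ t → HasDerivAt w (-l * w t + e t) t := fun t ht => by
    convert! (hv t ht).fun_sub ((hy t ht).const_mul l) using 1
    simp only [hw]; ring
  have he' : ∀ t, T ≤ t → |e t| ≤ l / 4 * (|u t| + |w t|) := fun t ht => by
    refine (he t ht).trans ?_
    have h1 : |v t| ≤ (|u t| + |w t|) / 2 := by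
      have := abs_add_le (u t) (w t)
      rw [show u t + w t = 2 * v t by simp only [hu, hw]; ring, abs_mul, abs_two] at this
      linarith
    have h2 : |y t| ≤ (|u t| + |w t|) / (2 * l) := by
      have := abs_sub (u t) (w t)
      rw [show u t - w t = 2 * l * y t by simp only [hu, hw]; ring, abs_mul,
        abs_of_pos (by positivity : 0 < 2 * l)] at this
      rw [le_div_iff₀ (by positivity)]
      linarith
    calc κ * (|y t| + |v t|) ≤ κ * ((|u t| + |w t|) / (2 * l) + (|u t| + |w t|) / 2) := by gcongr
      _ = κ * (1 / (2 * l) + 1 / 2) * (|u t| + |w t|) := by ring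
      _ ≤ _ := by gcongr
  -- Outside the cone `4u² - w²` is positive, and from then on it grows at least like `exp(l t)`,
  -- which a bounded solution does not allow.
  have cone : ∀ t, T ≤ t → 4 * u t ^ 2 ≤ w t ^ 2 := by
    by_contra! hcon
    obtain ⟨t1, ht1, hpos⟩ := hcon
    set Φ : ℝ → ℝ := fun t => 4 * u t ^ 2 - w t ^ 2 with hΦ
    have hΦd : ∀ t, T ≤ t → HasDerivAt (fun t => Φ t * Real.exp (-l * t))
        ((8 * u t * (l * u t + e t) - 2 * w t * (-l * w t + e t) - l * Φ t) *
          Real.exp (-l * t)) t := fun t ht => by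
      convert! ((((hud t ht).fun_pow 2).const_mul 4).fun_sub ((hwd t ht).fun_pow 2)).fun_mul
        (((hasDerivAt_id t).const_mul (-l)).exp) using 1
      simp only [hΦ, id]
      push_cast
      ring
    have mono : MonotoneOn (fun t => Φ t * Real.exp (-l * t)) (Ici T) := by
      refine monotoneOn_of_hasDerivWithinAt_nonneg (convex_Ici T)
        (fun t ht => (hΦd t ht).continuousAt.continuousWithinAt)
        (fun t ht => (hΦd t (interior_subset ht)).hasDerivWithinAt) (fun t ht => ?_)
      have hb := he' t (interior_subset ht)
      refine mul_nonneg ?_ (Real.exp_pos _).le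
      have h3 : |e t * (8 * u t - 2 * w t)| ≤
          l / 4 * (|u t| + |w t|) * (8 * |u t| + 2 * |w t|) := by
        rw [abs_mul]
        refine mul_le_mul hb ?_ (abs_nonneg _) (by positivity)
        refine (abs_sub _ _).trans (le_of_eq ?_)
        rw [abs_mul, abs_mul, abs_two, abs_of_pos (by norm_num : (0 : ℝ) < 8)]
      have h4 := (abs_le.1 h3).1
      have h5 : (|u t| + |w t|) * (8 * |u t| + 2 * |w t|) ≤ 13 * u t ^ 2 + 7 * w t ^ 2 := by
        rw [← sq_abs (u t), ← sq_abs (w t)]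
        nlinarith [sq_nonneg (|u t| - |w t|)]
      have h6 : l / 4 * (|u t| + |w t|) * (8 * |u t| + 2 * |w t|) ≤
          l / 4 * (13 * u t ^ 2 + 7 * w t ^ 2) := by
        rw [mul_assoc]; gcongr
      have h7 : 0 ≤ l * (u t) ^ 2 := by positivity
      have h8 : 0 ≤ l * (w t) ^ 2 := by positivity
      simp only [hΦ]
      nlinarith
    have hΦ1 : 0 < Φ t1 := by simp only [hΦ]; linarith
    have hB0 : 0 ≤ B := (abs_nonneg _).trans (hB t1 ht1).1
    have hΦb : ∀ t, T ≤ t → Φ t ≤ 4 * (B + l * B) ^ 2 := fun t ht => by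
      have h1 : |u t| ≤ B + l * B := by
        refine (abs_add_le _ _).trans (add_le_add (hB t ht).2 ?_)
        rw [abs_mul, abs_of_pos hl]
        exact mul_le_mul_of_nonneg_left (hB t ht).1 hl.le
      have h2 : u t ^ 2 ≤ (B + l * B) ^ 2 := by
        rw [← sq_abs]; gcongr
      simp only [hΦ]
      nlinarith [sq_nonneg (w t)]
    have hgrow : ∀ t, t1 ≤ t → Φ t1 * Real.exp (l * (t - t1)) ≤ 4 * (B + l * B) ^ 2 :=
      fun t ht => by
      refine le_trans ?_ (hΦb t (ht1.trans ht))
      have := mono (mem_Ici.2 ht1) (mem_Ici.2 (ht1.trans ht)) ht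
      simp only at this
      have e1 : Real.exp (l * (t - t1)) = Real.exp (-l * t1) / Real.exp (-l * t) := by
        rw [← Real.exp_sub]; congr 1; ring
      rw [e1, ← mul_div_assoc, div_le_iff₀ (Real.exp_pos _)]
      exact this
    have hlim : Tendsto (fun t => Φ t1 * Real.exp (l * (t - t1))) atTop atTop :=
      (Real.tendsto_exp_atTop.comp ((tendsto_atTop_add_const_right atTop (-t1)
        tendsto_id).const_mul_atTop hl)).const_mul_atTop hΦ1
    obtain ⟨t, h1, h2⟩ := ((hlim.eventually_gt_atTop (4 * (B + l * B) ^ 2)).and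
      (eventually_ge_atTop t1)).exists
    exact absurd (hgrow t h2) (not_le.2 h1)
  have cone' : ∀ t, T ≤ t → 2 * |u t| ≤ |w t| := fun t ht => by
    have := cone t ht
    refine le_of_sq_le_sq ?_ (abs_nonneg _)
    rw [mul_pow, sq_abs, sq_abs]
    linarith
  refine ⟨cone', fun s t hs hst => ?_⟩
  have hwd2 : ∀ t, T ≤ t → HasDerivAt (fun t => w t ^ 2 * Real.exp (l * t))
      ((2 * w t * (-l * w t + e t) + l * w t ^ 2) * Real.exp (l * t)) t := fun t ht => by
    convert! ((hwd t ht).fun_pow 2).fun_mul (((hasDerivAt_id t).const_mul l).exp) using 1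
    simp only [id]
    push_cast
    ring
  -- Inside the cone the perturbation takes away at most half of the contraction rate `2l` of `w²`.
  have anti : AntitoneOn (fun t => w t ^ 2 * Real.exp (l * t)) (Ici T) := by
    refine antitoneOn_of_hasDerivWithinAt_nonpos (convex_Ici T)
      (fun t ht => (hwd2 t ht).continuousAt.continuousWithinAt)
      (fun t ht => (hwd2 t (interior_subset ht)).hasDerivWithinAt) (fun t ht => ?_)
    refine mul_nonpos_of_nonpos_of_nonneg ?_ (Real.exp_pos _).le
    have hb := he' t (interior_subset ht)
    have hc := cone' t (interior_subset ht)
    have h3 : |e t * w t| ≤ l / 2 * w t ^ 2 := by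
      rw [abs_mul, ← sq_abs (w t)]
      calc |e t| * |w t| ≤ l / 4 * (2 * |w t|) * |w t| := by
            gcongr
            refine hb.trans ?_
            gcongr
            linarith [abs_nonneg (u t)]
        _ = _ := by ring
    nlinarith [(abs_le.1 h3).2]
  have := anti (mem_Ici.2 hs) (mem_Ici.2 (hs.trans hst)) hst
  simp only at this
  have e1 : Real.exp (-l * (t - s)) = Real.exp (l * s) / Real.exp (l * t) := by
    rw [← Real.exp_sub]; congr 1; ring
  rw [e1, div_mul_eq_mul_div, le_div_iff₀ (Real.exp_pos _)]
  linarith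

/-- Growth estimates for an orbit `x' = v`, `v' = w` and its rate of decay at `+∞`. -/
structure DecayAtTop (V W : ℝ → ℝ) (C ν T K : ℝ) : Prop where
  pos : 0 < C
  rate : 0 < ν
  tail : ∀ t, T ≤ t → |V t| ≤ K * |W t|
  decay : ∀ s t, 0 ≤ s → s ≤ t →
    √(V t ^ 2 + W t ^ 2) ≤ C * Real.exp (-ν * (t - s)) * √(V s ^ 2 + W s ^ 2)

/-- The force does not depend on the velocity, so the reversed orbit solves the same equation.
Estimates at `-∞` are thereby reduced to estimates at `+∞`. -/
theorem IsHomoclinic.reverse {f : ℝ → ℝ} {xe : ℝ} {x₀ : ℝ → ℝ} (h : IsHomoclinic f xe x₀) :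
    IsHomoclinic f xe (fun t => x₀ (-t)) ∧ deriv (fun t => x₀ (-t)) = fun t => -deriv x₀ (-t) := by
  obtain ⟨h1, h2, h3, h4, h5, h6, t, ht⟩ := h
  have e : deriv (fun t => x₀ (-t)) = fun t => -deriv x₀ (-t) := by
    funext t; exact deriv_comp_neg x₀ t
  refine ⟨⟨fun t => ?_, fun t => ?_, h5.comp tendsto_neg_atTop_atBot, ?_,
    h3.comp tendsto_neg_atBot_atTop, ?_, -t, by simpa⟩, e⟩
  · rw [e]; exact hasDerivAt_comp_neg (h1 (-t))
  · rw [e]; simpa using (hasDerivAt_comp_neg (h2 (-t))).fun_neg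
  · rw [e]; simpa using (h6.comp tendsto_neg_atTop_atBot).neg
  · rw [e]; simpa using (h4.comp tendsto_neg_atBot_atTop).neg

section

variable {f : ℝ → ℝ} {xe : ℝ} {x₀ : ℝ → ℝ}

theorem IsHomoclinic.hasDerivAt_W (h : IsHomoclinic f xe x₀) (hf : ContDiff ℝ 3 f) (t : ℝ) :
    HasDerivAt (fun t => f (x₀ t)) (deriv f (x₀ t) * deriv x₀ t) t :=
  ((hf.differentiable (by norm_num)) (x₀ t)).hasDerivAt.comp t (h.1 t)

theorem IsHomoclinic.continuous (h : IsHomoclinic f xe x₀) : Continuous x₀ :=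
  continuous_iff_continuousAt.2 fun t => (h.1 t).continuousAt

theorem IsHomoclinic.continuous_deriv (h : IsHomoclinic f xe x₀) : Continuous (deriv x₀) :=
  continuous_iff_continuousAt.2 fun t => (h.2.1 t).continuousAt

theorem contDiff_deriv_two (hf : ContDiff ℝ 3 f) : ContDiff ℝ 2 (deriv f) :=
  (contDiff_succ_iff_deriv.1 (show ContDiff ℝ (2 + 1) f from hf)).2.2

theorem contDiff_deriv_one (hf : ContDiff ℝ 3 f) : ContDiff ℝ 1 (deriv (deriv f)) :=
  (contDiff_succ_iff_deriv.1 (show ContDiff ℝ (1 + 1) (deriv f) from contDiff_deriv_two hf)).2.2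

/-- A common bound for all quantities along the orbit. -/
theorem IsHomoclinic.exists_bound (h : IsHomoclinic f xe x₀) (hf : ContDiff ℝ 3 f) :
    ∃ L, 1 ≤ L ∧ ∀ t, |deriv x₀ t| ≤ L ∧ |f (x₀ t)| ≤ L ∧ |deriv f (x₀ t)| ≤ L ∧
      |deriv (deriv f) (x₀ t) * deriv x₀ t| ≤ L ∧ |x₀ t| ≤ L := by
  have c1 := (contDiff_deriv_two hf).continuous
  have c2 := (contDiff_deriv_one hf).continuous
  have cx := h.continuous
  have cv := h.continuous_deriv
  have cf := hf.continuous
  obtain ⟨-, -, h3, h4, h5, h6, -⟩ := h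
  obtain ⟨B1, hB1⟩ := exists_abs_le_of_tendsto cv h4 h6
  obtain ⟨B2, hB2⟩ := exists_abs_le_of_tendsto (cf.comp cx)
    ((cf.tendsto xe).comp h3) ((cf.tendsto xe).comp h5)
  obtain ⟨B3, hB3⟩ := exists_abs_le_of_tendsto (c1.comp cx)
    ((c1.tendsto xe).comp h3) ((c1.tendsto xe).comp h5)
  obtain ⟨B4, hB4⟩ := exists_abs_le_of_tendsto ((c2.comp cx).mul cv)
    (((c2.tendsto xe).comp h3).mul h4) (((c2.tendsto xe).comp h5).mul h6)
  obtain ⟨B5, hB5⟩ := exists_abs_le_of_tendsto cx h3 h5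
  have hnn : ∀ {B : ℝ} {g : ℝ → ℝ}, (∀ t, |g t| ≤ B) → 0 ≤ B := fun hB =>
    (abs_nonneg _).trans (hB 0)
  have n1 := hnn hB1
  have n2 := hnn hB2
  have n3 := hnn hB3
  have n4 := hnn hB4
  have n5 := hnn hB5
  refine ⟨1 + B1 + B2 + B3 + B4 + B5, by linarith, fun t => ⟨(hB1 t).trans (by linarith),
    (hB2 t).trans (by linarith), (hB3 t).trans (by linarith), (hB4 t).trans (by linarith),
    (hB5 t).trans (by linarith)⟩⟩

/-- The orbit does not pass through an equilibrium. -/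
theorem IsHomoclinic.speed_pos (h : IsHomoclinic f xe x₀) (hf : ContDiff ℝ 3 f) (t : ℝ) :
    0 < deriv x₀ t ^ 2 + f (x₀ t) ^ 2 := by
  obtain ⟨L, -, hL⟩ := h.exists_bound hf
  by_contra hle
  rw [not_lt] at hle
  have hz : ∀ s, deriv x₀ s = 0 := fun s => by
    have := sq_add_sq_le_exp h.2.1 (h.hasDerivAt_W hf) (fun t => (hL t).2.2.1) t s
    have h0 := this.trans (mul_nonpos_of_nonneg_of_nonpos (Real.exp_pos _).le hle)
    nlinarith [sq_nonneg (deriv x₀ s), sq_nonneg (f (x₀ s))]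
  have hconst : ∀ s, x₀ s = x₀ 0 := fun s =>
    is_const_of_deriv_eq_zero (fun s => (h.1 s).differentiableAt) hz s 0
  obtain ⟨-, -, h3, -, -, -, s, hs⟩ := h
  refine hs ?_
  have : Tendsto x₀ atTop (𝓝 (x₀ 0)) := by
    rw [show x₀ = fun _ => x₀ 0 from funext hconst]; exact tendsto_const_nhds
  rw [hconst s]
  exact tendsto_nhds_unique this h3

/-- For large times `x₀ - xe` is a bounded solution near the saddle, so `cone_decay` applies with
the Taylor remainder of `f` as perturbation. Inside the cone `V`, `W` and the stable coordinate are
comparable, which gives both the tail inequality and the exponential decay; Grönwall covers the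
remaining compact time interval. -/
theorem IsHomoclinic.exists_decayAtTop (h : IsHomoclinic f xe x₀) (hf : ContDiff ℝ 3 f)
    (hxe : IsHyperbolicEquilibrium f xe) :
    ∃ C ν T K, DecayAtTop (deriv x₀) (fun t => f (x₀ t)) C ν T K := by
  obtain ⟨L, hL1, hL⟩ := h.exists_bound hf
  set V := deriv x₀ with hV
  set W : ℝ → ℝ := fun t => f (x₀ t) with hW
  have hl2 := hxe.deriv_pos
  set l := √(deriv f xe) with hl
  have hl0 : 0 < l := Real.sqrt_pos.2 hl2
  have hsq : l ^ 2 = deriv f xe := Real.sq_sqrt hl2.le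
  -- Four times smaller than `cone_decay` demands: the lower bound for `|W|` in terms of the stable
  -- coordinate requires that the remainder not cancel the linear term `l² y`.
  set κ := l / 16 / (1 / (2 * l) + 1 / 2) with hκ
  have hκ0 : 0 < κ := by positivity
  have hκl : κ * (1 / (2 * l) + 1 / 2) = l / 16 := div_mul_cancel₀ _ (by positivity)
  have hlo : ∀ᶠ x in 𝓝 xe, |f x - f xe - deriv f xe * (x - xe)| ≤ κ * |x - xe| := by
    have := ((hf.differentiable (by norm_num)) xe).hasDerivAt.hasFDerivAt.isLittleO.bound hκ0
    filter_upwards [this] with x hx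
    simpa [mul_comm] using hx
  obtain ⟨T0, hT0⟩ := eventually_atTop.1 (h.2.2.1.eventually hlo)
  set T := max T0 0 with hT
  set y : ℝ → ℝ := fun t => x₀ t - xe with hy
  set e : ℝ → ℝ := fun t => f (x₀ t) - l ^ 2 * y t with he
  have heb : ∀ t, T ≤ t → |e t| ≤ κ * (|y t| + |V t|) := fun t ht => by
    have := hT0 t ((le_max_left _ _).trans ht)
    rw [hxe.1, sub_zero, ← hsq] at this
    exact this.trans (mul_le_mul_of_nonneg_left (le_add_of_nonneg_right (abs_nonneg _)) hκ0.le)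
  obtain ⟨hcone, hdec⟩ := cone_decay (y := y) (v := V) (e := e) hl0 (T := T) (B := L + |xe|)
    (fun t _ => (h.1 t).sub_const xe)
    (fun t _ => by convert! h.2.1 t using 1; simp only [he]; ring) heb hκ0.le (by rw [hκl]; linarith) (fun t _ => by
      refine ⟨(abs_sub _ _).trans (add_le_add (hL t).2.2.2.2 le_rfl), (hL t).1.trans ?_⟩
      linarith [abs_nonneg xe])
  set w : ℝ → ℝ := fun t => V t - l * y t with hw
  -- comparison of the coordinates with the stable one
  have cmp : ∀ t, T ≤ t → |w t| ≤ 4 * |V t| ∧ |V t| ≤ |w t| ∧ |W t| ≤ l * |w t| ∧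
      l * |w t| ≤ 8 * |W t| := fun t ht => by
    have hc := hcone t ht
    set u := V t + l * y t with hu
    have e1 : V t = (u + w t) / 2 := by simp only [hu, hw]; ring
    have e2 : l * y t = (u - w t) / 2 := by simp only [hu, hw]; ring
    have hc' := abs_le.1 (show |u| ≤ |w t| / 2 by linarith)
    have b1 : |w t| ≤ 4 * |V t| := by
      rw [e1]
      rcases abs_cases (w t) with ⟨q, _⟩ | ⟨q, _⟩ <;> rcases abs_cases ((u + w t) / 2) with ⟨q', _⟩ | ⟨q', _⟩ <;>
        rw [q, q'] <;> rw [q] at hc' <;> linarith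
    have b2 : |V t| ≤ 3 / 4 * |w t| := by
      rw [e1]
      rcases abs_cases (w t) with ⟨q, _⟩ | ⟨q, _⟩ <;> rw [q] at hc' ⊢ <;>
        exact abs_le.2 ⟨by linarith, by linarith⟩
    have b3 : |w t| / 4 ≤ |l * y t| := by
      rw [e2]
      rcases abs_cases (w t) with ⟨q, _⟩ | ⟨q, _⟩ <;> rcases abs_cases ((u - w t) / 2) with ⟨q', _⟩ | ⟨q', _⟩ <;>
        rw [q, q'] <;> rw [q] at hc' <;> linarith
    have b4 : |l * y t| ≤ 3 / 4 * |w t| := by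
      rw [e2]
      rcases abs_cases (w t) with ⟨q, _⟩ | ⟨q, _⟩ <;> rw [q] at hc' ⊢ <;>
        exact abs_le.2 ⟨by linarith, by linarith⟩
    have b5 : |e t| ≤ l / 8 * |w t| := by
      refine (heb t ht).trans ?_
      have hy' : |y t| ≤ 3 / (4 * l) * |w t| := by
        rw [abs_mul, abs_of_pos hl0] at b4
        rw [div_mul_eq_mul_div, le_div_iff₀ (by positivity)]
        linarith
      calc κ * (|y t| + |V t|) ≤ κ * (3 / (4 * l) * |w t| + 3 / 4 * |w t|) := by gcongr
        _ = κ * (1 / (2 * l) + 1 / 2) * (3 / 2 * |w t|) := by ring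
        _ = l * |w t| * (3 / 32) := by rw [hκl]; ring
        _ ≤ l * |w t| * (1 / 8) := mul_le_mul_of_nonneg_left (by norm_num) (by positivity)
        _ = _ := by ring
    have e3 : W t = l * (l * y t) + e t := by simp only [he, hW]; ring
    have b6 : |l * (l * y t)| = l * |l * y t| := by rw [abs_mul, abs_of_pos hl0]
    refine ⟨b1, b2.trans (by linarith [abs_nonneg (w t)]), ?_, ?_⟩
    · rw [e3]
      refine (abs_add_le _ _).trans ?_
      rw [b6]
      have := mul_le_mul_of_nonneg_left b4 hl0.le
      have := mul_nonneg hl0.le (abs_nonneg (w t))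
      linarith
    · have h1 : |l * (l * y t)| ≤ |W t| + |e t| := by
        rw [show l * (l * y t) = W t - e t by rw [e3]; ring]
        exact abs_sub _ _
      rw [b6] at h1
      have := mul_le_mul_of_nonneg_left b3 hl0.le
      linarith
  set D := 16 * (1 + l ^ 2) with hD
  have hD1 : 1 ≤ D := by nlinarith [sq_nonneg l]
  -- decay of the squared speed
  have dec1 : ∀ s t, T ≤ s → s ≤ t →
      V t ^ 2 + W t ^ 2 ≤ D * Real.exp (-l * (t - s)) * (V s ^ 2 + W s ^ 2) := by
    intro s t hs hst
    obtain ⟨-, c2, c3, -⟩ := cmp t (hs.trans hst)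
    obtain ⟨c1, -⟩ := cmp s hs
    have q1 : V t ^ 2 ≤ w t ^ 2 := sq_le_sq.2 c2
    have q2 : W t ^ 2 ≤ l ^ 2 * w t ^ 2 := by
      rw [← mul_pow]; exact sq_le_sq.2 (by rwa [abs_mul, abs_of_pos hl0])
    have q3 : w s ^ 2 ≤ 16 * V s ^ 2 := by
      rw [show 16 * V s ^ 2 = (4 * V s) ^ 2 by ring]
      exact sq_le_sq.2 (by rwa [abs_mul, abs_of_pos (by norm_num : (0 : ℝ) < 4)])
    have q4 := hdec s t hs hst
    have hexp := Real.exp_pos (-l * (t - s))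
    calc _ ≤ (1 + l ^ 2) * w t ^ 2 := by linarith
      _ ≤ (1 + l ^ 2) * (Real.exp (-l * (t - s)) * (16 * (V s ^ 2 + W s ^ 2))) := by
          gcongr
          refine q4.trans ?_
          gcongr
          linarith [sq_nonneg (W s)]
      _ = _ := by ring
  have hT00 : 0 ≤ T := le_max_right _ _
  -- On `[0, T]` there is only the Grönwall bound; the exponential pays for the growth at rate `1 +
  -- L` and for the missing decay at rate `l`.
  set P := D * Real.exp ((1 + L + l) * T) with hP
  have gron : ∀ s t, 0 ≤ s → s ≤ t → t ≤ T →
      V t ^ 2 + W t ^ 2 ≤ Real.exp ((1 + L) * T) * (V s ^ 2 + W s ^ 2) := fun s t hs hst ht => by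
    refine (sq_add_sq_le_exp h.2.1 (h.hasDerivAt_W hf) (fun t => (hL t).2.2.1) s t).trans ?_
    gcongr
    rw [abs_of_nonneg (by linarith)]
    linarith
  have dec2 : ∀ s t, 0 ≤ s → s ≤ t →
      V t ^ 2 + W t ^ 2 ≤ P * Real.exp (-l * (t - s)) * (V s ^ 2 + W s ^ 2) := by
    intro s t hs hst
    have hR : 0 ≤ V s ^ 2 + W s ^ 2 := by positivity
    have hLT : 0 ≤ (1 + L) * T := by positivity
    rcases le_total T s with h1 | h1
    · refine (dec1 s t h1 hst).trans ?_
      gcongr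
      exact le_mul_of_one_le_right (by linarith) (Real.one_le_exp (by positivity))
    rcases le_total t T with h2 | h2
    · refine (gron s t hs hst h2).trans (mul_le_mul_of_nonneg_right ?_ hR)
      calc Real.exp ((1 + L) * T) ≤ 1 * (Real.exp ((1 + L + l) * T) * Real.exp (-l * (t - s))) := by
            rw [one_mul, ← Real.exp_add]
            apply Real.exp_le_exp.2
            nlinarith
        _ ≤ D * (Real.exp ((1 + L + l) * T) * Real.exp (-l * (t - s))) := by gcongr
        _ = _ := by rw [hP]; ring
    · have g1 := dec1 T t le_rfl h2
      have g2 := gron s T hs h1 le_rfl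
      calc _ ≤ D * Real.exp (-l * (t - T)) * (Real.exp ((1 + L) * T) * (V s ^ 2 + W s ^ 2)) := by
            refine g1.trans ?_; gcongr
        _ = D * (Real.exp (-l * (t - T)) * Real.exp ((1 + L) * T)) * (V s ^ 2 + W s ^ 2) := by ring
        _ ≤ D * (Real.exp ((1 + L + l) * T) * Real.exp (-l * (t - s))) *
            (V s ^ 2 + W s ^ 2) := by
            refine mul_le_mul_of_nonneg_right (mul_le_mul_of_nonneg_left ?_ (by linarith)) hR
            rw [← Real.exp_add, ← Real.exp_add]
            apply Real.exp_le_exp.2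
            nlinarith
        _ = _ := by rw [hP]; ring
  refine ⟨√P, l / 2, T, 8 / l, ⟨by positivity, by positivity, fun t ht => ?_,
    fun s t hs hst => ?_⟩⟩
  · obtain ⟨-, c2, -, c4⟩ := cmp t ht
    rw [div_mul_eq_mul_div, le_div_iff₀ hl0]
    nlinarith
  · have : Real.exp (-(l / 2) * (t - s)) = √(Real.exp (-l * (t - s))) := by
      rw [← Real.exp_half]; congr 1; ring
    rw [this, ← Real.sqrt_mul (by positivity), ← Real.sqrt_mul (by positivity)]
    exact Real.sqrt_le_sqrt (dec2 s t hs hst)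

end

theorem integrable_of_abs_le_exp {g : ℝ → ℝ} {A ν : ℝ} (hg : Continuous g) (hν : 0 < ν)
    (h : ∀ t, |g t| ≤ A * Real.exp (-ν * |t|)) : Integrable g := by
  have h1 : IntegrableOn (fun t : ℝ => A * Real.exp (-ν * |t|)) (Ioi 0) := by
    refine IntegrableOn.congr_fun (f := fun t => A * Real.exp (-ν * t))
      ((exp_neg_integrableOn_Ioi 0 hν).const_mul A) (fun t ht => ?_) measurableSet_Ioi
    simp only [abs_of_pos (mem_Ioi.1 ht)]
  have h2 : Integrable (fun t : ℝ => A * Real.exp (-ν * |t|)) := by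
    rw [← integrableOn_univ, ← Iic_union_Ioi (a := (0 : ℝ))]
    refine IntegrableOn.union ?_ h1
    have h3 := (integrableOn_Ici_iff_integrableOn_Ioi (by simp)).2 h1
    have h4 := (Measure.measurePreserving_neg (volume : Measure ℝ)).integrableOn_comp_preimage
      (Homeomorph.neg ℝ).measurableEmbedding (f := fun t : ℝ => A * Real.exp (-ν * |t|))
      (s := Ici 0)
    simpa [Function.comp_def] using h4.2 h3
  exact h2.mono' hg.aestronglyMeasurable (Eventually.of_forall fun t => by
    rw [Real.norm_eq_abs]; exact h t)

theorem exists_pos_forall_mem_finset {ι : Type*} (s : Finset ι) (P : ι → ℝ → Prop)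
    (anti : ∀ i c c', 0 < c' → c' ≤ c → P i c → P i c') (h : ∀ i ∈ s, ∃ c > 0, P i c) :
    ∃ c, 0 < c ∧ c ≤ 1 ∧ ∀ i ∈ s, P i c := by
  classical
  induction s using Finset.induction_on with
  | empty => exact ⟨1, one_pos, le_rfl, by simp⟩
  | insert j s _ ih =>
    obtain ⟨c, hc, hc1, hP⟩ := ih fun i hi => h i (Finset.mem_insert_of_mem hi)
    obtain ⟨c', hc', hP'⟩ := h j (Finset.mem_insert_self _ _)
    refine ⟨min c c', lt_min hc hc', (min_le_left _ _).trans hc1, fun i hi => ?_⟩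
    rcases Finset.mem_insert.1 hi with rfl | hi
    · exact anti _ _ _ (lt_min hc hc') (min_le_right _ _) hP'
    · exact anti _ _ _ (lt_min hc hc') (min_le_left _ _) (hP i hi)

/-! ### Nondegeneracy and finiteness of the critical points -/

section

variable {V W : ℝ → ℝ} {T K L : ℝ}

/-- Uniform nondegeneracy of the critical points of the phases `k X + μ t`. -/
theorem exists_nondegeneracy (cV : Continuous V) (cW : Continuous W) (hK : 1 ≤ K) (hL : 1 ≤ L)
    (bV : ∀ t, |V t| ≤ L) (tail : ∀ t, T ≤ |t| → |V t| ≤ K * |W t|)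
    (hR : ∀ t, 0 < V t ^ 2 + W t ^ 2) (μ : ℝ)
    (hnd : ∀ k : ℤ, k ≠ 0 → ∀ t, k * V t + μ = 0 → W t ≠ 0) :
    ∃ c > 0, ∀ k : ℤ, k ≠ 0 → ∀ t, |k * V t + μ| ≤ c → c * |V t| ≤ |W t| := by
  have hcomp : IsCompact (Icc (-|T|) |T|) := isCompact_Icc
  have hne : (Icc (-|T|) |T|).Nonempty := ⟨0, by simp, by simp⟩
  obtain ⟨s, -, hs⟩ := hcomp.exists_isMinOn hne
    ((cV.pow 2).add (cW.pow 2)).continuousOn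
  set ρ := V s ^ 2 + W s ^ 2 with hρ
  have hρ0 : 0 < ρ := hR s
  set v₀ := √(ρ / 2) with hv₀
  have hv₀0 : 0 < v₀ := Real.sqrt_pos.2 (by positivity)
  -- For `|k| > n` a nearly stationary phase forces `|V| < v₀`. As the speed is bounded below on the
  -- compact interval, `|W|` then exceeds `|V|`. Only finitely many `k` are left to compactness.
  obtain ⟨n, hn⟩ := exists_nat_gt ((1 + |μ|) / v₀)
  obtain ⟨c, hc, hc1, hP⟩ := exists_pos_forall_mem_finset (Finset.Icc (-n : ℤ) n)
    (fun k c => k ≠ 0 → ∀ t ∈ Icc (-|T|) |T|, |k * V t + μ| ≤ c → c * |V t| ≤ |W t|)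
    (fun k c c' _ hcc h hk t ht hle => (mul_le_mul_of_nonneg_right hcc (abs_nonneg _)).trans
      (h hk t ht (hle.trans hcc))) (fun k _ => by
      by_cases hk : k = 0
      · exact ⟨1, one_pos, fun h => absurd hk h⟩
      -- The minimum of the larger of `|k V + μ|` and `|W|` is positive, because the two do not
      -- vanish together. Where the first is below the minimum, the second is at least the minimum.
      obtain ⟨u, -, hu⟩ := hcomp.exists_isMinOn hne
        (f := fun t => max |k * V t + μ| |W t|)
        (((continuous_const.mul cV).add continuous_const).abs.max cW.abs).continuousOn
      set m := max |k * V u + μ| |W u| with hm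
      have hm0 : 0 < m := by
        by_contra hle
        rw [not_lt] at hle
        have h1 : |k * V u + μ| = 0 := le_antisymm ((le_max_left _ _).trans hle) (abs_nonneg _)
        have h2 : |W u| = 0 := le_antisymm ((le_max_right _ _).trans hle) (abs_nonneg _)
        exact hnd k hk u (abs_eq_zero.1 h1) (abs_eq_zero.1 h2)
      have hL0 : 0 < L := by linarith
      refine ⟨m / (2 * L), by positivity, fun _ t ht hle => ?_⟩
      have h1 : m ≤ max |k * V t + μ| |W t| := hu ht
      have h2 : m / (2 * L) < m := by
        rw [div_lt_iff₀ (by positivity)]; nlinarith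
      have h3 : m ≤ |W t| := by
        rcases le_max_iff.1 h1 with h | h
        · linarith
        · exact h
      calc m / (2 * L) * |V t| ≤ m / (2 * L) * L := by gcongr; exact bV t
        _ = m / 2 := by field_simp
        _ ≤ |W t| := by linarith)
  have hK0 : 0 < K := by linarith
  refine ⟨min c (1 / K), lt_min hc (by positivity), fun k hk t hle => ?_⟩
  rcases le_total T |t| with ht | ht
  · calc min c (1 / K) * |V t| ≤ 1 / K * (K * |W t|) := by
          gcongr
          · exact min_le_right _ _
          · exact tail t ht
      _ = |W t| := by field_simp
  have htT : t ∈ Icc (-|T|) |T| := abs_le.1 (ht.trans (le_abs_self T))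
  refine (mul_le_mul_of_nonneg_right (min_le_left _ _) (abs_nonneg _)).trans ?_
  have hle' := hle.trans (min_le_left c (1 / K))
  by_cases hkn : k ∈ Finset.Icc (-n : ℤ) n
  · exact hP k hkn hk t htT hle'
  have hkn' : (n : ℝ) < |(k : ℝ)| := by
    rw [Finset.mem_Icc, ← abs_le, not_le] at hkn
    exact_mod_cast hkn
  by_contra hlt
  rw [not_le] at hlt
  have hWV : |W t| ≤ |V t| := hlt.le.trans (mul_le_of_le_one_left (abs_nonneg _) hc1)
  have h1 : ρ ≤ V t ^ 2 + W t ^ 2 := hs htT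
  have h2 : v₀ ≤ |V t| := by
    rw [hv₀, ← Real.sqrt_sq_eq_abs]
    apply Real.sqrt_le_sqrt
    have := sq_le_sq.2 hWV
    linarith
  have h3 : |(k : ℝ)| * |V t| ≤ 1 + |μ| := by
    rw [← abs_mul]
    calc |k * V t| = |(k * V t + μ) - μ| := by rw [add_sub_cancel_right]
      _ ≤ |k * V t + μ| + |μ| := abs_sub _ _
      _ ≤ _ := by linarith
  rw [div_lt_iff₀ hv₀0] at hn
  have h4 : (n : ℝ) * v₀ ≤ |(k : ℝ)| * |V t| :=
    mul_le_mul hkn'.le h2 hv₀0.le (abs_nonneg _)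
  linarith

theorem subsingleton_of_rolle (hV : ∀ t, HasDerivAt V (W t) t) {I : Set ℝ} (hI : I.OrdConnected)
    (h0 : ∀ t ∈ I, W t ≠ 0) (v : ℝ) : (I ∩ {t | V t = v}).Subsingleton := by
  have key : ∀ s ∈ I, ∀ t ∈ I, V s = v → V t = v → ¬ s < t := fun s hs t ht es et hst => by
    obtain ⟨x, hx, hx'⟩ := exists_hasDerivAt_eq_zero (f := V) (f' := W) hst
      (fun x _ => (hV x).continuousAt.continuousWithinAt) (es.trans et.symm) (fun x _ => hV x)
    exact h0 x (hI.out hs ht (Ioo_subset_Icc_self hx)) hx'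
  rintro s ⟨hs, es⟩ t ⟨ht, et⟩
  exact le_antisymm (not_lt.1 (key t ht s hs et es)) (not_lt.1 (key s hs t ht es et))

/-- The level sets of the velocity that avoid turning points are finite. -/
theorem finite_level_of_separated (hV : ∀ t, HasDerivAt V (W t) t) {h : ℝ} (hh : 0 < h)
    (hW : ∀ t, T ≤ |t| → W t ≠ 0) :
    ∃ N : ℕ, ∀ v, (∀ t t', V t = v → V t' = v → t ≠ t' → h < |t' - t|) →
      {t | V t = v}.Finite ∧ {t | V t = v}.ncard ≤ N := by
  -- By Rolle each tail contains at most one point of the level set, since `W` has no zero there. In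
  -- the middle, points more than `h` apart lie in different cells of length `h`. The count does not
  -- involve the level `v`.
  refine ⟨1 + 1 + (Finset.Icc ⌊-|T| / h⌋ ⌊|T| / h⌋).card, fun v hsep => ?_⟩
  have s1 := subsingleton_of_rolle hV (I := Ici |T|) ordConnected_Ici (fun t ht =>
    hW t ((le_abs_self T).trans ((mem_Ici.1 ht).trans (le_abs_self t)))) v
  have s2 := subsingleton_of_rolle hV (I := Iic (-|T|)) ordConnected_Iic (fun t ht =>
    hW t ((le_abs_self T).trans ((le_neg.1 (mem_Iic.1 ht)).trans (neg_le_abs t)))) v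
  set S := Icc (-|T|) |T| ∩ {t | V t = v} with hS
  have hmaps : ∀ t ∈ S, ⌊t / h⌋ ∈ (Finset.Icc ⌊-|T| / h⌋ ⌊|T| / h⌋ : Set ℤ) := fun t ht => by
    rw [Finset.mem_coe, Finset.mem_Icc]
    exact ⟨Int.floor_le_floor (div_le_div_of_nonneg_right ht.1.1 hh.le),
      Int.floor_le_floor (div_le_div_of_nonneg_right ht.1.2 hh.le)⟩
  have hinj : InjOn (fun t : ℝ => ⌊t / h⌋) S := fun t ht t' ht' heq => by
    by_contra hne
    have h1 := hsep t t' ht.2 ht'.2 hne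
    have h2 := Int.abs_sub_lt_one_of_floor_eq_floor (show ⌊t' / h⌋ = ⌊t / h⌋ from heq.symm)
    rw [← sub_div, abs_div, abs_of_pos hh, div_lt_one hh] at h2
    linarith
  have f3 : S.Finite := Finite.of_injOn hmaps hinj (Finset.finite_toSet _)
  have c3 : S.ncard ≤ (Finset.Icc ⌊-|T| / h⌋ ⌊|T| / h⌋).card := by
    rw [← ncard_coe_finset]
    exact ncard_le_ncard_of_injOn _ hmaps hinj (Finset.finite_toSet _)
  have hsub : {t | V t = v} ⊆ (Ici |T| ∩ {t | V t = v} ∪ Iic (-|T|) ∩ {t | V t = v}) ∪ S := by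
    intro t ht
    rcases le_total |T| t with h1 | h1
    · exact Or.inl (Or.inl ⟨h1, ht⟩)
    rcases le_total t (-|T|) with h2 | h2
    · exact Or.inl (Or.inr ⟨h2, ht⟩)
    · exact Or.inr ⟨⟨h2, h1⟩, ht⟩
  have hfin := (s1.finite.union s2.finite).union f3
  refine ⟨hfin.subset hsub, (ncard_le_ncard hsub hfin).trans ((ncard_union_le _ _).trans
    (add_le_add ((ncard_union_le _ _).trans (add_le_add ?_ ?_)) c3))⟩
  · exact haveI := s1.finite.to_subtype; ncard_le_one_iff_subsingleton.2 s1
  · exact haveI := s2.finite.to_subtype; ncard_le_one_iff_subsingleton.2 s2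

end

/-! ### Uniform estimates along the homoclinic orbit -/

section

variable {f : ℝ → ℝ} {xe : ℝ} {x₀ : ℝ → ℝ}

/-- The decay at `+∞` of the orbit and of its time reversal combine to `|V|, |W| ≤ A exp(-ν |t|)`,
whence integrability. -/
theorem IsHomoclinic.exists_decayingOrbit (h : IsHomoclinic f xe x₀) (hf : ContDiff ℝ 3 f)
    (hxe : IsHyperbolicEquilibrium f xe) :
    ∃ L, DecayingOrbit x₀ (deriv x₀) (fun t => f (x₀ t)) (fun t => deriv f (x₀ t))
      (fun t => deriv (deriv f) (x₀ t) * deriv x₀ t) L := by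
  obtain ⟨L, hL1, hL⟩ := h.exists_bound hf
  obtain ⟨C, ν, T, K, hd⟩ := h.exists_decayAtTop hf hxe
  obtain ⟨C', ν', T', K', hd'⟩ := h.reverse.1.exists_decayAtTop hf hxe
  set R0 := √(deriv x₀ 0 ^ 2 + f (x₀ 0) ^ 2) with hR0
  have hR00 : 0 ≤ R0 := Real.sqrt_nonneg _
  have bound : ∀ t, √(deriv x₀ t ^ 2 + f (x₀ t) ^ 2) ≤
      ((C + C') * R0) * Real.exp (-(min ν ν') * |t|) := fun t => by
    have hC := hd.pos
    have hC' := hd'.pos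
    rcases le_total 0 t with ht | ht
    · refine (hd.decay 0 t le_rfl ht).trans ?_
      rw [sub_zero, abs_of_nonneg ht]
      calc C * Real.exp (-ν * t) * R0 ≤ (C + C') * Real.exp (-(min ν ν') * t) * R0 := by
            gcongr
            · linarith
            · exact min_le_left _ _
        _ = _ := by ring
    · have := hd'.decay 0 (-t) le_rfl (by linarith)
      simp only [h.reverse.2, neg_neg, neg_sq, neg_zero, sub_zero] at this
      refine this.trans ?_
      rw [abs_of_nonpos ht]
      calc C' * Real.exp (-ν' * -t) * R0 ≤ (C + C') * Real.exp (-(min ν ν') * -t) * R0 := by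
            gcongr
            · linarith
            · linarith
            · exact min_le_right _ _
        _ = _ := by ring
  have hν : 0 < min ν ν' := lt_min hd.rate hd'.rate
  refine ⟨L, h.1, h.2.1, h.hasDerivAt_W hf, fun t => ?_, ?_, hL1, fun t => (hL t).1,
    fun t => (hL t).2.1, fun t => (hL t).2.2.1, fun t => (hL t).2.2.2.1, ?_, ?_, h.2.2.2.1,
    h.2.2.2.2.2.1⟩
  · exact ((contDiff_deriv_two hf).differentiable (by norm_num) (x₀ t)).hasDerivAt.comp t (h.1 t)
  · exact ((contDiff_deriv_one hf).continuous.comp h.continuous).mul h.continuous_deriv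
  · refine integrable_of_abs_le_exp h.continuous_deriv hν fun t => le_trans ?_ (bound t)
    exact Real.abs_le_sqrt (by linarith [sq_nonneg (f (x₀ t))])
  · refine integrable_of_abs_le_exp (hf.continuous.comp h.continuous) hν
      fun t => le_trans ?_ (bound t)
    exact Real.abs_le_sqrt (by linarith [sq_nonneg (deriv x₀ t)])

theorem IsHomoclinic.exists_tail (h : IsHomoclinic f xe x₀) (hf : ContDiff ℝ 3 f)
    (hxe : IsHyperbolicEquilibrium f xe) :
    ∃ T K, 1 ≤ K ∧ ∀ t, T ≤ |t| → |deriv x₀ t| ≤ K * |f (x₀ t)| := by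
  obtain ⟨C, ν, T, K, hd⟩ := h.exists_decayAtTop hf hxe
  obtain ⟨C', ν', T', K', hd'⟩ := h.reverse.1.exists_decayAtTop hf hxe
  refine ⟨max T T', max 1 (max K K'), le_max_left _ _, fun t ht => ?_⟩
  rcases le_total 0 t with h0 | h0
  · rw [abs_of_nonneg h0] at ht
    refine (hd.tail t ((le_max_left _ _).trans ht)).trans ?_
    exact mul_le_mul_of_nonneg_right ((le_max_left _ _).trans (le_max_right _ _)) (abs_nonneg _)
  · rw [abs_of_nonpos h0] at ht
    have := hd'.tail (-t) ((le_max_right _ _).trans ht)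
    simp only [h.reverse.2, neg_neg, abs_neg] at this
    refine this.trans ?_
    exact mul_le_mul_of_nonneg_right ((le_max_right _ _).trans (le_max_right _ _)) (abs_nonneg _)

/-- The nondegeneracy of all phases with a common constant, and the bound for the number of
critical points. -/
theorem IsHomoclinic.exists_uniform_nondegeneracy (h : IsHomoclinic f xe x₀)
    (hf : ContDiff ℝ 3 f) (hxe : IsHyperbolicEquilibrium f xe) {ι : Type*} (s : Finset ι)
    (μ : ι → ℝ) (hμ : ∀ i ∈ s, μ i ≠ 0)
    (hnd : ∀ k : ℤ, k ≠ 0 → ∀ i ∈ s, ∀ t, k * deriv x₀ t + μ i = 0 → f (x₀ t) ≠ 0) :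
    ∃ c, 0 < c ∧ c ≤ 1 ∧ (∀ i ∈ s, ∀ k : ℤ, k ≠ 0 → ∀ t, |k * deriv x₀ t + μ i| ≤ c →
        c * |deriv x₀ t| ≤ |f (x₀ t)|) ∧
      ∃ N : ℕ, ∀ i ∈ s, ∀ k : ℤ, k ≠ 0 → {t | deriv x₀ t = -μ i / k}.Finite ∧
        {t | deriv x₀ t = -μ i / k}.ncard ≤ N := by
  obtain ⟨L, o⟩ := h.exists_decayingOrbit hf hxe
  obtain ⟨T, K, hK, htail⟩ := h.exists_tail hf hxe
  obtain ⟨c, hc, hc1, hP⟩ := exists_pos_forall_mem_finset s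
    (fun i c => ∀ k : ℤ, k ≠ 0 → ∀ t, |k * deriv x₀ t + μ i| ≤ c →
      c * |deriv x₀ t| ≤ |f (x₀ t)|)
    (fun i c c' _ hcc hP k hk t hle => (mul_le_mul_of_nonneg_right hcc (abs_nonneg _)).trans
      (hP k hk t (hle.trans hcc)))
    (fun i hi => exists_nondegeneracy h.continuous_deriv (hf.continuous.comp h.continuous) hK
      o.one_le o.bV htail (h.speed_pos hf) (μ i) fun k hk t => hnd k hk i hi t)
  refine ⟨c, hc, hc1, hP, ?_⟩
  obtain ⟨w, hw, hw1, hwL⟩ := DecayingOrbit.exists_window_width L o.one_le hc hc1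
  obtain ⟨N, hN⟩ := finite_level_of_separated h.2.1 hw (T := T) (fun t ht h0 => by
    have h1 := htail t ht
    rw [h0, abs_zero, mul_zero] at h1
    have h2 := h.speed_pos hf t
    rw [h0, abs_eq_zero.1 (le_antisymm h1 (abs_nonneg _))] at h2
    norm_num at h2)
  refine ⟨N, fun i hi k hk => hN _ fun t t' ht ht' hne => ?_⟩
  have hk' : (k : ℝ) ≠ 0 := Int.cast_ne_zero.2 hk
  refine o.separated hc hc1 hw1 (hwL.trans (by norm_num)) ?_ ?_ (ht.trans ht'.symm) hne
  · refine hP i hi k hk t ?_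
    rw [ht, mul_div_cancel₀ _ hk', neg_add_cancel, abs_zero]
    exact hc.le
  · rw [ht]
    exact div_ne_zero (neg_ne_zero.2 (hμ i hi)) hk'

end

/-! ### Bounded solutions of linear equations -/

/-- `E` plays the role of the tail integral of the bound `E'`. Both `M + E` and `M - E` are monotone
with limit `0`, so the comparison does not require writing `M` as an improper integral. -/
theorem abs_le_of_abs_deriv_le {M M' E E' : ℝ → ℝ} {t₀ : ℝ}
    (cM : ContinuousOn M (Ici t₀)) (cE : ContinuousOn E (Ici t₀))
    (hM : ∀ t > t₀, HasDerivAt M (M' t) t) (hE : ∀ t > t₀, HasDerivAt E (-E' t) t)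
    (hle : ∀ t > t₀, |M' t| ≤ E' t) (lM : Tendsto M atTop (𝓝 0)) (lE : Tendsto E atTop (𝓝 0)) :
    |M t₀| ≤ E t₀ := by
  have hint : interior (Ici t₀) = Ioi t₀ := interior_Ici
  have m1 : AntitoneOn (fun t => M t + E t) (Ici t₀) := by
    refine antitoneOn_of_deriv_nonpos (convex_Ici t₀) (cM.add cE) (fun t ht => ?_) fun t ht => ?_
    · rw [hint] at ht
      exact ((hM t ht).fun_add (hE t ht)).differentiableAt.differentiableWithinAt
    · rw [hint] at ht
      rw [((hM t ht).fun_add (hE t ht)).deriv]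
      linarith [(abs_le.1 (hle t ht)).2]
  have m2 : MonotoneOn (fun t => M t - E t) (Ici t₀) := by
    refine monotoneOn_of_deriv_nonneg (convex_Ici t₀) (cM.sub cE) (fun t ht => ?_) fun t ht => ?_
    · rw [hint] at ht
      exact ((hM t ht).fun_sub (hE t ht)).differentiableAt.differentiableWithinAt
    · rw [hint] at ht
      rw [((hM t ht).fun_sub (hE t ht)).deriv]
      linarith [(abs_le.1 (hle t ht)).1]
  have l1 : 0 ≤ M t₀ + E t₀ := by
    refine le_of_tendsto (x := atTop) (f := fun t => M t + E t) ?_ ?_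
    · simpa using lM.add lE
    · filter_upwards [eventually_ge_atTop t₀] with t ht
      exact m1 self_mem_Ici ht ht
  have l2 : M t₀ - E t₀ ≤ 0 := by
    refine ge_of_tendsto (x := atTop) (f := fun t => M t - E t) ?_ ?_
    · simpa using lM.sub lE
    · filter_upwards [eventually_ge_atTop t₀] with t ht
      exact m2 self_mem_Ici ht ht
  exact abs_le.2 ⟨by linarith, by linarith⟩

theorem abs_sub_le_of_abs_deriv_le {M M' E E' : ℝ → ℝ} {t₀ t₁ : ℝ} (h01 : t₀ ≤ t₁)
    (cM : ContinuousOn M (Icc t₀ t₁)) (cE : ContinuousOn E (Icc t₀ t₁))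
    (hM : ∀ t ∈ Ioo t₀ t₁, HasDerivAt M (M' t) t) (hE : ∀ t ∈ Ioo t₀ t₁, HasDerivAt E (E' t) t)
    (hle : ∀ t ∈ Ioo t₀ t₁, |M' t| ≤ E' t) : |M t₁ - M t₀| ≤ E t₁ - E t₀ := by
  have hint : interior (Icc t₀ t₁) = Ioo t₀ t₁ := interior_Icc
  have m1 : MonotoneOn (fun t => E t + M t) (Icc t₀ t₁) := by
    refine monotoneOn_of_deriv_nonneg (convex_Icc t₀ t₁) (cE.add cM) (fun t ht => ?_) fun t ht => ?_
    · rw [hint] at ht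
      exact ((hE t ht).fun_add (hM t ht)).differentiableAt.differentiableWithinAt
    · rw [hint] at ht
      rw [((hE t ht).fun_add (hM t ht)).deriv]
      linarith [(abs_le.1 (hle t ht)).1]
  have m2 : MonotoneOn (fun t => E t - M t) (Icc t₀ t₁) := by
    refine monotoneOn_of_deriv_nonneg (convex_Icc t₀ t₁) (cE.sub cM) (fun t ht => ?_) fun t ht => ?_
    · rw [hint] at ht
      exact ((hE t ht).fun_sub (hM t ht)).differentiableAt.differentiableWithinAt
    · rw [hint] at ht
      rw [((hE t ht).fun_sub (hM t ht)).deriv]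
      linarith [(abs_le.1 (hle t ht)).2]
  have h1 := m1 (left_mem_Icc.2 h01) (right_mem_Icc.2 h01) h01
  have h2 := m2 (left_mem_Icc.2 h01) (right_mem_Icc.2 h01) h01
  simp only at h1 h2
  exact abs_le.2 ⟨by linarith, by linarith⟩

theorem exists_primitive_tendsto_zero {k : ℝ → ℝ} (hk : Continuous k)
    (hi : IntegrableOn k (Ioi 0)) :
    ∃ M : ℝ → ℝ, (∀ t, HasDerivAt M (k t) t) ∧ Tendsto M atTop (𝓝 0) := by
  refine ⟨fun t => (∫ s in (0 : ℝ)..t, k s) - ∫ s in Ioi (0 : ℝ), k s, fun t => ?_, ?_⟩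
  · exact (intervalIntegral.integral_hasDerivAt_right (hk.intervalIntegrable _ _)
      hk.aestronglyMeasurable.stronglyMeasurableAtFilter hk.continuousAt).sub_const _
  · have := intervalIntegral_tendsto_integral_Ioi 0 hi tendsto_id
    simpa using this.sub_const (∫ s in Ioi (0 : ℝ), k s)

theorem tendsto_exp_neg_mul {l : ℝ} (hl : 0 < l) (A s : ℝ) :
    Tendsto (fun t => A * Real.exp (-l * (t - s))) atTop (𝓝 0) := by
  have h1 : Tendsto (fun t => -l * (t - s)) atTop atBot := by
    apply Tendsto.const_mul_atTop_of_neg (by linarith)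
    exact tendsto_atTop_add_const_right _ _ tendsto_id
  simpa using (Real.tendsto_exp_atBot.comp h1).const_mul A

theorem hasDerivAt_const_mul_exp (A l s t : ℝ) :
    HasDerivAt (fun t => A * Real.exp (l * (t - s))) (l * (A * Real.exp (l * (t - s)))) t := by
  convert! ((((hasDerivAt_id t).sub_const s).const_mul l).exp).const_mul A using 1
  simp only [id]; ring

/-! #### Scalar equation -/

/-- After multiplication by the decaying factor `exp(-l (s - t))` a bounded solution tends to `0` at
infinity, so its value at `t` is determined by the future of `h`. -/
theorem abs_le_of_unstable_scalar {l H : ℝ} (hl : 0 < l) {u h : ℝ → ℝ} {B : ℝ}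
    (hu : ∀ t, HasDerivAt u (l * u t + h t) t) (hB : ∀ t, |u t| ≤ B) (hh : ∀ t, |h t| ≤ H) (t : ℝ) :
    |u t| ≤ H / l := by
  have e1 : ∀ s, HasDerivAt (fun s => 1 * Real.exp (-l * (s - t)) * u s)
      (Real.exp (-l * (s - t)) * h s) s := fun s => by
    convert! (hasDerivAt_const_mul_exp 1 (-l) t s).fun_mul (hu s) using 1
    ring
  have e2 := fun s => hasDerivAt_const_mul_exp (H / l) (-l) t s
  have := abs_le_of_abs_deriv_le (t₀ := t) (E' := fun s => H * Real.exp (-l * (s - t)))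
    (fun s _ => (e1 s).continuousAt.continuousWithinAt)
    (fun s _ => (e2 s).continuousAt.continuousWithinAt) (fun s _ => e1 s)
    (fun s _ => by convert! e2 s using 1; field_simp)
    (fun s _ => by
      rw [abs_mul, abs_of_pos (Real.exp_pos _), mul_comm]
      exact mul_le_mul_of_nonneg_right (hh s) (Real.exp_pos _).le)
    (squeeze_zero_norm (fun s => by
      rw [one_mul, Real.norm_eq_abs, abs_mul, abs_of_pos (Real.exp_pos _), mul_comm]
      exact mul_le_mul_of_nonneg_right (hB s) (Real.exp_pos _).le) (tendsto_exp_neg_mul hl B t))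
    (tendsto_exp_neg_mul hl (H / l) t)
  simpa using this

theorem exists_unstable_scalar {l H : ℝ} (hl : 0 < l) {h : ℝ → ℝ} (ch : Continuous h)
    (hh : ∀ t, |h t| ≤ H) :
    ∃ u : ℝ → ℝ, (∀ t, HasDerivAt u (l * u t + h t) t) ∧ ∀ t, |u t| ≤ H / l := by
  have hi : IntegrableOn (fun s => Real.exp (-l * s) * h s) (Ioi 0) := by
    refine Integrable.mono' ((exp_neg_integrableOn_Ioi 0 hl).const_mul H)
      (by fun_prop : Continuous fun s => Real.exp (-l * s) * h s).aestronglyMeasurable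
      (Eventually.of_forall fun s => ?_)
    rw [Real.norm_eq_abs, abs_mul, abs_of_pos (Real.exp_pos _), mul_comm]
    exact mul_le_mul_of_nonneg_right (hh s) (Real.exp_pos _).le
  obtain ⟨M, hM, lM⟩ := exists_primitive_tendsto_zero (by fun_prop) hi
  refine ⟨fun t => Real.exp (l * t) * M t, fun t => ?_, fun t => ?_⟩
  · convert! (((hasDerivAt_id t).const_mul l).exp).fun_mul (hM t) using 1
    have : Real.exp (l * t) * Real.exp (-l * t) = 1 := by
      rw [← Real.exp_add]; simp
    simp only [id]
    linear_combination (-h t) * this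
  · have e2 := fun s => hasDerivAt_const_mul_exp (H / l) (-l) 0 s
    have := abs_le_of_abs_deriv_le (t₀ := t) (E' := fun s => H * Real.exp (-l * (s - 0)))
      (fun s _ => (hM s).continuousAt.continuousWithinAt)
      (fun s _ => (e2 s).continuousAt.continuousWithinAt) (fun s _ => hM s)
      (fun s _ => by convert! e2 s using 1; field_simp)
      (fun s _ => by
        rw [abs_mul, abs_of_pos (Real.exp_pos _), mul_comm, sub_zero]
        exact mul_le_mul_of_nonneg_right (hh s) (Real.exp_pos _).le)
      lM (tendsto_exp_neg_mul hl (H / l) 0)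
    rw [abs_mul, abs_of_pos (Real.exp_pos _)]
    calc Real.exp (l * t) * |M t| ≤ Real.exp (l * t) * (H / l * Real.exp (-l * (t - 0))) := by
          gcongr
      _ = H / l * (Real.exp (l * t) * Real.exp (-l * (t - 0))) := by ring
      _ = H / l := by rw [← Real.exp_add]; simp

/-! #### Constant coefficients on the line -/

/-- `d` is a bounded solution of `d₁' = d₂`, `d₂' = l² d₁ + h` on the line. -/
structure LineSolution (l : ℝ) (h : ℝ → ℝ) (d : ℝ → ℝ × ℝ) : Prop where
  bdd : ∃ B, ∀ t, ‖d t‖ ≤ B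
  fst : ∀ t, HasDerivAt (fun s => (d s).1) (d t).2 t
  snd : ∀ t, HasDerivAt (fun s => (d s).2) (l ^ 2 * (d t).1 + h t) t

theorem LineSolution.sub {l : ℝ} {h h' : ℝ → ℝ} {d d' : ℝ → ℝ × ℝ} (s : LineSolution l h d)
    (s' : LineSolution l h' d') : LineSolution l (fun t => h t - h' t) (fun t => d t - d' t) := by
  obtain ⟨B, hB⟩ := s.bdd
  obtain ⟨B', hB'⟩ := s'.bdd
  refine ⟨⟨B + B', fun t => (norm_sub_le _ _).trans (add_le_add (hB t) (hB' t))⟩,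
    fun t => (s.fst t).fun_sub (s'.fst t), fun t => ?_⟩
  convert! (s.snd t).fun_sub (s'.snd t) using 1
  simp only [Prod.fst_sub]; ring

theorem LineSolution.continuous {l : ℝ} {h : ℝ → ℝ} {d : ℝ → ℝ × ℝ} (s : LineSolution l h d) :
    Continuous d :=
  (continuous_iff_continuousAt.2 fun t => (s.fst t).continuousAt).prodMk
    (continuous_iff_continuousAt.2 fun t => (s.snd t).continuousAt)

/-- The combination `d₂ + l d₁` solves an unstable scalar equation, and `d₂ - l d₁` solves one after
time reversal. Both are therefore bounded by `H / l`. -/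
theorem LineSolution.norm_le {l H : ℝ} (hl : 0 < l) {h : ℝ → ℝ} {d : ℝ → ℝ × ℝ}
    (s : LineSolution l h d) (hh : ∀ t, |h t| ≤ H) (t : ℝ) : ‖d t‖ ≤ (1 / l + 1 / l ^ 2) * H := by
  obtain ⟨B, hB⟩ := s.bdd
  have hb1 : ∀ t, |(d t).1| ≤ B := fun t => (norm_fst_le (d t)).trans (hB t)
  have hb2 : ∀ t, |(d t).2| ≤ B := fun t => (norm_snd_le (d t)).trans (hB t)
  have hb3 : ∀ t, |l * (d t).1| ≤ l * B := fun t => by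
    rw [abs_mul, abs_of_pos hl]; exact mul_le_mul_of_nonneg_left (hb1 t) hl.le
  have hu := abs_le_of_unstable_scalar (u := fun t => (d t).2 + l * (d t).1) (B := B + l * B) hl
    (fun t => by
      convert! (s.snd t).fun_add ((s.fst t).const_mul l) using 1
      ring_nf) (fun t => (abs_add_le _ _).trans (add_le_add (hb2 t) (hb3 t))) hh t
  have hw := abs_le_of_unstable_scalar (u := fun t => (d (-t)).2 - l * (d (-t)).1)
    (h := fun t => -h (-t)) (B := B + l * B) hl
    (fun t => by
      have := hasDerivAt_comp_neg ((s.snd (-t)).fun_sub ((s.fst (-t)).const_mul l))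
      convert! this using 1
      ring_nf) (fun t => (abs_sub _ _).trans (add_le_add (hb2 _) (hb3 _)))
    (fun t => by rw [abs_neg]; exact hh _) (-t)
  rw [neg_neg] at hw
  have hH : 0 ≤ H := (abs_nonneg _).trans (hh 0)
  rw [abs_le] at hu hw
  have e1 : 0 ≤ H / l := by positivity
  have e2 : 0 ≤ H / l ^ 2 := by positivity
  have e3 : (1 / l + 1 / l ^ 2) * H = H / l + H / l ^ 2 := by ring
  have e4 : l * (H / l ^ 2) = H / l := by field_simp
  have q2 : |(d t).2| ≤ H / l := abs_le.2 ⟨by linarith, by linarith⟩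
  have q1 : |(d t).1| ≤ H / l ^ 2 := by
    have : |l * (d t).1| ≤ H / l := abs_le.2 ⟨by linarith, by linarith⟩
    rw [abs_mul, abs_of_pos hl, ← e4] at this
    exact le_of_mul_le_mul_left this hl
  rw [e3]
  exact max_le (by rw [Real.norm_eq_abs]; linarith) (by rw [Real.norm_eq_abs]; linarith)

theorem exists_lineSolution {l H : ℝ} (hl : 0 < l) {h : ℝ → ℝ} (ch : Continuous h)
    (hh : ∀ t, |h t| ≤ H) : ∃ d, LineSolution l h d := by
  obtain ⟨u, hu, bu⟩ := exists_unstable_scalar hl ch hh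
  obtain ⟨w, hw, bw⟩ := exists_unstable_scalar (h := fun t => -h (-t)) (H := H) hl (by fun_prop)
    (fun t => by rw [abs_neg]; exact hh _)
  have hw' : ∀ t, HasDerivAt (fun t => w (-t)) (-(l * w (-t)) + h t) t := fun t => by
    convert! hasDerivAt_comp_neg (hw (-t)) using 1
    simp only [neg_neg]; ring
  refine ⟨fun t => ((u t - w (-t)) / (2 * l), (u t + w (-t)) / 2),
    ⟨(H / l + H / l) / (2 * l) + (H / l + H / l) / 2, fun t => ?_⟩, fun t => ?_, fun t => ?_⟩
  · have hH : 0 ≤ H := (abs_nonneg _).trans (hh 0)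
    have p1 : 0 ≤ (H / l + H / l) / (2 * l) := by positivity
    have p2 : 0 ≤ (H / l + H / l) / 2 := by positivity
    refine max_le ?_ ?_
    · simp only [Real.norm_eq_abs]
      rw [abs_div, abs_of_pos (by positivity : 0 < 2 * l)]
      have := div_le_div_of_nonneg_right ((abs_sub (u t) (w (-t))).trans
        (add_le_add (bu t) (bw (-t)))) (by positivity : 0 ≤ 2 * l)
      linarith
    · simp only [Real.norm_eq_abs]
      rw [abs_div, abs_of_pos (by norm_num : (0 : ℝ) < 2)]
      have := div_le_div_of_nonneg_right ((abs_add_le (u t) (w (-t))).trans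
        (add_le_add (bu t) (bw (-t)))) (by norm_num : (0 : ℝ) ≤ 2)
      linarith
  · convert! ((hu t).fun_sub (hw' t)).div_const (2 * l) using 1
    field_simp; ring
  · convert! ((hu t).fun_add (hw' t)).div_const 2 using 1
    field_simp; ring

/-! #### Linearization along an orbit, on the half-line -/

/-- `d` is a bounded solution of `d₁' = d₂`, `d₂' = a d₁ + h` on `[0, ∞)`, extended by a constant,
whose initial value is orthogonal to `(V 0, W 0)`. -/
structure HalfLineSolution (V W a h : ℝ → ℝ) (d : ℝ → ℝ × ℝ) : Prop where
  cont : Continuous d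
  const : ∀ t, t ≤ 0 → d t = d 0
  bdd : ∃ B, ∀ t, ‖d t‖ ≤ B
  bdry : V 0 * (d 0).1 + W 0 * (d 0).2 = 0
  fst : ∀ t, 0 < t → HasDerivAt (fun s => (d s).1) (d t).2 t
  snd : ∀ t, 0 < t → HasDerivAt (fun s => (d s).2) (a t * (d t).1 + h t) t

theorem HalfLineSolution.sub {V W a h h' : ℝ → ℝ} {d d' : ℝ → ℝ × ℝ}
    (s : HalfLineSolution V W a h d) (s' : HalfLineSolution V W a h' d') :
    HalfLineSolution V W a (fun t => h t - h' t) (fun t => d t - d' t) := by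
  obtain ⟨B, hB⟩ := s.bdd
  obtain ⟨B', hB'⟩ := s'.bdd
  refine ⟨s.cont.sub s'.cont, fun t ht => by rw [s.const t ht, s'.const t ht],
    ⟨B + B', fun t => (norm_sub_le _ _).trans (add_le_add (hB t) (hB' t))⟩, ?_,
    fun t ht => (s.fst t ht).fun_sub (s'.fst t ht), fun t ht => ?_⟩
  · simp only [Prod.fst_sub, Prod.snd_sub]
    linear_combination s.bdry - s'.bdry
  · convert! (s.snd t ht).fun_sub (s'.snd t ht) using 1
    simp only [Prod.fst_sub]; ring

/-- An orbit of `x'' = f(x)` that decays exponentially at `+∞`: the velocity `V`, the acceleration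
`W`, and the coefficient `a` of the linearized equation. -/
structure StableOrbit (V W a : ℝ → ℝ) (L C ν T K : ℝ) : Prop where
  hV : ∀ t, HasDerivAt V (W t) t
  hW : ∀ t, HasDerivAt W (a t * V t) t
  ca : Continuous a
  ba : ∀ t, |a t| ≤ L
  speed : ∀ t, 0 < V t ^ 2 + W t ^ 2
  dec : DecayAtTop V W C ν T K

namespace StableOrbit

variable {V W a h : ℝ → ℝ} {L C ν T K H : ℝ}

theorem cV (o : StableOrbit V W a L C ν T K) : Continuous V :=
  continuous_iff_continuousAt.2 fun t => (o.hV t).continuousAt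

theorem cW (o : StableOrbit V W a L C ν T K) : Continuous W :=
  continuous_iff_continuousAt.2 fun t => (o.hW t).continuousAt

theorem abs_V_le (V W : ℝ → ℝ) (t : ℝ) : |V t| ≤ √(V t ^ 2 + W t ^ 2) :=
  Real.abs_le_sqrt (by linarith [sq_nonneg (W t)])

theorem abs_W_le (V W : ℝ → ℝ) (t : ℝ) : |W t| ≤ √(V t ^ 2 + W t ^ 2) :=
  Real.abs_le_sqrt (by linarith [sq_nonneg (V t)])

theorem abs_speed_le (o : StableOrbit V W a L C ν T K) {t : ℝ} (ht : 0 ≤ t) :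
    √(V t ^ 2 + W t ^ 2) ≤ C * √(V 0 ^ 2 + W 0 ^ 2) * Real.exp (-ν * (t - 0)) := by
  refine (o.dec.decay 0 t le_rfl ht).trans_eq (by ring)

theorem integrableOn_V_mul (o : StableOrbit V W a L C ν T K) {h : ℝ → ℝ} (ch : Continuous h)
    (hh : ∀ t, 0 ≤ t → |h t| ≤ H) : IntegrableOn (fun t => V t * h t) (Ioi 0) := by
  refine Integrable.mono'
    (g := fun t => H * (C * √(V 0 ^ 2 + W 0 ^ 2)) * Real.exp (-ν * t))
    ((exp_neg_integrableOn_Ioi 0 o.dec.rate).const_mul _)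
    (o.cV.mul ch).aestronglyMeasurable ?_
  filter_upwards [ae_restrict_mem measurableSet_Ioi] with t ht
  have ht0 := (mem_Ioi.1 ht).le
  rw [Real.norm_eq_abs, abs_mul]
  have h1 := (abs_V_le V W t).trans (o.abs_speed_le ht0)
  rw [sub_zero] at h1
  calc |V t| * |h t| ≤ (C * √(V 0 ^ 2 + W 0 ^ 2) * Real.exp (-ν * t)) * H :=
        mul_le_mul h1 (hh t ht0) (abs_nonneg _) ((abs_nonneg _).trans h1)
    _ = _ := by ring

/-- The constant in the a-priori estimate for the linearized equation. -/
def gain (L C ν : ℝ) : ℝ := C * (1 + (1 + L) * (C / ν)) / ν + C / ν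

/-- In the frame moving with the orbit a solution of the linearized equation is `α (V, W) + M (-W,
V) / ρ²` with `ρ² = V² + W²`. The wedge `M` obeys `M' = V h`, without `α`, and vanishes at infinity,
so it is at most the integral of `|V| H` over the future, hence `O(Hρ)`. Then `α'` is `O(H/ρ)`; as
`1/ρ` grows at least exponentially, `α ρ` remains bounded. -/
theorem abs_le_of_polar (o : StableOrbit V W a L C ν T K) {M α : ℝ → ℝ}
    (cM : ContinuousOn M (Ici 0)) (cα : ContinuousOn α (Ici 0))
    (hM : ∀ t > 0, HasDerivAt M (V t * h t) t) (lM : Tendsto M atTop (𝓝 0))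
    (hα : ∀ t > 0, HasDerivAt α ((W t * h t + M t * (1 + a t) * (V t ^ 2 - W t ^ 2) /
      (V t ^ 2 + W t ^ 2)) / (V t ^ 2 + W t ^ 2)) t) (hα0 : α 0 = 0) (hH : 0 ≤ H)
    (hh : ∀ t > 0, |h t| ≤ H) {t : ℝ} (ht : 0 ≤ t) :
    |M t| ≤ C / ν * H * √(V t ^ 2 + W t ^ 2) ∧
    |α t| * √(V t ^ 2 + W t ^ 2) ≤ C * (1 + (1 + L) * (C / ν)) / ν * H := by
  set ρ : ℝ → ℝ := fun t => √(V t ^ 2 + W t ^ 2) with hρ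
  have hρ0 : ∀ t, 0 < ρ t := fun t => Real.sqrt_pos.2 (o.speed t)
  have hρ2 : ∀ t, V t ^ 2 + W t ^ 2 = ρ t ^ 2 := fun t => (Real.sq_sqrt (o.speed t).le).symm
  have hC := o.dec.pos
  have hν := o.dec.rate
  have hL : 0 ≤ L := (abs_nonneg _).trans (o.ba 0)
  have decay : ∀ s t, 0 ≤ s → s ≤ t → ρ t ≤ C * Real.exp (-ν * (t - s)) * ρ s := o.dec.decay
  have bM : ∀ t, 0 ≤ t → |M t| ≤ C / ν * H * ρ t := fun t ht => by
    have e := fun s => hasDerivAt_const_mul_exp (C / ν * H * ρ t) (-ν) t s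
    have := abs_le_of_abs_deriv_le (t₀ := t)
      (E' := fun s => H * (C * Real.exp (-ν * (s - t)) * ρ t))
      (cM.mono (Ici_subset_Ici.2 ht)) (fun s _ => (e s).continuousAt.continuousWithinAt)
      (fun s hs => hM s (lt_of_le_of_lt ht hs))
      (fun s _ => by convert! e s using 1; field_simp) (fun s hs => by
        have hs' : t < s := hs
        rw [abs_mul, mul_comm]
        exact mul_le_mul (hh s (lt_of_le_of_lt ht hs)) ((abs_V_le V W s).trans
          (decay t s ht hs'.le)) (abs_nonneg _) hH) lM (tendsto_exp_neg_mul hν _ t)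
    simpa using this
  refine ⟨bM t ht, ?_⟩
  set A := 1 + (1 + L) * (C / ν) with hA
  have hA0 : 0 ≤ A := by positivity
  have e := fun s => hasDerivAt_const_mul_exp (H * A * C / (ν * ρ t)) ν t s
  have hρt := (hρ0 t).ne'
  have key := abs_sub_le_of_abs_deriv_le ht
    (E' := fun s => H * A * (C / ρ t * Real.exp (ν * (s - t))))
    (cα.mono Icc_subset_Ici_self) (fun s _ => (e s).continuousAt.continuousWithinAt)
    (fun s hs => hα s hs.1) (fun s _ => by convert! e s using 1; field_simp) (fun s hs => by
      have hρs := hρ0 s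
      have h1 : |W s * h s| ≤ H * ρ s := by
        rw [abs_mul, mul_comm]
        exact mul_le_mul (hh s hs.1) (abs_W_le V W s) (abs_nonneg _) hH
      have h2 : |M s * (1 + a s) * (V s ^ 2 - W s ^ 2) / (V s ^ 2 + W s ^ 2)| ≤
          C / ν * H * ρ s * (1 + L) := by
        rw [mul_div_assoc, abs_mul, abs_mul, abs_div, abs_of_pos (o.speed s)]
        have h3 : |1 + a s| ≤ 1 + L := (abs_add_le _ _).trans (by rw [abs_one]; linarith [o.ba s])
        have h4 : |V s ^ 2 - W s ^ 2| / (V s ^ 2 + W s ^ 2) ≤ 1 := by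
          rw [div_le_one (o.speed s)]
          exact abs_le.2 ⟨by linarith [sq_nonneg (V s)], by linarith [sq_nonneg (W s)]⟩
        calc _ ≤ (C / ν * H * ρ s) * (1 + L) * 1 :=
              mul_le_mul (mul_le_mul (bM s hs.1.le) h3 (abs_nonneg _) (by positivity)) h4
                (by have := o.speed s; positivity) (by positivity)
          _ = _ := by ring
      have h5 : 1 / ρ s ≤ C / ρ t * Real.exp (ν * (s - t)) := by
        have := decay s t hs.1.le hs.2.le
        rw [div_le_iff₀ hρs, div_mul_eq_mul_div, div_mul_eq_mul_div, le_div_iff₀ (hρ0 t), one_mul]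
        refine this.trans_eq ?_
        rw [show -ν * (t - s) = ν * (s - t) by ring]
      rw [abs_div, abs_of_pos (o.speed s), hρ2 s]
      rw [hρ2 s] at h2
      calc |W s * h s + M s * (1 + a s) * (V s ^ 2 - W s ^ 2) / ρ s ^ 2| / ρ s ^ 2
          ≤ (H * ρ s + C / ν * H * ρ s * (1 + L)) / ρ s ^ 2 :=
            div_le_div_of_nonneg_right ((abs_add_le _ _).trans (add_le_add h1 h2)) (by positivity)
        _ = H * A * (1 / ρ s) := by rw [hA]; field_simp
        _ ≤ _ := mul_le_mul_of_nonneg_left h5 (by positivity))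
  rw [hα0, sub_zero, sub_self, mul_zero, Real.exp_zero, mul_one] at key
  have hpos : 0 ≤ H * A * C / (ν * ρ t) * Real.exp (ν * (0 - t)) := by
    have := hρ0 t; positivity
  calc |α t| * ρ t ≤ H * A * C / (ν * ρ t) * ρ t :=
        mul_le_mul_of_nonneg_right (by linarith) (hρ0 t).le
    _ = _ := by field_simp

theorem abs_polar_le (o : StableOrbit V W a L C ν T K) {M α t : ℝ} (hH : 0 ≤ H)
    (h1 : |M| ≤ C / ν * H * √(V t ^ 2 + W t ^ 2))
    (h2 : |α| * √(V t ^ 2 + W t ^ 2) ≤ C * (1 + (1 + L) * (C / ν)) / ν * H) {v w : ℝ}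
    (hv : |v| ≤ √(V t ^ 2 + W t ^ 2)) (hw : |w| ≤ √(V t ^ 2 + W t ^ 2)) :
    |α * v + M * w / (V t ^ 2 + W t ^ 2)| ≤ gain L C ν * H := by
  set ρ := √(V t ^ 2 + W t ^ 2) with hρ
  have hρ0 : 0 < ρ := Real.sqrt_pos.2 (o.speed t)
  have hρ2 : V t ^ 2 + W t ^ 2 = ρ ^ 2 := (Real.sq_sqrt (o.speed t).le).symm
  have hC := o.dec.pos
  have hν := o.dec.rate
  refine (abs_add_le _ _).trans ?_
  rw [abs_div, abs_mul, abs_mul, abs_of_pos (o.speed t), hρ2]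
  have e1 : |α| * |v| ≤ |α| * ρ := mul_le_mul_of_nonneg_left hv (abs_nonneg _)
  have e2 : |M| * |w| / ρ ^ 2 ≤ (C / ν * H * ρ) * ρ / ρ ^ 2 :=
    div_le_div_of_nonneg_right (mul_le_mul h1 hw (abs_nonneg _) (by positivity)) (by positivity)
  have e3 : (C / ν * H * ρ) * ρ / ρ ^ 2 = C / ν * H := by field_simp
  rw [gain, add_mul]
  linarith

end StableOrbit

section

variable {V W a h : ℝ → ℝ} {L C ν T K H : ℝ} {d : ℝ → ℝ × ℝ}

/-- The wedge product of the velocity with a solution of the linearized equation. -/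
theorem HalfLineSolution.hasDerivAt_wedge (o : StableOrbit V W a L C ν T K)
    (s : HalfLineSolution V W a h d) (t : ℝ) (ht : 0 < t) :
    HasDerivAt (fun t => V t * (d t).2 - W t * (d t).1) (V t * h t) t := by
  convert! ((o.hV t).fun_mul (s.snd t ht)).fun_sub ((o.hW t).fun_mul (s.fst t ht)) using 1
  ring

theorem HalfLineSolution.tendsto_wedge (o : StableOrbit V W a L C ν T K)
    (s : HalfLineSolution V W a h d) :
    Tendsto (fun t => V t * (d t).2 - W t * (d t).1) atTop (𝓝 0) := by
  obtain ⟨B, hB⟩ := s.bdd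
  have hB0 : 0 ≤ B := (norm_nonneg _).trans (hB 0)
  refine squeeze_zero_norm' ?_ (tendsto_exp_neg_mul o.dec.rate
    (2 * B * (C * √(V 0 ^ 2 + W 0 ^ 2))) 0)
  filter_upwards [eventually_ge_atTop 0] with t ht
  have h1 := o.abs_speed_le ht
  have hV := (StableOrbit.abs_V_le V W t).trans h1
  have hW := (StableOrbit.abs_W_le V W t).trans h1
  rw [Real.norm_eq_abs]
  refine (abs_sub _ _).trans ?_
  rw [abs_mul, abs_mul]
  have e1 := mul_le_mul hV ((norm_snd_le (d t)).trans (hB t)) (norm_nonneg _)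
    ((abs_nonneg _).trans hV)
  have e2 := mul_le_mul hW ((norm_fst_le (d t)).trans (hB t)) (norm_nonneg _)
    ((abs_nonneg _).trans hV)
  simp only [Real.norm_eq_abs] at e1 e2
  linarith

theorem HalfLineSolution.norm_le (o : StableOrbit V W a L C ν T K)
    (s : HalfLineSolution V W a h d) (hH : 0 ≤ H) (hh : ∀ t > 0, |h t| ≤ H) (t : ℝ) :
    ‖d t‖ ≤ StableOrbit.gain L C ν * H := by
  wlog ht : 0 ≤ t generalizing t
  · rw [s.const t (not_le.1 ht).le]; exact this 0 le_rfl
  set M : ℝ → ℝ := fun t => V t * (d t).2 - W t * (d t).1 with hM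
  set α : ℝ → ℝ := fun t => (V t * (d t).1 + W t * (d t).2) / (V t ^ 2 + W t ^ 2) with hα
  have c1 : Continuous fun t => (d t).1 := continuous_fst.comp s.cont
  have c2 : Continuous fun t => (d t).2 := continuous_snd.comp s.cont
  have cV := o.cV
  have cW := o.cW
  have cM : Continuous M := by fun_prop
  have cα : Continuous α := Continuous.div (by fun_prop) (by fun_prop) fun t => (o.speed t).ne'
  have hα' : ∀ t > 0, HasDerivAt α ((W t * h t + M t * (1 + a t) * (V t ^ 2 - W t ^ 2) /
      (V t ^ 2 + W t ^ 2)) / (V t ^ 2 + W t ^ 2)) t := fun t ht => by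
    convert! (((o.hV t).fun_mul (s.fst t ht)).fun_add ((o.hW t).fun_mul (s.snd t ht))).fun_div
      (((o.hV t).fun_pow 2).fun_add ((o.hW t).fun_pow 2)) (o.speed t).ne' using 1
    have := (o.speed t).ne'
    simp only [hM]
    field_simp
    push_cast
    ring
  obtain ⟨b1, b2⟩ := o.abs_le_of_polar cM.continuousOn cα.continuousOn
    (fun t ht => s.hasDerivAt_wedge o t ht) (s.tendsto_wedge o) hα'
    (by simp only [hα]; rw [s.bdry, zero_div]) hH hh ht
  have hR := (o.speed t).ne'
  have e1 : (d t).1 = α t * V t + M t * (-W t) / (V t ^ 2 + W t ^ 2) := by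
    simp only [hα, hM]; field_simp; ring
  have e2 : (d t).2 = α t * W t + M t * V t / (V t ^ 2 + W t ^ 2) := by
    simp only [hα, hM]; field_simp; ring
  have vV := StableOrbit.abs_V_le V W t
  have vW := StableOrbit.abs_W_le V W t
  refine max_le ?_ ?_
  · rw [Real.norm_eq_abs, e1]
    exact o.abs_polar_le hH b1 b2 vV (by rwa [abs_neg])
  · rw [Real.norm_eq_abs, e2]
    exact o.abs_polar_le hH b1 b2 vW vV

/-- Variation of constants in the moving frame. The two free constants are fixed by the requirements
on the solution: `M → 0` at infinity for boundedness, and `α(0) = 0` for orthogonality to the orbit.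
-/
theorem StableOrbit.exists_halfLineSolution (o : StableOrbit V W a L C ν T K)
    (ch : Continuous h) (hh : ∀ t, |h t| ≤ H) : ∃ d, HalfLineSolution V W a h d := by
  have hH : 0 ≤ H := (abs_nonneg _).trans (hh 0)
  have cV := o.cV
  have cW := o.cW
  have ca := o.ca
  have cR : Continuous fun t => V t ^ 2 + W t ^ 2 := by fun_prop
  obtain ⟨M, hM, lM⟩ := exists_primitive_tendsto_zero
    (k := fun t => V t * h t) (cV.mul ch)
    (o.integrableOn_V_mul ch fun t _ => hh t)
  have cM : Continuous M := continuous_iff_continuousAt.2 fun t => (hM t).continuousAt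
  set g : ℝ → ℝ := fun t => (W t * h t + M t * (1 + a t) * (V t ^ 2 - W t ^ 2) /
      (V t ^ 2 + W t ^ 2)) / (V t ^ 2 + W t ^ 2) with hg
  have cg : Continuous g :=
    ((cW.mul ch).add (Continuous.div (by fun_prop) cR fun t => (o.speed t).ne')).div cR
      fun t => (o.speed t).ne'
  set α : ℝ → ℝ := fun t => ∫ s in (0 : ℝ)..t, g s with hα
  have hα' : ∀ t, HasDerivAt α (g t) t := fun t =>
    intervalIntegral.integral_hasDerivAt_right (cg.intervalIntegrable _ _)
      cg.aestronglyMeasurable.stronglyMeasurableAtFilter cg.continuousAt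
  have cα : Continuous α := continuous_iff_continuousAt.2 fun t => (hα' t).continuousAt
  set e : ℝ → ℝ × ℝ := fun t => (α t * V t + M t * (-W t) / (V t ^ 2 + W t ^ 2),
    α t * W t + M t * V t / (V t ^ 2 + W t ^ 2)) with he
  have ce : Continuous e :=
    ((cα.mul cV).add ((cM.mul cW.neg).div cR fun t => (o.speed t).ne')).prodMk
      ((cα.mul cW).add ((cM.mul cV).div cR fun t => (o.speed t).ne'))
  have e1 : ∀ t, HasDerivAt (fun t => (e t).1) (e t).2 t := fun t => by
    have := (o.speed t).ne'
    convert! ((hα' t).fun_mul (o.hV t)).fun_add (((hM t).fun_mul (o.hW t).fun_neg).fun_div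
      (((o.hV t).fun_pow 2).fun_add ((o.hW t).fun_pow 2)) this) using 1
    simp only [he, hg]
    field_simp
    push_cast
    ring
  have e2 : ∀ t, HasDerivAt (fun t => (e t).2) (a t * (e t).1 + h t) t := fun t => by
    have := (o.speed t).ne'
    convert! ((hα' t).fun_mul (o.hW t)).fun_add (((hM t).fun_mul (o.hV t)).fun_div
      (((o.hV t).fun_pow 2).fun_add ((o.hW t).fun_pow 2)) this) using 1
    simp only [he, hg]
    field_simp
    push_cast
    ring
  have eq : ∀ t, 0 < t → (fun s => e (max s 0)) =ᶠ[𝓝 t] e := fun t ht => by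
    filter_upwards [Ioi_mem_nhds ht] with s hs
    rw [max_eq_left (mem_Ioi.1 hs).le]
  have b : ∀ t, 0 ≤ t → ‖e t‖ ≤ StableOrbit.gain L C ν * H := fun t ht => by
    obtain ⟨b1, b2⟩ := o.abs_le_of_polar cM.continuousOn cα.continuousOn
      (fun t _ => hM t) lM (fun t _ => hα' t) (by simp [hα]) hH (fun t _ => hh t) ht
    have vV := StableOrbit.abs_V_le V W t
    have vW := StableOrbit.abs_W_le V W t
    exact max_le (o.abs_polar_le hH b1 b2 vV (by rwa [abs_neg])) (o.abs_polar_le hH b1 b2 vW vV)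
  refine ⟨fun t => e (max t 0), by fun_prop, fun t ht => by rw [max_eq_right ht, max_self],
    ⟨_, fun t => b _ (le_max_right _ _)⟩, ?_, fun t ht => ?_, fun t ht => ?_⟩
  · have := (o.speed 0).ne'
    simp only [he, max_self]
    rw [show α 0 = 0 by simp [hα]]
    field_simp
    ring
  · simp only [max_eq_left ht.le]
    exact (e1 t).congr_of_eventuallyEq ((eq t ht).fun_comp Prod.fst)
  · simp only [max_eq_left ht.le]
    exact (e2 t).congr_of_eventuallyEq ((eq t ht).fun_comp Prod.snd)

end

section

open scoped BoundedContinuousFunction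

/-! ### Nonlinear perturbations of a linear solution operator -/

/-- Iteration gives `g ≤ max B 0 / 2^n` for every `n`. It replaces a discussion of suprema, both for
uniqueness and for sharpening an a-priori bound. -/
theorem le_zero_of_halving {g : ℝ → ℝ} {B : ℝ} (hB : ∀ t, g t ≤ B)
    (h : ∀ A, 0 ≤ A → (∀ t, g t ≤ A) → ∀ t, g t ≤ A / 2) (t : ℝ) : g t ≤ 0 := by
  have key : ∀ n : ℕ, ∀ t, g t ≤ max B 0 * (1 / 2) ^ n := fun n => by
    induction n with
    | zero => intro t; simpa using Or.inl (hB t)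
    | succ n ih =>
      intro t
      refine (h _ (by positivity) ih t).trans_eq ?_
      rw [pow_succ]; ring
  have lim : Tendsto (fun n : ℕ => max B 0 * (1 / 2 : ℝ) ^ n) atTop (𝓝 0) := by
    simpa using (tendsto_pow_atTop_nhds_zero_of_lt_one (by norm_num : (0 : ℝ) ≤ 1 / 2)
      (by norm_num)).const_mul (max B 0)
  exact ge_of_tendsto' lim fun n => key n t

/-- The linear problem enters only through an abstract relation with a gain `Γ`, so that the same
argument serves the bounded trajectory on the line and the invariant manifolds on the half-line. The
solution map is a contraction of the `δ`-ball of bounded continuous functions because `Γℓ ≤ 1/2`.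
The bound `2Γη`, finer than `δ`, is what makes the later Melnikov error quadratic. -/
theorem exists_unique_solution_of_contraction {Sol : (ℝ → ℝ) → (ℝ → ℝ × ℝ) → Prop}
    {N : ℝ → ℝ × ℝ → ℝ} {Γ δ η ℓ : ℝ}
    (ex : ∀ h H, Continuous h → (∀ t, |h t| ≤ H) → ∃ d, Sol h d)
    (cont : ∀ h d, Sol h d → Continuous d)
    (bd : ∀ h h' d d' H, 0 ≤ H → Sol h d → Sol h' d' → (∀ t, |h t - h' t| ≤ H) →
      ∀ t, ‖d t - d' t‖ ≤ Γ * H)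
    (zero : Sol (fun _ => 0) (fun _ => 0))
    (cN : Continuous fun p : ℝ × (ℝ × ℝ) => N p.1 p.2)
    (lip : ∀ t d d', ‖d‖ ≤ δ → ‖d'‖ ≤ δ → |N t d - N t d'| ≤ ℓ * ‖d - d'‖)
    (h0 : ∀ t, |N t 0| ≤ η) (hΓ : 0 ≤ Γ) (hδ : 0 < δ) (hη : 0 ≤ η) (hℓ : 0 ≤ ℓ)
    (hΓℓ : Γ * ℓ ≤ 1 / 2) (hΓη : Γ * η ≤ δ / 2) :
    ∃ d, Sol (fun t => N t (d t)) d ∧ (∀ t, ‖d t‖ ≤ 2 * (Γ * η)) ∧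
      ∀ d', Sol (fun t => N t (d' t)) d' → (∀ t, ‖d' t‖ ≤ δ) → d' = d := by
  have size : ∀ t d A, ‖d‖ ≤ δ → ‖d‖ ≤ A → |N t d| ≤ η + ℓ * A := fun t d A hd hA => by
    have h1 := lip t d 0 hd (by simpa using hδ.le)
    rw [sub_zero] at h1
    calc |N t d| = |N t 0 + (N t d - N t 0)| := by rw [add_sub_cancel]
      _ ≤ |N t 0| + |N t d - N t 0| := abs_add_le _ _
      _ ≤ η + ℓ * A := add_le_add (h0 t) (h1.trans (mul_le_mul_of_nonneg_left hA hℓ))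
  have contN : ∀ d : ℝ → ℝ × ℝ, Continuous d → Continuous fun t => N t (d t) := fun d hd =>
    cN.comp (continuous_id.prodMk hd)
  have small : ∀ h d H, 0 ≤ H → Sol h d → (∀ t, |h t| ≤ H) → ∀ t, ‖d t‖ ≤ Γ * H :=
    fun h d H hH hs hh t => by
      simpa using bd h _ d _ H hH hs zero (by simpa using hh) t
  set S := Metric.closedBall (0 : ℝ →ᵇ ℝ × ℝ) δ with hS
  have memS : ∀ d : S, ∀ t, ‖d.1 t‖ ≤ δ := fun d t =>
    (d.1.norm_coe_le_norm t).trans (mem_closedBall_zero_iff.1 d.2)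
  have key : ∀ d : S, ∃ d' : S, Sol (fun t => N t (d.1 t)) d'.1 := fun d => by
    have hb : ∀ t, |N t (d.1 t)| ≤ η + ℓ * δ := fun t => size t _ δ (memS d t) (memS d t)
    obtain ⟨d', hd'⟩ := ex _ _ (contN _ d.1.continuous) hb
    have hd'b : ∀ t, ‖d' t‖ ≤ δ := fun t => by
      refine (small _ _ _ (by positivity) hd' hb t).trans ?_
      have := mul_le_mul_of_nonneg_right hΓℓ hδ.le
      linarith
    refine ⟨⟨BoundedContinuousFunction.ofNormedAddCommGroup d' (cont _ _ hd') δ hd'b, ?_⟩, hd'⟩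
    refine mem_closedBall_zero_iff.2 ?_
    exact BoundedContinuousFunction.norm_ofNormedAddCommGroup_le _ hδ.le hd'b
  choose Φ hΦ using key
  have hcontr : ContractingWith (1 / 2) Φ := by
    refine ⟨by rw [div_lt_one]; exacts [one_lt_two, two_pos], LipschitzWith.of_dist_le_mul fun d e => ?_⟩
    rw [Subtype.dist_eq, Subtype.dist_eq, BoundedContinuousFunction.dist_le (by positivity)]
    intro t
    rw [dist_eq_norm]
    refine (bd _ _ _ _ (ℓ * dist d.1 e.1) (by positivity) (hΦ d) (hΦ e) (fun t => ?_) t).trans ?_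
    · refine (lip t _ _ (memS d t) (memS e t)).trans (mul_le_mul_of_nonneg_left ?_ hℓ)
      rw [← dist_eq_norm]
      exact BoundedContinuousFunction.dist_coe_le_dist t
    · rw [← mul_assoc]
      exact mul_le_mul_of_nonneg_right (hΓℓ.trans (by norm_num)) dist_nonneg
  have : CompleteSpace S := Metric.isClosed_closedBall.completeSpace_coe
  have : Nonempty S := ⟨⟨0, by simp [hS, hδ.le]⟩⟩
  have hfix : Φ (ContractingWith.fixedPoint Φ hcontr) = ContractingWith.fixedPoint Φ hcontr :=
    hcontr.fixedPoint_isFixedPt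
  set d := ContractingWith.fixedPoint Φ hcontr
  have hsol : Sol (fun t => N t (d.1 t)) d.1 := by
    have := hΦ d
    rwa [hfix] at this
  refine ⟨d.1, hsol, fun t => ?_, fun d' hd' hb => ?_⟩
  -- If `‖d‖ ≤ A + 2Γη`, the fixed-point equation gives `‖d‖ ≤ Γη + (A + 2Γη)/2 = A/2 + 2Γη`: the
  -- excess over `2Γη` is halved.
  · have := le_zero_of_halving (g := fun t => ‖d.1 t‖ - 2 * (Γ * η)) (B := δ)
      (fun t => by have := memS d t; have : 0 ≤ Γ * η := by positivity
                   linarith [memS d t]) (fun A hA h t => by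
        have h1 : ∀ t, ‖d.1 t‖ ≤ A + 2 * (Γ * η) := fun t => by linarith [h t]
        have h2 := small _ _ (η + ℓ * (A + 2 * (Γ * η))) (by positivity) hsol
          (fun t => size t _ _ (memS d t) (h1 t)) t
        have h3 := mul_le_mul_of_nonneg_right hΓℓ (by positivity : 0 ≤ A + 2 * (Γ * η))
        linarith) t
    linarith
  · funext t
    have := le_zero_of_halving (g := fun t => ‖d' t - d.1 t‖) (B := 2 * δ)
      (fun t => (norm_sub_le _ _).trans (by linarith [memS d t, hb t])) (fun A hA h t => by
        refine (bd _ _ _ _ (ℓ * A) (by positivity) hd' hsol (fun t => ?_) t).trans ?_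
        · exact (lip t _ _ (hb t) (memS d t)).trans (mul_le_mul_of_nonneg_left (h t) hℓ)
        · have := mul_le_mul_of_nonneg_right hΓℓ hA
          linarith) t
    exact sub_eq_zero.1 (norm_le_zero_iff.1 this)

end

/-! ### Persistence of the hyperbolic trajectory and of its invariant manifolds -/

/-- The first-order form of `x'' = f(x) + G(t, x, x')`. -/
def forcedField (f : ℝ → ℝ) (G : ℝ → ℝ → ℝ → ℝ) (t : ℝ) (z : ℝ × ℝ) : ℝ × ℝ :=
  (z.2, f z.1 + G t z.1 z.2)

/-- The forcing `G` is bounded by `η` and `ℓ`-Lipschitz for velocities up to `R`. -/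
structure IsSmallForcing (G : ℝ → ℝ → ℝ → ℝ) (R η ℓ : ℝ) : Prop where
  cont : Continuous fun p : ℝ × ℝ × ℝ => G p.1 p.2.1 p.2.2
  nonneg : 0 ≤ ℓ
  bdd : ∀ t x v, |v| ≤ R → |G t x v| ≤ η
  lip : ∀ t x v x' v', |v| ≤ R → |v'| ≤ R → |G t x v - G t x' v'| ≤ ℓ * ‖((x, v) : ℝ × ℝ) - (x', v')‖

theorem IsSmallForcing.mono {G : ℝ → ℝ → ℝ → ℝ} {R R' η ℓ : ℝ} (h : IsSmallForcing G R η ℓ)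
    (hR : R' ≤ R) : IsSmallForcing G R' η ℓ :=
  ⟨h.cont, h.nonneg, fun t x v hv => h.bdd t x v (hv.trans hR),
    fun t x v x' v' hv hv' => h.lip t x v x' v' (hv.trans hR) (hv'.trans hR)⟩

theorem IsSmallForcing.bound_nonneg {G : ℝ → ℝ → ℝ → ℝ} {R η ℓ : ℝ} (h : IsSmallForcing G R η ℓ)
    (hR : 0 ≤ R) : 0 ≤ η :=
  (abs_nonneg _).trans (h.bdd 0 0 0 (by simpa using hR))

theorem hasDerivWithinAt_fst {z : ℝ → ℝ × ℝ} {z' : ℝ × ℝ} {S : Set ℝ} {t : ℝ}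
    (h : HasDerivWithinAt z z' S t) : HasDerivWithinAt (fun s => (z s).1) z'.1 S t :=
  (ContinuousLinearMap.fst ℝ ℝ ℝ).hasFDerivAt.comp_hasDerivWithinAt t h

theorem hasDerivWithinAt_snd {z : ℝ → ℝ × ℝ} {z' : ℝ × ℝ} {S : Set ℝ} {t : ℝ}
    (h : HasDerivWithinAt z z' S t) : HasDerivWithinAt (fun s => (z s).2) z'.2 S t :=
  (ContinuousLinearMap.snd ℝ ℝ ℝ).hasFDerivAt.comp_hasDerivWithinAt t h

theorem hasDerivWithinAt_pair {z : ℝ → ℝ × ℝ} {a b : ℝ} {S : Set ℝ} {t : ℝ}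
    (h1 : HasDerivWithinAt (fun s => (z s).1) a S t)
    (h2 : HasDerivWithinAt (fun s => (z s).2) b S t) : HasDerivWithinAt z (a, b) S t :=
  h1.prodMk h2

/-- First-order Taylor estimate, uniform on bounded sets. -/
theorem exists_taylor_bound {f : ℝ → ℝ} (hf : ContDiff ℝ 3 f) (L : ℝ) :
    ∃ κ, 0 ≤ κ ∧ ∀ X δ x x', |X| ≤ L → δ ≤ 1 → |x| ≤ δ → |x'| ≤ δ →
      |f (X + x) - f (X + x') - deriv f X * (x - x')| ≤ κ * δ * |x - x'| := by
  have c2 := (contDiff_deriv_one hf).continuous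
  obtain ⟨κ, hκ⟩ := (isCompact_Icc (a := -(L + 1)) (b := L + 1)).exists_bound_of_continuousOn
    c2.continuousOn
  refine ⟨max κ 0, le_max_right _ _, fun X δ x x' hX hδ hx hx' => ?_⟩
  have hδ0 : 0 ≤ δ := (abs_nonneg _).trans hx
  have d1 : ∀ y, HasDerivAt f (deriv f y) y := fun y =>
    (hf.differentiable (by norm_num) y).hasDerivAt
  have d2 : ∀ y, HasDerivAt (deriv f) (deriv (deriv f) y) y := fun y =>
    ((contDiff_deriv_two hf).differentiable (by norm_num) y).hasDerivAt
  have hX' := abs_le.1 hX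
  have b1 : ∀ y ∈ Icc (-δ) δ, |deriv f (X + y) - deriv f X| ≤ max κ 0 * δ := fun y hy => by
    have := (convex_Icc (-(L + 1)) (L + 1)).norm_image_sub_le_of_norm_hasDerivWithin_le
      (f := deriv f) (f' := deriv (deriv f)) (fun u _ => (d2 u).hasDerivWithinAt)
      (fun u hu => (hκ u hu).trans (le_max_left κ 0)) (x := X) (y := X + y)
      ⟨by linarith, by linarith⟩ ⟨by linarith [hy.1], by linarith [hy.2]⟩
    rw [add_sub_cancel_left, Real.norm_eq_abs, Real.norm_eq_abs] at this
    exact this.trans (mul_le_mul_of_nonneg_left (abs_le.2 hy) (le_max_right _ _))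
  have := (convex_Icc (-δ) δ).norm_image_sub_le_of_norm_hasDerivWithin_le
    (f := fun y => f (X + y) - deriv f X * y) (f' := fun y => deriv f (X + y) - deriv f X)
    (C := max κ 0 * δ) (fun y _ => by
      convert! (((d1 (X + y)).comp_const_add X y).fun_sub
        ((hasDerivAt_id y).const_mul (deriv f X))).hasDerivWithinAt using 1
      simp) (fun y hy => b1 y hy) (abs_le.1 hx') (abs_le.1 hx)
  rw [Real.norm_eq_abs, Real.norm_eq_abs] at this
  convert this using 2
  ring

section

variable {f : ℝ → ℝ} {xe : ℝ}

/-- The hyperbolic equilibrium continues to a unique bounded trajectory. -/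
theorem exists_unique_trajectoryNear (hf : ContDiff ℝ 3 f) (hxe : IsHyperbolicEquilibrium f xe)
    {R : ℝ} (hR : 1 ≤ R) :
    ∃ δ₀ > 0, ∃ Γ, 0 ≤ Γ ∧ ∀ δ, 0 < δ → δ ≤ δ₀ → ∀ G η ℓ, IsSmallForcing G R η ℓ → ℓ ≤ δ₀ →
      Γ * η ≤ δ / 2 → ∃! p, IsTrajectoryNear (forcedField f G) (xe, 0) δ p := by
  have hl2 := hxe.deriv_pos
  set l := √(deriv f xe) with hl
  have hl0 : 0 < l := Real.sqrt_pos.2 hl2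
  have hsq : l ^ 2 = deriv f xe := Real.sq_sqrt hl2.le
  obtain ⟨κ, hκ0, hκ⟩ := exists_taylor_bound hf |xe|
  set Γ := 1 / l + 1 / l ^ 2 with hΓ
  have hΓ0 : 0 < Γ := by positivity
  refine ⟨min 1 (1 / (2 * Γ * (κ + 1))), by positivity, Γ, hΓ0.le,
    fun δ hδ hδ₀ G η ℓ hG hℓ hη => ?_⟩
  have hδ1 : δ ≤ 1 := hδ₀.trans (min_le_left _ _)
  -- For `δ` and `ℓ` below `s` the Lipschitz constant `κδ + ℓ` of the nonlinear part times the gain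
  -- is at most `1/2`.
  set s := 1 / (2 * Γ * (κ + 1)) with hs
  have hsκ : Γ * (κ * s + s) = 1 / 2 := by rw [hs]; field_simp
  have hδs : δ ≤ s := hδ₀.trans (min_le_right _ _)
  have hℓs : ℓ ≤ s := hℓ.trans (min_le_right _ _)
  set N : ℝ → ℝ × ℝ → ℝ := fun t d => f (xe + d.1) - l ^ 2 * d.1 + G t (xe + d.1) d.2 with hN
  have hv : ∀ d : ℝ × ℝ, ‖d‖ ≤ δ → |d.2| ≤ R := fun d hd =>
    (norm_snd_le d).trans (hd.trans (hδ1.trans hR))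
  obtain ⟨d, hd, hdb, huniq⟩ := exists_unique_solution_of_contraction (Sol := LineSolution l)
    (N := N) (Γ := Γ) (δ := δ) (η := η) (ℓ := κ * δ + ℓ)
    (fun h H ch hh => exists_lineSolution hl0 ch hh) (fun h d hd => hd.continuous)
    (fun h h' d d' H _ hd hd' hle => (hd.sub hd').norm_le hl0 hle)
    ⟨⟨0, fun t => by simp⟩, fun t => by simpa using hasDerivAt_const t (0 : ℝ),
      fun t => by simpa using hasDerivAt_const t (0 : ℝ)⟩
    (by
      have cf := hf.continuous
      have cG : Continuous fun p : ℝ × (ℝ × ℝ) => G p.1 (xe + p.2.1) p.2.2 :=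
        hG.cont.comp (by fun_prop : Continuous fun p : ℝ × (ℝ × ℝ) => (p.1, xe + p.2.1, p.2.2))
      exact ((cf.comp (by fun_prop)).sub (by fun_prop)).add cG)
    (fun t d d' hd hd' => by
      have h1 := hκ xe δ d.1 d'.1 le_rfl hδ1 ((norm_fst_le d).trans hd) ((norm_fst_le d').trans hd')
      have h2 := hG.lip t (xe + d.1) d.2 (xe + d'.1) d'.2 (hv d hd) (hv d' hd')
      have e2 : ((xe + d.1, d.2) : ℝ × ℝ) - (xe + d'.1, d'.2) = d - d' := by
        ext <;> simp
      rw [e2] at h2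
      have h3 : |d.1 - d'.1| ≤ ‖d - d'‖ := norm_fst_le (d - d')
      have e1 : N t d - N t d' = (f (xe + d.1) - f (xe + d'.1) - deriv f xe * (d.1 - d'.1)) +
          (G t (xe + d.1) d.2 - G t (xe + d'.1) d'.2) := by
        simp only [hN, ← hsq]; ring
      rw [e1, add_mul]
      exact (abs_add_le _ _).trans (add_le_add (h1.trans
        (mul_le_mul_of_nonneg_left h3 (by positivity))) h2))
    (fun t => by
      simp only [hN, Prod.fst_zero, Prod.snd_zero, add_zero, hxe.1, mul_zero, sub_zero, zero_add]
      exact hG.bdd _ _ _ (by rw [abs_zero]; linarith))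
    hΓ0.le hδ (hG.bound_nonneg (by linarith)) (by have := hG.nonneg; positivity)
    (by rw [← hsκ]; gcongr) hη
  refine ⟨fun t => (xe, 0) + d t, ⟨fun t _ => ?_, fun t => ?_⟩, fun p hp => ?_⟩
  · refine hasDerivWithinAt_pair ?_ ?_
    · convert! ((hd.fst t).const_add xe).hasDerivWithinAt using 1
      simp
    · convert! ((hd.snd t).const_add 0).hasDerivWithinAt using 1
      simp only [hN, Prod.fst_add, Prod.snd_add, zero_add]
      ring
  · rw [dist_eq_norm, add_sub_cancel_left]
    exact (hdb t).trans (by linarith)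
  · have hb : ∀ t, ‖p t - (xe, 0)‖ ≤ δ := fun t => by rw [← dist_eq_norm]; exact hp.2 t
    have h1 : ∀ t, HasDerivAt p (forcedField f G t (p t)) t := fun t =>
      (hp.1 t (mem_univ t)).hasDerivAt univ_mem
    have := huniq (fun t => p t - (xe, 0)) ⟨⟨δ, hb⟩, fun t => ?_, fun t => ?_⟩ hb
    · funext t
      rw [← this]
      simp
    · convert! (hasDerivWithinAt_fst (h1 t).hasDerivWithinAt).hasDerivAt univ_mem |>.sub_const xe
        using 1
      simp [forcedField]
    · convert! (hasDerivWithinAt_snd (h1 t).hasDerivWithinAt).hasDerivAt univ_mem |>.sub_const 0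
        using 1
      simp only [hN, forcedField, Prod.fst_sub, Prod.snd_sub, sub_zero]
      rw [add_sub_cancel]
      ring

end

/-- The inhomogeneity in the equation for the deviation from the separatrix. -/
def deviationForcing (f x₀ : ℝ → ℝ) (G : ℝ → ℝ → ℝ → ℝ) (t₀ τ : ℝ) (d : ℝ × ℝ) : ℝ :=
  f (x₀ τ + d.1) - f (x₀ τ) - deriv f (x₀ τ) * d.1 +
    G (t₀ + τ) (x₀ τ + d.1) (deriv x₀ τ + d.2)

section

variable {f : ℝ → ℝ} {xe : ℝ} {x₀ : ℝ → ℝ} {G : ℝ → ℝ → ℝ → ℝ} {R η ℓ δ κ L t₀ : ℝ}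

/-- `d` is a deviation from the separatrix: `z₀ + d` solves the forced system on the half-line and
starts on the normal line. -/
def IsDeviation (f x₀ : ℝ → ℝ) (G : ℝ → ℝ → ℝ → ℝ) (t₀ : ℝ) (d : ℝ → ℝ × ℝ) : Prop :=
  HalfLineSolution (deriv x₀) (fun t => f (x₀ t)) (fun t => deriv f (x₀ t))
    (fun τ => deviationForcing f x₀ G t₀ τ (d τ)) d

theorem continuous_deviationForcing (hf : ContDiff ℝ 3 f) (cx : Continuous x₀)
    (cv : Continuous (deriv x₀)) (hG : IsSmallForcing G R η ℓ) (t₀ : ℝ) :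
    Continuous fun p : ℝ × (ℝ × ℝ) => deviationForcing f x₀ G t₀ p.1 p.2 := by
  have cf := hf.continuous
  have ca := (contDiff_deriv_two hf).continuous
  have cG : Continuous fun p : ℝ × (ℝ × ℝ) => G (t₀ + p.1) (x₀ p.1 + p.2.1)
      (deriv x₀ p.1 + p.2.2) := hG.cont.comp (by fun_prop : Continuous fun p : ℝ × (ℝ × ℝ) =>
        (t₀ + p.1, x₀ p.1 + p.2.1, deriv x₀ p.1 + p.2.2))
  exact (((cf.comp (by fun_prop)).sub (cf.comp (by fun_prop))).sub
    ((ca.comp (by fun_prop)).mul (by fun_prop))).add cG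

theorem deviationForcing_lipschitz (hG : IsSmallForcing G R η ℓ)
    (hκ : ∀ X δ x x', |X| ≤ L → δ ≤ 1 → |x| ≤ δ → |x'| ≤ δ →
      |f (X + x) - f (X + x') - deriv f X * (x - x')| ≤ κ * δ * |x - x'|) (hκ0 : 0 ≤ κ)
    (hX : ∀ t, |x₀ t| ≤ L) (hV : ∀ t, |deriv x₀ t| ≤ L) (hR : L + 1 ≤ R) (hδ1 : δ ≤ 1)
    (τ : ℝ) {d d' : ℝ × ℝ} (hd : ‖d‖ ≤ δ) (hd' : ‖d'‖ ≤ δ) :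
    |deviationForcing f x₀ G t₀ τ d - deviationForcing f x₀ G t₀ τ d'| ≤
      (κ * δ + ℓ) * ‖d - d'‖ := by
  have hδ0 : 0 ≤ δ := (norm_nonneg _).trans hd
  have hv : ∀ d : ℝ × ℝ, ‖d‖ ≤ δ → |deriv x₀ τ + d.2| ≤ R := fun d hd => by
    have := (abs_add_le (deriv x₀ τ) d.2).trans (add_le_add (hV τ) (norm_snd_le d))
    linarith
  have h1 := hκ (x₀ τ) δ d.1 d'.1 (hX τ) hδ1 ((norm_fst_le d).trans hd) ((norm_fst_le d').trans hd')
  have h2 := hG.lip (t₀ + τ) (x₀ τ + d.1) (deriv x₀ τ + d.2) (x₀ τ + d'.1) (deriv x₀ τ + d'.2)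
    (hv d hd) (hv d' hd')
  have e2 : ((x₀ τ + d.1, deriv x₀ τ + d.2) : ℝ × ℝ) - (x₀ τ + d'.1, deriv x₀ τ + d'.2)
      = d - d' := by ext <;> simp
  rw [e2] at h2
  have h3 : |d.1 - d'.1| ≤ ‖d - d'‖ := norm_fst_le (d - d')
  have e1 : deviationForcing f x₀ G t₀ τ d - deviationForcing f x₀ G t₀ τ d' =
      (f (x₀ τ + d.1) - f (x₀ τ + d'.1) - deriv f (x₀ τ) * (d.1 - d'.1)) +
      (G (t₀ + τ) (x₀ τ + d.1) (deriv x₀ τ + d.2) -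
        G (t₀ + τ) (x₀ τ + d'.1) (deriv x₀ τ + d'.2)) := by
    simp only [deviationForcing]; ring
  rw [e1, add_mul]
  exact (abs_add_le _ _).trans (add_le_add (h1.trans
    (mul_le_mul_of_nonneg_left h3 (by positivity))) h2)

theorem deviationForcing_zero (f x₀ : ℝ → ℝ) (G : ℝ → ℝ → ℝ → ℝ) (t₀ τ : ℝ) :
    deviationForcing f x₀ G t₀ τ 0 = G (t₀ + τ) (x₀ τ) (deriv x₀ τ) := by
  simp [deviationForcing]

/-- A deviation yields a solution of the forced system. -/
theorem IsDeviation.isSolutionOn (h : IsHomoclinic f xe x₀) (hf : ContDiff ℝ 3 f)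
    (hG : IsSmallForcing G R η ℓ) {d : ℝ → ℝ × ℝ} (hd : IsDeviation f x₀ G t₀ d) :
    IsSolutionOn (forcedField f G) (Ici t₀) fun t => separatrix x₀ (t - t₀) + d (t - t₀) := by
  set z : ℝ → ℝ × ℝ := fun t => separatrix x₀ (t - t₀) + d (t - t₀) with hz
  have cx := h.continuous
  have cv := h.continuous_deriv
  have cd := hd.cont
  have cz : Continuous z := by
    simp only [hz, separatrix]; fun_prop
  have h1 : ∀ t, t₀ < t → HasDerivAt z (forcedField f G t (z t)) t := fun t ht => by
    have ht' : 0 < t - t₀ := sub_pos.2 ht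
    have e1 := ((h.1 (t - t₀)).fun_add (hd.fst _ ht')).comp_sub_const t t₀
    have e2 := ((h.2.1 (t - t₀)).fun_add (hd.snd _ ht')).comp_sub_const t t₀
    convert! e1.prodMk e2 using 1
    simp only [hz, forcedField, separatrix, deviationForcing, Prod.fst_add, Prod.snd_add]
    rw [add_sub_cancel]
    ring_nf
  have cX : Continuous fun t => forcedField f G t (z t) := by
    have cf := hf.continuous
    exact (continuous_snd.comp cz).prodMk ((cf.comp (continuous_fst.comp cz)).add
      (hG.cont.comp (continuous_id.prodMk ((continuous_fst.comp cz).prodMk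
        (continuous_snd.comp cz)))))
  intro t ht
  rcases (mem_Ici.1 ht).eq_or_lt with rfl | hlt
  -- The deviation satisfies its equation for positive times only. At the initial time the one-sided
  -- derivative is the limit of the derivatives, by continuity of the field along the solution.
  · refine hasDerivWithinAt_Ici_of_tendsto_deriv (s := Ioi t₀)
      (fun t ht => (h1 t ht).differentiableAt.differentiableWithinAt)
      cz.continuousWithinAt self_mem_nhdsWithin ?_
    refine Tendsto.congr' ?_ (cX.continuousWithinAt (s := Ioi t₀) (x := t₀))
    filter_upwards [self_mem_nhdsWithin] with t ht
    exact (h1 t ht).deriv.symm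
  · exact (h1 t hlt).hasDerivWithinAt

/-- A solution of the forced system close to the separatrix yields a deviation. -/
theorem isDeviation_of_isSolutionOn (h : IsHomoclinic f xe x₀) {z : ℝ → ℝ × ℝ}
    (hz : IsSolutionOn (forcedField f G) (Ici t₀) z) (hSec : z t₀ ∈ normalSection f x₀)
    (hδ : ∀ t ∈ Ici t₀, dist (z t) (separatrix x₀ (t - t₀)) ≤ δ) :
    IsDeviation f x₀ G t₀ (fun τ => z (t₀ + max τ 0) - separatrix x₀ (max τ 0)) ∧
      ∀ τ, ‖z (t₀ + max τ 0) - separatrix x₀ (max τ 0)‖ ≤ δ := by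
  have hb : ∀ τ, ‖z (t₀ + max τ 0) - separatrix x₀ (max τ 0)‖ ≤ δ := fun τ => by
    have := hδ (t₀ + max τ 0) (by simp)
    rwa [dist_eq_norm, add_sub_cancel_left] at this
  have cx := h.continuous
  have cv := h.continuous_deriv
  have cs : Continuous (separatrix x₀) := cx.prodMk cv
  have hz' : ∀ τ, 0 < τ → HasDerivAt z (forcedField f G (t₀ + τ) (z (t₀ + τ))) (t₀ + τ) :=
    fun τ hτ => (hz _ (by simp [hτ.le])).hasDerivAt (Ici_mem_nhds (by linarith))
  have eq : ∀ τ, 0 < τ → (fun τ => z (t₀ + max τ 0) - separatrix x₀ (max τ 0)) =ᶠ[𝓝 τ]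
      fun τ => z (t₀ + τ) - separatrix x₀ τ := fun τ hτ => by
    filter_upwards [Ioi_mem_nhds hτ] with s hs
    rw [max_eq_left (mem_Ioi.1 hs).le]
  refine ⟨⟨?_, fun t ht => by rw [max_eq_right ht, max_self], ⟨δ, hb⟩, ?_, fun τ hτ => ?_,
    fun τ hτ => ?_⟩, hb⟩
  · refine Continuous.sub ?_ (by fun_prop)
    have c1 : ContinuousOn z (Ici t₀) := fun t ht => (hz t ht).continuousWithinAt
    exact c1.comp_continuous (by fun_prop) fun τ => by simp
  · obtain ⟨s, -, hs⟩ := hSec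
    simp only [max_self, add_zero, hs, add_sub_cancel_left, Prod.smul_fst, Prod.smul_snd,
      smul_eq_mul]
    ring
  · refine HasDerivAt.congr_of_eventuallyEq ?_ ((eq τ hτ).fun_comp Prod.fst)
    have e1 := (hasDerivWithinAt_fst (hz' τ hτ).hasDerivWithinAt).hasDerivAt univ_mem
    convert! (e1.comp_const_add t₀ τ).fun_sub (h.1 τ) using 1
    simp [max_eq_left hτ.le, forcedField, separatrix]
  · refine HasDerivAt.congr_of_eventuallyEq ?_ ((eq τ hτ).fun_comp Prod.snd)
    have e1 := (hasDerivWithinAt_snd (hz' τ hτ).hasDerivWithinAt).hasDerivAt univ_mem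
    convert! (e1.comp_const_add t₀ τ).fun_sub (h.2.1 τ) using 1
    simp only [max_eq_left hτ.le, forcedField, separatrix, deviationForcing, Prod.fst_sub,
      Prod.snd_sub, add_sub_cancel]
    ring

/-- Solutions close to the equilibrium for large times are asymptotic to each other. -/
theorem tendsto_sub_of_close (hG : IsSmallForcing G R η ℓ)
    (hκ : ∀ X δ x x', |X| ≤ L → δ ≤ 1 → |x| ≤ δ → |x'| ≤ δ →
      |f (X + x) - f (X + x') - deriv f X * (x - x')| ≤ κ * δ * |x - x'|) (hκ0 : 0 ≤ κ)
    (hxL : |xe| ≤ L) (hR : 1 ≤ R) (hδ1 : δ ≤ 1) {l : ℝ} (hl : 0 < l) (hl2 : l ^ 2 = deriv f xe)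
    (hsmall : (κ * δ + ℓ) * (1 / (2 * l) + 1 / 2) ≤ l / 4) {z p : ℝ → ℝ × ℝ} {T : ℝ}
    (hz : ∀ t, T ≤ t → HasDerivAt z (forcedField f G t (z t)) t)
    (hp : ∀ t, T ≤ t → HasDerivAt p (forcedField f G t (p t)) t)
    (bz : ∀ t, T ≤ t → dist (z t) (xe, 0) ≤ δ) (bp : ∀ t, T ≤ t → dist (p t) (xe, 0) ≤ δ) :
    Tendsto (fun t => z t - p t) atTop (𝓝 0) := by
  have hδ0 : 0 ≤ δ := dist_nonneg.trans (bz T le_rfl)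
  have comp : ∀ w : ℝ × ℝ, dist w (xe, 0) ≤ δ → |w.1 - xe| ≤ δ ∧ |w.2| ≤ δ := fun w hw => by
    rw [dist_eq_norm] at hw
    refine ⟨(norm_fst_le (w - (xe, 0))).trans hw, ?_⟩
    simpa using (norm_snd_le (w - (xe, 0))).trans hw
  -- The difference of the two solutions satisfies the linearized saddle equation up to an error
  -- with constant `κδ + ℓ`, so `cone_decay` forces it to decay.
  set y : ℝ → ℝ := fun t => (z t).1 - (p t).1 with hy
  set v : ℝ → ℝ := fun t => (z t).2 - (p t).2 with hv
  set e : ℝ → ℝ := fun t => (f (z t).1 - f (p t).1 - deriv f xe * y t) +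
    (G t (z t).1 (z t).2 - G t (p t).1 (p t).2) with he
  have hG0 := hG.nonneg
  obtain ⟨hcone, hdec⟩ := cone_decay (y := y) (v := v) (e := e) (l := l) (κ := κ * δ + ℓ) (T := T)
    (B := 2 * δ) hl
    (fun t ht => ((hasDerivWithinAt_fst (hz t ht).hasDerivWithinAt).hasDerivAt univ_mem).fun_sub
      ((hasDerivWithinAt_fst (hp t ht).hasDerivWithinAt).hasDerivAt univ_mem))
    (fun t ht => by
      convert! ((hasDerivWithinAt_snd (hz t ht).hasDerivWithinAt).hasDerivAt univ_mem).fun_sub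
        ((hasDerivWithinAt_snd (hp t ht).hasDerivWithinAt).hasDerivAt univ_mem) using 1
      simp only [he, forcedField, hl2]; ring)
    (fun t ht => by
      obtain ⟨z1, z2⟩ := comp _ (bz t ht)
      obtain ⟨p1, p2⟩ := comp _ (bp t ht)
      have h1 := hκ xe δ ((z t).1 - xe) ((p t).1 - xe) hxL hδ1 z1 p1
      rw [add_sub_cancel, add_sub_cancel, sub_sub_sub_cancel_right] at h1
      have h2 := hG.lip t (z t).1 (z t).2 (p t).1 (p t).2 (z2.trans (hδ1.trans hR))
        (p2.trans (hδ1.trans hR))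
      have h3 : ‖(((z t).1, (z t).2) : ℝ × ℝ) - ((p t).1, (p t).2)‖ ≤ |y t| + |v t| :=
        max_le (le_add_of_nonneg_right (abs_nonneg _)) (le_add_of_nonneg_left (abs_nonneg _))
      rw [add_mul]
      refine (abs_add_le _ _).trans (add_le_add (h1.trans ?_) (h2.trans ?_))
      · exact mul_le_mul_of_nonneg_left (le_add_of_nonneg_right (abs_nonneg _)) (by positivity)
      · exact mul_le_mul_of_nonneg_left h3 hG0)
    (by positivity) hsmall (fun t ht => by
      obtain ⟨z1, z2⟩ := comp _ (bz t ht)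
      obtain ⟨p1, p2⟩ := comp _ (bp t ht)
      constructor
      · rw [show y t = ((z t).1 - xe) - ((p t).1 - xe) by simp only [hy]; ring]
        exact (abs_sub _ _).trans (by linarith)
      · exact (abs_sub _ _).trans (by linarith))
  set w : ℝ → ℝ := fun t => v t - l * y t with hw
  have lw : Tendsto w atTop (𝓝 0) := by
    have h1 : Tendsto (fun t => w t ^ 2) atTop (𝓝 0) := by
      refine squeeze_zero' (Eventually.of_forall fun t => sq_nonneg _) ?_
        (tendsto_exp_neg_mul hl (w T ^ 2) T)
      filter_upwards [eventually_ge_atTop T] with t ht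
      rw [mul_comm]
      exact hdec T t le_rfl ht
    have h2 := (Real.continuous_sqrt.tendsto 0).comp h1
    rw [Real.sqrt_zero] at h2
    exact squeeze_zero_norm (fun t => by
      simp only [Function.comp, Real.sqrt_sq_eq_abs, Real.norm_eq_abs, le_refl]) h2
  have lu : Tendsto (fun t => v t + l * y t) atTop (𝓝 0) := by
    refine squeeze_zero_norm' ?_ (by simpa using lw.abs)
    filter_upwards [eventually_ge_atTop T] with t ht
    rw [Real.norm_eq_abs]
    have := hcone t ht
    linarith [abs_nonneg (v t + l * y t)]
  have l2 : Tendsto v atTop (𝓝 0) := by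
    have := (lu.add lw).div_const 2
    rw [add_zero, zero_div] at this
    refine this.congr fun t => ?_
    simp only [hw]; ring
  have l1 : Tendsto y atTop (𝓝 0) := by
    have := (lu.sub lw).div_const (2 * l)
    rw [sub_zero, zero_div] at this
    refine this.congr fun t => ?_
    simp only [hw]; field_simp; ring
  exact l1.prodMk_nhds l2

end

section

variable {f : ℝ → ℝ} {xe : ℝ} {x₀ : ℝ → ℝ}

/-- The first intersection of the stable manifold with the normal section: existence, uniqueness
and the first-order (Melnikov) formula for its position. -/
theorem IsHomoclinic.exists_stable_crossing (h : IsHomoclinic f xe x₀) (hf : ContDiff ℝ 3 f)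
    (hxe : IsHyperbolicEquilibrium f xe) :
    ∃ δ₀ > 0, ∃ Γ R C : ℝ, 0 ≤ Γ ∧ 0 ≤ C ∧ ∀ δ, 0 < δ → δ ≤ δ₀ →
      ∀ G η ℓ, IsSmallForcing G R η ℓ → ℓ ≤ δ₀ → Γ * η ≤ δ / 2 →
      ∀ p, IsTrajectoryNear (forcedField f G) (xe, 0) δ p → ∀ t₀,
      (∃! Z, IsStableCrossing (forcedField f G) p (separatrix x₀) (normalSection f x₀) δ t₀ Z) ∧
      ∀ Z, IsStableCrossing (forcedField f G) p (separatrix x₀) (normalSection f x₀) δ t₀ Z →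
        |deriv x₀ 0 * (Z.2 - deriv x₀ 0) - f (x₀ 0) * (Z.1 - x₀ 0) +
          ∫ τ in Ioi 0, deriv x₀ τ * G (t₀ + τ) (x₀ τ) (deriv x₀ τ)| ≤ C * (η ^ 2 + ℓ * η) := by
  obtain ⟨L, hL1, hL⟩ := h.exists_bound hf
  obtain ⟨C, ν, T, K, hd⟩ := h.exists_decayAtTop hf hxe
  set V := deriv x₀ with hV
  set W : ℝ → ℝ := fun t => f (x₀ t) with hW
  have o : StableOrbit V W (fun t => deriv f (x₀ t)) L C ν T K :=
    ⟨h.2.1, h.hasDerivAt_W hf, (contDiff_deriv_two hf).continuous.comp h.continuous,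
      fun t => (hL t).2.2.1, h.speed_pos hf, hd⟩
  have hxL : |xe| ≤ L := le_of_tendsto h.2.2.1.abs (Eventually.of_forall fun t => (hL t).2.2.2.2)
  obtain ⟨κ, hκ0, hκ⟩ := exists_taylor_bound hf L
  have hl2 := hxe.deriv_pos
  set l := √(deriv f xe) with hl
  have hl0 : 0 < l := Real.sqrt_pos.2 hl2
  have hsq : l ^ 2 = deriv f xe := Real.sq_sqrt hl2.le
  set Γ := StableOrbit.gain L C ν with hΓ
  have hC0 := o.dec.pos
  have hν0 := o.dec.rate
  have hΓ0 : 0 < Γ := by rw [hΓ, StableOrbit.gain]; positivity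
  set R0 := V 0 ^ 2 + W 0 ^ 2 with hR0
  have hR00 : 0 < R0 := o.speed 0
  -- Three smallness thresholds: `s1` for the contraction, `s2` so that the crossing point lies on
  -- the segment `|s| ≤ 1`, and `s3` for the cone estimate on a ball of radius `2δ`.
  set s1 := 1 / (2 * Γ * (κ + 1)) with hs1
  set s2 := R0 / (2 * L) with hs2
  set s3 := l / 4 / ((1 / (2 * l) + 1 / 2) * (2 * κ + 1)) with hs3
  have e1 : Γ * (κ * s1 + s1) = 1 / 2 := by rw [hs1]; field_simp
  have e2 : 2 * L * s2 = R0 := by rw [hs2]; field_simp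
  have e3 : (κ * (2 * s3) + s3) * (1 / (2 * l) + 1 / 2) = l / 4 := by rw [hs3]; field_simp
  set I := ∫ τ in Ioi 0, |V τ| with hI
  have hI0 : 0 ≤ I := integral_nonneg fun τ => abs_nonneg _
  refine ⟨min (min (1 / 2) s1) (min s2 s3), by positivity, Γ, L + 1,
    I * (4 * κ * Γ ^ 2 + 2 * Γ), hΓ0.le, by positivity,
    fun δ hδ hδ₀ G η ℓ hG hℓ hη p hp t₀ => ?_⟩
  have hδ1 : δ ≤ 1 / 2 := hδ₀.trans ((min_le_left _ _).trans (min_le_left _ _))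
  have hδs1 : δ ≤ s1 := hδ₀.trans ((min_le_left _ _).trans (min_le_right _ _))
  have hδs2 : δ ≤ s2 := hδ₀.trans ((min_le_right _ _).trans (min_le_left _ _))
  have hδs3 : δ ≤ s3 := hδ₀.trans ((min_le_right _ _).trans (min_le_right _ _))
  have hℓs1 : ℓ ≤ s1 := hℓ.trans ((min_le_left _ _).trans (min_le_right _ _))
  have hℓs3 : ℓ ≤ s3 := hℓ.trans ((min_le_right _ _).trans (min_le_right _ _))
  have hℓ0 := hG.nonneg
  have hη0 : 0 ≤ η := hG.bound_nonneg (by linarith)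
  have hNlip := fun (δ : ℝ) (hδ : δ ≤ 1) (t : ℝ) (d d' : ℝ × ℝ) (hd : ‖d‖ ≤ δ) (hd' : ‖d'‖ ≤ δ) =>
    deviationForcing_lipschitz (t₀ := t₀) hG hκ hκ0 (fun t => (hL t).2.2.2.2) (fun t => (hL t).1)
      le_rfl hδ t hd hd'
  obtain ⟨d, hd, hdb, huniq⟩ := exists_unique_solution_of_contraction
    (Sol := HalfLineSolution V W (fun t => deriv f (x₀ t)))
    (N := deviationForcing f x₀ G t₀) (Γ := Γ) (δ := δ) (η := η) (ℓ := κ * δ + ℓ)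
    (fun h H ch hh => o.exists_halfLineSolution ch hh) (fun h d hd => hd.cont)
    (fun h h' d d' H hH hd hd' hle => (hd.sub hd').norm_le o hH fun t _ => hle t)
    ⟨continuous_const, fun t _ => rfl, ⟨0, fun t => by simp⟩, by simp,
      fun t _ => by simpa using hasDerivAt_const t (0 : ℝ),
      fun t _ => by simpa using hasDerivAt_const t (0 : ℝ)⟩
    (continuous_deviationForcing hf h.continuous h.continuous_deriv hG t₀)
    (hNlip δ (by linarith))
    (fun t => by
      rw [deviationForcing_zero]
      exact hG.bdd _ _ _ ((hL t).1.trans (by linarith)))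
    hΓ0.le hδ hη0 (by positivity) (by rw [← e1]; gcongr) hη
  have hlt : ∀ᶠ t in atTop, dist (separatrix x₀ (t - t₀)) (xe, 0) < δ := by
    have h1 : Tendsto (separatrix x₀) atTop (𝓝 (xe, 0)) := h.2.2.1.prodMk_nhds h.2.2.2.1
    have h2 := h1.comp (tendsto_atTop_add_const_right atTop (-t₀) tendsto_id)
    filter_upwards [h2.eventually (Metric.ball_mem_nhds _ hδ)] with t ht
    exact ht
  have hex : IsStableCrossing (forcedField f G) p (separatrix x₀) (normalSection f x₀) δ t₀
      (separatrix x₀ 0 + d 0) := by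
    have hsol := IsDeviation.isSolutionOn h hf hG hd
    have hclose : ∀ t, dist (separatrix x₀ (t - t₀) + d (t - t₀)) (separatrix x₀ (t - t₀)) ≤ δ :=
      fun t => by
        rw [dist_eq_norm, add_sub_cancel_left]
        exact (hdb _).trans (by linarith)
    refine ⟨?_, _, hsol, by simp, ?_, fun t _ => hclose t⟩
    · have hb : V 0 * (d 0).1 + W 0 * (d 0).2 = 0 := hd.bdry
      have hd0 : ‖d 0‖ ≤ δ := (hdb 0).trans (by linarith)
      have h1 : |(d 0).1| ≤ δ := (norm_fst_le _).trans hd0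
      have h2 : |(d 0).2| ≤ δ := (norm_snd_le _).trans hd0
      -- The boundary condition makes `d 0` a multiple of the normal vector `(-W 0, V 0)`; the
      -- multiple is the wedge divided by the squared speed.
      refine ⟨(V 0 * (d 0).2 - W 0 * (d 0).1) / R0, abs_le.1 ?_, ?_⟩
      · rw [abs_div, abs_of_pos hR00, div_le_one hR00]
        refine (abs_sub _ _).trans ?_
        rw [abs_mul, abs_mul]
        have q1 := mul_le_mul (hL 0).1 h2 (abs_nonneg _) (by linarith)
        have q2 := mul_le_mul (hL 0).2.1 h1 (abs_nonneg _) (by linarith)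
        have q3 := mul_le_mul_of_nonneg_left hδs2 (by linarith : 0 ≤ 2 * L)
        linarith
      · congr 1
        ext
        · simp only [Prod.smul_fst, smul_eq_mul]
          change (d 0).1 = _ * -(W 0)
          field_simp
          simp only [hR0]
          linear_combination (V 0) * hb
        · simp only [Prod.smul_snd, smul_eq_mul]
          field_simp
          simp only [hR0]
          linear_combination (W 0) * hb
    · obtain ⟨T', hT'⟩ := eventually_atTop.1 hlt
      -- Eventually the separatrix is within `δ` of the equilibrium and the solution is within `δ`
      -- of the separatrix, hence the radius `2δ`. The start after `t₀ + 1` provides two-sided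
      -- derivatives.
      refine tendsto_sub_of_close (δ := 2 * δ) (T := max T' (t₀ + 1)) hG hκ hκ0 hxL (by linarith)
        (by linarith) hl0 hsq ?_ (fun t ht => ?_) (fun t ht => ?_) (fun t ht => ?_) fun t ht => ?_
      · rw [← e3]; gcongr
      · have : t₀ < t := by linarith [(le_max_right T' (t₀ + 1)).trans ht]
        exact (hsol t this.le).hasDerivAt (Ici_mem_nhds this)
      · exact (hp.1 t (mem_univ t)).hasDerivAt univ_mem
      · refine (dist_triangle _ (separatrix x₀ (t - t₀)) _).trans ?_
        linarith [hclose t, hT' t ((le_max_left _ _).trans ht)]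
      · exact (hp.2 t).trans (by linarith)
  have hall : ∀ Z, IsStableCrossing (forcedField f G) p (separatrix x₀) (normalSection f x₀) δ t₀ Z
      → Z = separatrix x₀ 0 + d 0 := fun Z hZ => by
    obtain ⟨hSec, z, hz, rfl, -, hclose⟩ := hZ
    obtain ⟨h1, h2⟩ := isDeviation_of_isSolutionOn h hz hSec hclose
    have := congrFun (huniq _ h1 h2) 0
    simp only [max_self, add_zero] at this
    rw [← this]; abel
  refine ⟨⟨_, hex, hall⟩, fun Z hZ => ?_⟩
  rw [hall Z hZ]
  -- The Lipschitz estimate is applied on the ball of radius `2Γη` instead of `δ`, which makes `E` a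
  -- combination of `η²` and `ℓη` with coefficients free of `δ`.
  set E := (κ * (2 * (Γ * η)) + ℓ) * (2 * (Γ * η)) with hE
  have hE0 : 0 ≤ E := by positivity
  set g : ℝ → ℝ := fun τ => deviationForcing f x₀ G t₀ τ (d τ) with hg
  have cg : Continuous g := (continuous_deviationForcing hf h.continuous h.continuous_deriv hG
    t₀).comp (continuous_id.prodMk hd.cont)
  set g0 : ℝ → ℝ := fun τ => G (t₀ + τ) (x₀ τ) (deriv x₀ τ) with hg0
  have cg0 : Continuous g0 := hG.cont.comp ((continuous_const.add continuous_id).prodMk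
    (h.continuous.prodMk h.continuous_deriv))
  have hg0b : ∀ τ, |g0 τ| ≤ η := fun τ => hG.bdd _ _ _ ((hL τ).1.trans (by linarith))
  have hgg : ∀ τ, |g τ - g0 τ| ≤ E := fun τ => by
    have h1 := hNlip (2 * (Γ * η)) (by linarith) τ (d τ) 0 (hdb τ) (by simp; positivity)
    rw [deviationForcing_zero, sub_zero] at h1
    exact h1.trans (mul_le_mul_of_nonneg_left (hdb τ) (by positivity))
  have hgb : ∀ τ, |g τ| ≤ η + E := fun τ => by
    rw [show g τ = g0 τ + (g τ - g0 τ) by ring]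
    exact (abs_add_le _ _).trans (add_le_add (hg0b τ) (hgg τ))
  have i1 := o.integrableOn_V_mul cg fun t _ => hgb t
  have i2 := o.integrableOn_V_mul cg0 fun t _ => hg0b t
  have i3 : IntegrableOn (fun τ => |V τ|) (Ioi 0) := by
    have := o.integrableOn_V_mul (h := fun _ => 1) continuous_const fun t _ =>
      (abs_one (α := ℝ)).le
    simp only [mul_one] at this
    exact this.abs
  have cd1 := continuous_fst.comp hd.cont
  have cd2 := continuous_snd.comp hd.cont
  have hM : Continuous fun t => V t * (d t).2 - W t * (d t).1 :=
    (o.cV.mul cd2).sub (o.cW.mul cd1)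
  -- An exact identity: the integral of `V g` is minus the initial wedge, which measures the
  -- position of the crossing on the normal section. Only the replacement of `g` by `g0` is
  -- approximate.
  have hint := integral_Ioi_of_hasDerivAt_of_tendsto
    (f := fun t => V t * (d t).2 - W t * (d t).1) (f' := fun t => V t * g t) (hM.continuousWithinAt (s := Ici 0) (x := 0))
    (fun t ht => hd.hasDerivAt_wedge o t ht) i1 (hd.tendsto_wedge o)
  have hfin : deriv x₀ 0 * ((separatrix x₀ 0 + d 0).2 - deriv x₀ 0) -
      f (x₀ 0) * ((separatrix x₀ 0 + d 0).1 - x₀ 0) + ∫ τ in Ioi 0, V τ * g0 τ =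
      -∫ τ in Ioi 0, V τ * (g τ - g0 τ) := by
    simp only [mul_sub]
    rw [integral_sub i1 i2, hint]
    simp only [separatrix, Prod.fst_add, Prod.snd_add, hV, hW]
    ring
  rw [hfin, abs_neg]
  calc |∫ τ in Ioi 0, V τ * (g τ - g0 τ)| ≤ ∫ τ in Ioi 0, |V τ| * E := by
        rw [← Real.norm_eq_abs]
        refine norm_integral_le_of_norm_le (Integrable.mul_const i3 E) (Eventually.of_forall fun τ => ?_)
        rw [Real.norm_eq_abs, abs_mul]
        exact mul_le_mul_of_nonneg_left (hgg τ) (abs_nonneg _)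
    _ = I * E := integral_mul_const _ _
    _ = I * (4 * κ * Γ ^ 2 * η ^ 2 + 2 * Γ * (ℓ * η)) := by rw [hE]; ring
    _ ≤ I * (4 * κ * Γ ^ 2 * (η ^ 2 + ℓ * η) + 2 * Γ * (η ^ 2 + ℓ * η)) := by
        gcongr
        · exact le_add_of_nonneg_right (by positivity)
        · exact le_add_of_nonneg_left (by positivity)
    _ = _ := by ring

end

/-! ### Time reversal -/

/-- The reflection `(x, v) ↦ (x, -v)` of the phase plane. -/
def flipVelocity (z : ℝ × ℝ) : ℝ × ℝ := (z.1, -z.2)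

/-- The forcing seen in reversed time. -/
def reverseForcing (G : ℝ → ℝ → ℝ → ℝ) (t x v : ℝ) : ℝ := G (-t) x (-v)

theorem flipVelocity_flipVelocity (z : ℝ × ℝ) : flipVelocity (flipVelocity z) = z := by
  simp [flipVelocity]

theorem dist_flipVelocity (z w : ℝ × ℝ) : dist (flipVelocity z) (flipVelocity w) = dist z w := by
  simp [flipVelocity, Prod.dist_eq, dist_neg_neg]

theorem continuous_flipVelocity : Continuous flipVelocity := by
  unfold flipVelocity; fun_prop

theorem reverseForcing_reverseForcing (G : ℝ → ℝ → ℝ → ℝ) :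
    reverseForcing (reverseForcing G) = G := by
  funext t x v; simp [reverseForcing]

section

variable {f : ℝ → ℝ} {xe : ℝ} {x₀ : ℝ → ℝ} {G : ℝ → ℝ → ℝ → ℝ} {p z : ℝ → ℝ × ℝ} {S : Set ℝ}
  {R η ℓ δ t₀ : ℝ} {Z : ℝ × ℝ}

theorem IsSmallForcing.reverse (h : IsSmallForcing G R η ℓ) :
    IsSmallForcing (reverseForcing G) R η ℓ := by
  refine ⟨h.cont.comp (by fun_prop : Continuous fun p : ℝ × ℝ × ℝ => (-p.1, p.2.1, -p.2.2)),
    h.nonneg, fun t x v hv => h.bdd _ _ _ (by rwa [abs_neg]), fun t x v x' v' hv hv' => ?_⟩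
  refine (h.lip (-t) x (-v) x' (-v') (by rwa [abs_neg]) (by rwa [abs_neg])).trans_eq ?_
  congr 1
  rw [← dist_eq_norm, ← dist_eq_norm]
  exact dist_flipVelocity (x, v) (x', v')

/-- The reversal `(t, x, v) ↦ (-t, x, -v)` preserves the form of the equation and the size of the
forcing, and exchanges stable and unstable manifolds. -/
theorem IsSolutionOn.reverse (h : IsSolutionOn (forcedField f G) S z) :
    IsSolutionOn (forcedField f (reverseForcing G)) (-S) fun t => flipVelocity (z (-t)) := by
  intro t ht
  have h1 := h (-t) ht
  have hneg : HasDerivWithinAt (fun t : ℝ => -t) (-1) (-S) t := (hasDerivAt_neg t).hasDerivWithinAt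
  have hm : MapsTo (fun t : ℝ => -t) (-S) S := fun s hs => hs
  have e1 := (hasDerivWithinAt_fst h1).comp t hneg hm
  have e2 := ((hasDerivWithinAt_snd h1).comp t hneg hm).fun_neg
  convert! e1.prodMk e2 using 1
  simp [forcedField, reverseForcing, flipVelocity]

theorem separatrix_reverse (h : IsHomoclinic f xe x₀) (t : ℝ) :
    separatrix (fun t => x₀ (-t)) t = flipVelocity (separatrix x₀ (-t)) := by
  simp [separatrix, h.reverse.2, flipVelocity]

theorem flipVelocity_mem_normalSection (h : IsHomoclinic f xe x₀) (hZ : Z ∈ normalSection f x₀) :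
    flipVelocity Z ∈ normalSection f fun t => x₀ (-t) := by
  obtain ⟨s, hs, rfl⟩ := hZ
  refine ⟨s, hs, ?_⟩
  rw [separatrix_reverse h]
  ext
  · simp [flipVelocity]
  · simp [flipVelocity, h.reverse.2]; ring

theorem tendsto_flip_sub {l l' : Filter ℝ} (hl : Tendsto (fun t : ℝ => -t) l' l)
    (h : Tendsto (fun t => z t - p t) l (𝓝 0)) :
    Tendsto (fun t => flipVelocity (z (-t)) - flipVelocity (p (-t))) l' (𝓝 0) := by
  have := (continuous_flipVelocity.tendsto 0).comp (h.comp hl)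
  rw [show flipVelocity 0 = 0 by simp [flipVelocity]] at this
  refine this.congr fun t => ?_
  ext
  · simp [flipVelocity]
  · simp only [flipVelocity, Function.comp, Prod.snd_sub]; ring

theorem IsUnstableCrossing.reverse (h : IsHomoclinic f xe x₀)
    (hZ : IsUnstableCrossing (forcedField f G) p (separatrix x₀) (normalSection f x₀) δ t₀ Z) :
    IsStableCrossing (forcedField f (reverseForcing G)) (fun t => flipVelocity (p (-t)))
      (separatrix fun t => x₀ (-t)) (normalSection f fun t => x₀ (-t)) δ (-t₀)
      (flipVelocity Z) := by
  obtain ⟨h1, z, h2, rfl, h3, h4⟩ := hZ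
  refine ⟨flipVelocity_mem_normalSection h h1, fun t => flipVelocity (z (-t)), ?_, by simp,
    tendsto_flip_sub tendsto_neg_atTop_atBot h3, fun t ht => ?_⟩
  · have := h2.reverse; rwa [neg_Iic] at this
  · rw [separatrix_reverse h, dist_flipVelocity, show -(t - -t₀) = -t - t₀ by ring]
    exact h4 _ (neg_le.1 (mem_Ici.1 ht))

theorem IsStableCrossing.reverse (h : IsHomoclinic f xe x₀)
    (hZ : IsStableCrossing (forcedField f G) p (separatrix x₀) (normalSection f x₀) δ t₀ Z) :
    IsUnstableCrossing (forcedField f (reverseForcing G)) (fun t => flipVelocity (p (-t)))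
      (separatrix fun t => x₀ (-t)) (normalSection f fun t => x₀ (-t)) δ (-t₀)
      (flipVelocity Z) := by
  obtain ⟨h1, z, h2, rfl, h3, h4⟩ := hZ
  refine ⟨flipVelocity_mem_normalSection h h1, fun t => flipVelocity (z (-t)), ?_, by simp,
    tendsto_flip_sub tendsto_neg_atBot_atTop h3, fun t ht => ?_⟩
  · have := h2.reverse; rwa [neg_Ici] at this
  · rw [separatrix_reverse h, dist_flipVelocity, show -(t - -t₀) = -t - t₀ by ring]
    exact h4 _ (le_neg.1 (mem_Iic.1 ht))

theorem IsTrajectoryNear.reverse (h : IsTrajectoryNear (forcedField f G) (xe, 0) δ p) :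
    IsTrajectoryNear (forcedField f (reverseForcing G)) (xe, 0) δ fun t => flipVelocity (p (-t)) := by
  refine ⟨?_, fun t => ?_⟩
  · have := h.1.reverse; rwa [neg_univ] at this
  · have := dist_flipVelocity (p (-t)) (xe, 0)
    rw [show flipVelocity (xe, 0) = (xe, 0) by simp [flipVelocity]] at this
    rw [this]; exact h.2 _

/-- The bounded trajectory, its stable and unstable manifolds, and the Melnikov integral for the
displacement between them. -/
theorem IsHomoclinic.exists_melnikov (h : IsHomoclinic f xe x₀) (hf : ContDiff ℝ 3 f)
    (hxe : IsHyperbolicEquilibrium f xe) :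
    ∃ δ₀ > 0, ∃ Γ R C : ℝ, 0 ≤ Γ ∧ 0 ≤ C ∧ (∀ t, |deriv x₀ t| ≤ R) ∧ ∀ δ, 0 < δ → δ ≤ δ₀ →
      ∀ G η ℓ, IsSmallForcing G R η ℓ → ℓ ≤ δ₀ → Γ * η ≤ δ / 2 →
      (∃! p, IsTrajectoryNear (forcedField f G) (xe, 0) δ p) ∧
      ∀ p, IsTrajectoryNear (forcedField f G) (xe, 0) δ p → ∀ t₀,
      (∃! Z, IsStableCrossing (forcedField f G) p (separatrix x₀) (normalSection f x₀) δ t₀ Z) ∧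
      (∃! Z, IsUnstableCrossing (forcedField f G) p (separatrix x₀) (normalSection f x₀) δ t₀ Z) ∧
      ∀ Zs Zu,
        IsStableCrossing (forcedField f G) p (separatrix x₀) (normalSection f x₀) δ t₀ Zs →
        IsUnstableCrossing (forcedField f G) p (separatrix x₀) (normalSection f x₀) δ t₀ Zu →
        |displacement f x₀ Zu Zs - ∫ τ, deriv x₀ τ * G (t₀ + τ) (x₀ τ) (deriv x₀ τ)| ≤
          C * (η ^ 2 + ℓ * η) := by
  obtain ⟨L, o⟩ := h.exists_decayingOrbit hf hxe
  obtain ⟨δ₁, hδ₁, Γ₁, R₁, C₁, hΓ₁, hC₁, H₁⟩ := h.exists_stable_crossing hf hxe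
  obtain ⟨δ₂, hδ₂, Γ₂, R₂, C₂, hΓ₂, hC₂, H₂⟩ := h.reverse.1.exists_stable_crossing hf hxe
  obtain ⟨δ₃, hδ₃, Γ₃, hΓ₃, H₃⟩ := exists_unique_trajectoryNear hf hxe le_rfl
  refine ⟨min δ₁ (min δ₂ δ₃), by positivity, Γ₁ + Γ₂ + Γ₃, max L (max R₁ (max R₂ 1)), C₁ + C₂,
    by positivity, by positivity, fun t => (o.bV t).trans (le_max_left _ _),
    fun δ hδ hδ₀ G η ℓ hG hℓ hη => ?_⟩
  have r1 : R₁ ≤ max L (max R₁ (max R₂ 1)) := (le_max_left _ _).trans (le_max_right _ _)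
  have r2 : R₂ ≤ max L (max R₁ (max R₂ 1)) :=
    (le_max_left _ _).trans ((le_max_right _ _).trans (le_max_right _ _))
  have r3 : 1 ≤ max L (max R₁ (max R₂ 1)) :=
    (le_max_right _ _).trans ((le_max_right _ _).trans (le_max_right _ _))
  have m1 := min_le_left δ₁ (min δ₂ δ₃)
  have m2 := (min_le_right δ₁ (min δ₂ δ₃)).trans (min_le_left _ _)
  have m3 := (min_le_right δ₁ (min δ₂ δ₃)).trans (min_le_right _ _)
  have hη0 : 0 ≤ η := hG.bound_nonneg (by linarith)
  have g1 := mul_nonneg hΓ₁ hη0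
  have g2 := mul_nonneg hΓ₂ hη0
  have g3 := mul_nonneg hΓ₃ hη0
  rw [add_mul, add_mul] at hη
  refine ⟨H₃ δ hδ (hδ₀.trans m3) G η ℓ (hG.mono r3) (hℓ.trans m3) (by linarith),
    fun p hp t₀ => ?_⟩
  obtain ⟨us, es⟩ := H₁ δ hδ (hδ₀.trans m1) G η ℓ (hG.mono r1) (hℓ.trans m1) (by linarith) p hp t₀
  obtain ⟨uu, eu⟩ := H₂ δ hδ (hδ₀.trans m2) _ η ℓ (hG.reverse.mono r2) (hℓ.trans m2) (by linarith)
    _ hp.reverse (-t₀)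
  refine ⟨us, ?_, fun Zs Zu hs hu => ?_⟩
  · obtain ⟨Z, hZ, hZu⟩ := uu
    refine ⟨flipVelocity Z, ?_, fun Y hY => ?_⟩
    · have := hZ.reverse h.reverse.1
      simpa only [reverseForcing_reverseForcing, neg_neg, flipVelocity_flipVelocity] using this
    · rw [← hZu _ (hY.reverse h), flipVelocity_flipVelocity]
  · have q1 := es Zs hs
    have q2 := eu _ (hu.reverse h)
    set g : ℝ → ℝ := fun τ => deriv x₀ τ * G (t₀ + τ) (x₀ τ) (deriv x₀ τ) with hg
    have hint : Integrable g := by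
      refine o.iV.mul_bdd (c := η) ?_ (Eventually.of_forall fun τ => ?_)
      · exact (hG.cont.comp ((continuous_const.add continuous_id).prodMk
          (h.continuous.prodMk h.continuous_deriv))).aestronglyMeasurable
      · exact hG.bdd _ _ _ ((o.bV τ).trans (le_max_left _ _))
    -- The velocity changes sign under reversal, so the past half of the integral appears with a
    -- minus sign. Subtracting the stable formula from the unstable one therefore adds the two
    -- halves.
    have e1 : ∫ τ in Ioi 0, deriv (fun t => x₀ (-t)) τ *
        reverseForcing G (-t₀ + τ) (x₀ (-τ)) (deriv (fun t => x₀ (-t)) τ) = -∫ τ in Iic 0, g τ := by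
      have e2 := integral_comp_neg_Ioi (0 : ℝ) g
      rw [neg_zero] at e2
      rw [← e2, ← integral_neg]
      congr 1
      funext τ
      simp only [h.reverse.2, reverseForcing, hg, neg_neg]
      rw [show -(-t₀ + τ) = t₀ + -τ by ring]
      ring
    rw [e1] at q2
    simp only [h.reverse.2, flipVelocity, neg_zero] at q2
    have e3 : ∫ τ, g τ = (∫ τ in Iic 0, g τ) + ∫ τ in Ioi 0, g τ := by
      rw [← setIntegral_union (Iic_disjoint_Ioi le_rfl) measurableSet_Ioi hint.integrableOn
        hint.integrableOn, Iic_union_Ioi, setIntegral_univ]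
    rw [e3]
    have e4 : displacement f x₀ Zu Zs - ((∫ τ in Iic 0, g τ) + ∫ τ in Ioi 0, g τ) =
        (-deriv x₀ 0 * (-Zu.2 - -deriv x₀ 0) - f (x₀ 0) * (Zu.1 - x₀ 0) + -∫ τ in Iic 0, g τ) -
        (deriv x₀ 0 * (Zs.2 - deriv x₀ 0) - f (x₀ 0) * (Zs.1 - x₀ 0) + ∫ τ in Ioi 0, g τ) := by
      simp only [displacement]; ring
    rw [e4]
    refine (abs_sub _ _).trans ?_
    linarith

end

/-! ### Contribution of one temporal mode to the Melnikov integral -/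

section

variable {X V W a a1 : ℝ → ℝ} {L : ℝ}

theorem cexp_I_mul_add (x y : ℝ) : Complex.exp (Complex.I * ((x + y : ℝ) : ℂ)) =
    Complex.exp (Complex.I * x) * Complex.exp (Complex.I * y) := by
  rw [← Complex.exp_add]; push_cast; ring_nf

theorem norm_cexp_I_mul (x : ℝ) : ‖Complex.exp (Complex.I * x)‖ = 1 := by
  rw [mul_comm]; exact Complex.norm_exp_ofReal_mul_I x

theorem DecayingOrbit.continuous_X (o : DecayingOrbit X V W a a1 L) : Continuous X :=
  continuous_iff_continuousAt.2 fun t => (o.hX t).continuousAt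

theorem DecayingOrbit.continuous_V (o : DecayingOrbit X V W a a1 L) : Continuous V :=
  continuous_iff_continuousAt.2 fun t => (o.hV t).continuousAt

theorem norm_tsum_sub_le {ι : Type*} {a b : ι → ℂ} {u : ι → ℝ} {s : ℂ} (ha : HasSum a s)
    (hu : Summable u) (h : ∀ i, ‖a i - b i‖ ≤ u i) : Summable b ∧ ‖s - ∑' i, b i‖ ≤ ∑' i, u i := by
  have h1 : Summable fun i => a i - b i := Summable.of_norm_bounded hu h
  have hb : Summable b := by simpa using ha.summable.sub h1
  refine ⟨hb, ?_⟩
  rw [← ha.tsum_eq, ← ha.summable.tsum_sub hb]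
  exact tsum_of_norm_bounded hu.hasSum h

/-- Leading term of the contribution of one temporal mode to the Melnikov integral. -/
theorem DecayingOrbit.exists_mode_expansion (o : DecayingOrbit X V W a a1 L) {g : ℝ × ℝ → ℝ}
    (hg : ContDiff ℝ 3 g) (hper : ∀ y, g (y + (2 * Real.pi, 0)) = g y) {μ c : ℝ} (hμ : μ ≠ 0)
    (hc : 0 < c) (hc1 : c ≤ 1)
    (hU : ∀ k : ℤ, k ≠ 0 → ∀ t, |k * V t + μ| ≤ c → c * |V t| ≤ |W t|) {N : ℕ}
    (T : ℤ → Finset ℝ) (hT : ∀ k : ℤ, k ≠ 0 → ∀ t, t ∈ T k ↔ k * V t + μ = 0)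
    (hN : ∀ k, k ≠ 0 → (T k).card ≤ N) :
    ∃ C, 0 ≤ C ∧ ∀ ε, 0 < ε →
      ‖(∫ s, V s * g (X s / ε, V s) * Complex.exp (Complex.I * (μ * s / ε : ℝ))) -
        ∑' k : {k : ℤ // k ≠ 0}, ∑ t ∈ T k,
          criticalContribution X V W (partialFourier g k) k μ ε t‖ ≤ C * ε := by
  obtain ⟨C1, hC1, H1⟩ := o.oscillatory_integral hc hc1 (abs_pos.2 hμ) N
  obtain ⟨C2, hC2, H2⟩ := o.oscillatory_integral_zero (abs_pos.2 hμ)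
  obtain ⟨B, hB, hB'⟩ := exists_partialFourier_bound hg hper L
  have hsum := summable_const_div_int_pow (C1 * (3 * B)) (p := 2) (by norm_num)
  have hsum0 : Summable fun k : ℤ => if k = 0 then C2 * (B + B) else 0 :=
    (hasSum_ite_eq 0 _).summable
  -- With the decay rates of `q_k` and its two derivatives, each of the three terms `|k| B0`, `B1`
  -- and `B2 / |k|` equals `B / |k|²`. The extra summand accounts for the mean mode.
  set u : ℤ → ℝ := fun k => C1 * (3 * B) / |(k : ℝ)| ^ 2 + if k = 0 then C2 * (B + B) else 0
    with hu
  have husum : Summable u := hsum.add hsum0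
  have hu0 : ∀ k, 0 ≤ u k := fun k => by
    simp only [hu]; split_ifs <;> positivity
  refine ⟨∑' k, u k, tsum_nonneg hu0, fun ε hε => ?_⟩
  have d1 : ContDiff ℝ 1 g := hg.of_le (by norm_num)
  have d2 : ContDiff ℝ 1 (dirDeriv (0, 1) g) :=
    (contDiff_dirDeriv (n := 2) hg _).of_le (by norm_num)
  have d3 : ContDiff ℝ 1 (dirDeriv (0, 1) (dirDeriv (0, 1) g)) :=
    contDiff_dirDeriv (n := 1) (contDiff_dirDeriv (n := 2) hg _) _
  have cQ : ∀ k, Continuous (partialFourier g k) := fun k =>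
    continuous_iff_continuousAt.2 fun v => (hasDerivAt_partialFourier d1 k v).continuousAt
  have cX := o.continuous_X
  have cV := o.continuous_V
  set A : ℤ → ℝ → ℂ := fun k s =>
    V s * partialFourier g k (V s) * Complex.exp (Complex.I * ((k * X s + μ * s) / ε : ℝ)) with hA
  have cA : ∀ k, Continuous (A k) := fun k => by
    have := cQ k
    simp only [hA]
    fun_prop
  have bA : ∀ k s, ‖A k s‖ ≤ |V s| * ‖partialFourier g k (V s)‖ := fun k s => by
    simp only [hA]
    rw [norm_mul, norm_mul, norm_cexp_I_mul, mul_one, Complex.norm_real, Real.norm_eq_abs]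
  have iA : ∀ k, Integrable (A k) := fun k =>
    (o.iV.abs.mul_const B).mono' (cA k).aestronglyMeasurable (Eventually.of_forall fun s =>
      (bA k s).trans (mul_le_mul_of_nonneg_left (hB' k _ (o.bV s)).1.1 (abs_nonneg _)))
  set In := ∫ s, |V s| with hIn
  have hIn0 : 0 ≤ In := integral_nonneg fun s => abs_nonneg _
  have sA : Summable fun k => ∫ s, ‖A k s‖ := by
    refine Summable.of_nonneg_of_le (fun k => integral_nonneg fun s => norm_nonneg _) (fun k => ?_)
      ((summable_const_div_int_pow (In * B) (p := 3) (by norm_num)).add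
        (hasSum_ite_eq (0 : ℤ) (In * B)).summable)
    by_cases hk : k = 0
    · rw [if_pos hk]
      refine le_trans ?_ (le_add_of_nonneg_left (by positivity))
      rw [hIn, ← integral_mul_const]
      exact integral_mono (iA k).norm (o.iV.abs.mul_const B) fun s =>
        (bA k s).trans (mul_le_mul_of_nonneg_left (hB' k _ (o.bV s)).1.1 (abs_nonneg _))
    · rw [if_neg hk, add_zero, mul_div_assoc, hIn, ← integral_mul_const]
      exact integral_mono (iA k).norm (o.iV.abs.mul_const _) fun s =>
        (bA k s).trans (mul_le_mul_of_nonneg_left ((hB' k _ (o.bV s)).2 hk).1 (abs_nonneg _))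
  have hs := hasSum_integral_of_summable_integral_norm iA sA
  have htsum : ∀ s, ∑' k, A k s =
      V s * g (X s / ε, V s) * Complex.exp (Complex.I * (μ * s / ε : ℝ)) := fun s => by
    have := ((hasSum_partialFourier hg hper (X s / ε) (V s)).mul_left (V s : ℂ)).mul_right
      (Complex.exp (Complex.I * (μ * s / ε : ℝ)))
    rw [← this.tsum_eq]
    congr 1
    funext k
    simp only [hA]
    rw [add_div, cexp_I_mul_add]
    have : Complex.exp (Complex.I * ((k * X s / ε : ℝ) : ℂ)) =
        Complex.exp (Complex.I * k * ((X s / ε : ℝ) : ℂ)) := by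
      congr 1; push_cast; ring
    rw [this]; ring
  simp only [htsum] at hs
  -- The mean mode has no stationary point and is pure error, so its leading term is set to `0`.
  set b : ℤ → ℂ := ({k | k ≠ 0} : Set ℤ).indicator fun k =>
    ∑ t ∈ T k, criticalContribution X V W (partialFourier g k) k μ ε t with hb
  obtain ⟨-, hfin⟩ := norm_tsum_sub_le (b := b) hs (husum.mul_left ε) (fun k => by
    by_cases hk : k = 0
    · have h1 := H2 μ le_rfl _ _ B B (hasDerivAt_partialFourier d1 k)
        (continuous_iff_continuousAt.2 fun v => (hasDerivAt_partialFourier d2 k v).continuousAt)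
        (fun v hv => (hB' k v hv).1.1) (fun v hv => (hB' k v hv).1.2) ε hε
      rw [hb, indicator_of_notMem (by simpa using hk), sub_zero]
      simp only [hu, if_pos hk]
      refine le_trans (le_of_eq ?_) (h1.trans (mul_le_mul_of_nonneg_left
        (le_add_of_nonneg_left (by positivity)) hε.le))
      simp only [hA, hk, Int.cast_zero, zero_mul, zero_add]
    · have hk1 : (1 : ℝ) ≤ |(k : ℝ)| := by exact_mod_cast Int.one_le_abs hk
      have hk0 : |(k : ℝ)| ≠ 0 := by positivity
      have h1 := H1 k μ hk1 le_rfl (hU k hk) (T k) (hT k hk) (hN k hk) _ _ _ _ _ _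
        (hasDerivAt_partialFourier d1 k) (hasDerivAt_partialFourier d2 k)
        (fun v hv => ((hB' k v hv).2 hk).1) (fun v hv => ((hB' k v hv).2 hk).2.1)
        (fun v hv => ((hB' k v hv).2 hk).2.2) ε hε
      rw [hb, indicator_of_mem (by simpa using hk)]
      simp only [hu, if_neg hk, add_zero]
      refine h1.trans_eq ?_
      field_simp
      ring)
  rw [hb, ← tsum_subtype, tsum_mul_left, mul_comm] at hfin
  exact hfin

/-- The contribution of a stationary point in terms of its amplitude. -/
theorem criticalContribution_eq {Q : ℝ → ℂ} {k μ ε t : ℝ} (hk : k ≠ 0) (hε : 0 < ε)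
    (ht : V t = -μ / k) :
    criticalContribution X V W Q k μ ε t = √(2 * Real.pi) * √ε *
      (-(μ : ℂ) * Q (-μ / k) * Complex.exp (Complex.I * (Real.sign (k * W t) * Real.pi / 4 : ℝ)) /
        ((k * √|k| * √|W t| : ℝ) : ℂ) * Complex.exp (Complex.I * ((k * X t + μ * t) / ε : ℝ))) := by
  have h1 : Real.sign (k * W t / ε) = Real.sign (k * W t) := by
    rcases lt_trichotomy (k * W t) 0 with h | h | h
    · rw [Real.sign_of_neg h, Real.sign_of_neg (div_neg_of_neg_of_pos h hε)]
    · rw [h, zero_div]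
    · rw [Real.sign_of_pos h, Real.sign_of_pos (div_pos h hε)]
  have h2 : √(2 * Real.pi / |k * W t / ε|) = √(2 * Real.pi) * √ε / (√|k| * √|W t|) := by
    rw [abs_div, abs_of_pos hε, abs_mul, div_div_eq_mul_div, Real.sqrt_div (by positivity),
      Real.sqrt_mul (by positivity), Real.sqrt_mul (abs_nonneg _)]
  rw [criticalContribution, h1, h2, ht]
  have hk' : (k : ℂ) ≠ 0 := Complex.ofReal_ne_zero.2 hk
  push_cast
  generalize (√|k| : ℂ) = x
  ring_nf

end

/-! ### The quasi-periodic perturbation -/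

section

variable {q : ℝ → ℝ → ℝ → ℝ}

/-- Bounds and Lipschitz constants of `q`, uniform in the fast variable. -/
theorem exists_uniform_bounds
    (hq_per : ∀ ξ v ε, 0 ≤ ε → q (ξ + 2 * Real.pi) v ε = q ξ v ε)
    (hq_C1 : ContDiffOn ℝ 1 (fun y : ℝ × ℝ × ℝ => q y.1 y.2.1 y.2.2) {y | 0 ≤ y.2.2}) (R : ℝ) :
    ∃ B, 0 ≤ B ∧ ∀ ε, 0 ≤ ε → ε ≤ 1 → ∀ ξ v, |v| ≤ R → |q ξ v ε| ≤ B ∧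
      |q ξ v ε - q ξ v 0| ≤ B * ε ∧
      ∀ ξ' v', |v'| ≤ R → |q ξ v ε - q ξ' v' ε| ≤ B * ‖((ξ, v) : ℝ × ℝ) - (ξ', v')‖ := by
  have hpi : 0 < 2 * Real.pi := by positivity
  have hper : ∀ v ε, 0 ≤ ε → ∀ n : ℤ, ∀ ξ, q (ξ - n * (2 * Real.pi)) v ε = q ξ v ε :=
    fun v ε hε n ξ => by
      have : Function.Periodic (fun ξ => q ξ v ε) (2 * Real.pi) := fun ξ => hq_per ξ v ε hε
      exact this.sub_int_mul_eq n
  -- Wider than one period: after a translation that brings `ξ` into `[0, 2π)`, any `ξ'` within `2π`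
  -- of it is still covered.
  set S : Set (ℝ × ℝ × ℝ) :=
    Icc (-(2 * Real.pi)) (2 * (2 * Real.pi)) ×ˢ (Icc (-R) R ×ˢ Icc 0 1) with hS
  have hSc : IsCompact S := isCompact_Icc.prod (isCompact_Icc.prod isCompact_Icc)
  have hSv : Convex ℝ S := (convex_Icc _ _).prod ((convex_Icc _ _).prod (convex_Icc _ _))
  have hq : ContDiffOn ℝ 1 (fun y : ℝ × ℝ × ℝ => q y.1 y.2.1 y.2.2) S :=
    hq_C1.mono fun y hy => hy.2.2.1
  obtain ⟨K, hK⟩ := hq.exists_lipschitzOnWith one_ne_zero hSv hSc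
  obtain ⟨B, hB⟩ := hSc.exists_bound_of_continuousOn hq.continuousOn
  have red : ∀ ξ, ∃ n : ℤ, ξ - n * (2 * Real.pi) ∈ Ico 0 (2 * Real.pi) := fun ξ => by
    refine ⟨⌊ξ / (2 * Real.pi)⌋, ?_, ?_⟩
    · have := Int.floor_le (ξ / (2 * Real.pi))
      rw [le_div_iff₀ hpi] at this
      linarith
    · have := Int.lt_floor_add_one (ξ / (2 * Real.pi))
      rw [div_lt_iff₀ hpi] at this
      linarith
  have bq : ∀ ε, 0 ≤ ε → ε ≤ 1 → ∀ ξ v, |v| ≤ R → |q ξ v ε| ≤ max B 0 :=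
    fun ε h0 h1 ξ v hv => by
      obtain ⟨n, hn⟩ := red ξ
      rw [← hper v ε h0 n ξ]
      exact (hB (ξ - n * (2 * Real.pi), v, ε)
        ⟨⟨by linarith [hn.1], by linarith [hn.2]⟩, abs_le.1 hv, h0, h1⟩).trans (le_max_left _ _)
  have hB0 : 0 ≤ max B 0 := le_max_right _ _
  refine ⟨max B 0 + K, by positivity, fun ε h0 h1 ξ v hv => ⟨?_, ?_, fun ξ' v' hv' => ?_⟩⟩
  · exact (bq ε h0 h1 ξ v hv).trans (le_add_of_nonneg_right K.2)
  · obtain ⟨n, hn⟩ := red ξ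
    rw [← hper v ε h0 n ξ, ← hper v 0 le_rfl n ξ]
    have hm : ξ - n * (2 * Real.pi) ∈ Icc (-(2 * Real.pi)) (2 * (2 * Real.pi)) :=
      ⟨by linarith [hn.1], by linarith [hn.2]⟩
    have := hK.dist_le_mul (ξ - n * (2 * Real.pi), v, ε) ⟨hm, abs_le.1 hv, h0, h1⟩
      (ξ - n * (2 * Real.pi), v, 0) ⟨hm, abs_le.1 hv, le_rfl, zero_le_one⟩
    simp only [Prod.dist_eq, dist_self, Real.dist_eq, sub_zero] at this
    rw [abs_of_nonneg h0, max_eq_right h0, max_eq_right h0] at this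
    refine this.trans (mul_le_mul_of_nonneg_right (le_add_of_nonneg_left hB0) h0)
  · obtain ⟨n, hn⟩ := red ξ
    have hnorm : |ξ - ξ'| ≤ ‖((ξ, v) : ℝ × ℝ) - (ξ', v')‖ := norm_fst_le (((ξ, v) : ℝ × ℝ) - (ξ', v'))
    rcases le_total |ξ - ξ'| (2 * Real.pi) with hle | hle
    · rw [← hper v ε h0 n ξ, ← hper v' ε h0 n ξ']
      have h2 := abs_le.1 hle
      have := hK.dist_le_mul (ξ - n * (2 * Real.pi), v, ε)
        ⟨⟨by linarith [hn.1], by linarith [hn.2]⟩, abs_le.1 hv, h0, h1⟩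
        (ξ' - n * (2 * Real.pi), v', ε)
        ⟨⟨by linarith [hn.1], by linarith [hn.2]⟩, abs_le.1 hv', h0, h1⟩
      simp only [Prod.dist_eq, dist_self, Real.dist_eq, sub_sub_sub_cancel_right] at this
      rw [max_eq_left (abs_nonneg (v - v'))] at this
      refine this.trans ?_
      exact mul_le_mul_of_nonneg_right (le_add_of_nonneg_left hB0)
        (le_max_of_le_left (abs_nonneg _))
    -- For distant arguments the sup bound alone gives the Lipschitz estimate.
    · have h3 : (2 : ℝ) ≤ ‖((ξ, v) : ℝ × ℝ) - (ξ', v')‖ := by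
        have := Real.pi_gt_three
        linarith
      calc |q ξ v ε - q ξ' v' ε| ≤ |q ξ v ε| + |q ξ' v' ε| := abs_sub _ _
        _ ≤ max B 0 * 2 := by linarith [bq ε h0 h1 ξ v hv, bq ε h0 h1 ξ' v' hv']
        _ ≤ (max B 0 + K) * ‖((ξ, v) : ℝ × ℝ) - (ξ', v')‖ :=
          mul_le_mul (le_add_of_nonneg_right K.2) h3 (by norm_num) (by positivity)

end

section

variable {n : ℕ} {F : (Fin n → ℝ) → ℝ} {modes : Finset (Fin n → ℤ)} {Fc : (Fin n → ℤ) → ℂ}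

theorem abs_trigPolynomial_le (hF : ∀ θ : Fin n → ℝ,
      (F θ : ℂ) = ∑ m ∈ modes, Fc m * Complex.exp (Complex.I * idot m θ)) (θ : Fin n → ℝ) :
    |F θ| ≤ ∑ m ∈ modes, ‖Fc m‖ := by
  rw [← Real.norm_eq_abs, ← Complex.norm_real, hF]
  refine (norm_sum_le _ _).trans (Finset.sum_le_sum fun m _ => ?_)
  rw [norm_mul, norm_cexp_I_mul, mul_one]

theorem continuous_trigPolynomial (hF : ∀ θ : Fin n → ℝ,
      (F θ : ℂ) = ∑ m ∈ modes, Fc m * Complex.exp (Complex.I * idot m θ)) : Continuous F := by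
  have h : F = fun θ => (∑ m ∈ modes, Fc m * Complex.exp (Complex.I * idot m θ)).re := by
    funext θ; rw [← hF, Complex.ofReal_re]
  rw [h]
  unfold idot
  fun_prop

theorem idot_rescale (m : Fin n → ℤ) (ω : Fin n → ℝ) (t ε : ℝ) :
    idot m (fun i => ω i * t / ε) = idot m ω * t / ε := by
  simp only [idot]
  rw [Finset.sum_mul, Finset.sum_div]
  exact Finset.sum_congr rfl fun i _ => by ring

/-- Because `x` enters through `x / ε`, the Lipschitz constant is one power of `ε` worse than the
sup bound. This loss determines the size of the quadratic error in the displacement. -/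
theorem isSmallForcing_perturbation {q : ℝ → ℝ → ℝ → ℝ} {ω : Fin n → ℝ} {r ε R B : ℝ}
    (hε : 0 < ε) (hε1 : ε ≤ 1) (hB0 : 0 ≤ B)
    (hB : ∀ ξ v, |v| ≤ R → |q ξ v ε| ≤ B ∧
      ∀ ξ' v', |v'| ≤ R → |q ξ v ε - q ξ' v' ε| ≤ B * ‖((ξ, v) : ℝ × ℝ) - (ξ', v')‖)
    (hq : Continuous fun y : ℝ × ℝ => q y.1 y.2 ε)
    (hF : ∀ θ : Fin n → ℝ,
      (F θ : ℂ) = ∑ m ∈ modes, Fc m * Complex.exp (Complex.I * idot m θ)) :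
    IsSmallForcing (fun t x v => ε ^ r * perturbation q F ω ε x v t) R
      (B * (∑ m ∈ modes, ‖Fc m‖) * ε ^ r) (B * (∑ m ∈ modes, ‖Fc m‖) * ε ^ (r - 1)) := by
  set Φ := ∑ m ∈ modes, ‖Fc m‖ with hΦ
  have hΦ0 : 0 ≤ Φ := Finset.sum_nonneg fun m _ => norm_nonneg _
  have hr := Real.rpow_pos_of_pos hε r
  have hr1 := Real.rpow_pos_of_pos hε (r - 1)
  have hF' := abs_trigPolynomial_le hF
  refine ⟨?_, by positivity, fun t x v hv => ?_, fun t x v x' v' hv hv' => ?_⟩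
  · have cF := continuous_trigPolynomial hF
    have c1 : Continuous fun p : ℝ × ℝ × ℝ => q (p.2.1 / ε) p.2.2 ε :=
      hq.comp (by fun_prop : Continuous fun p : ℝ × ℝ × ℝ => (p.2.1 / ε, p.2.2))
    have c2 : Continuous fun p : ℝ × ℝ × ℝ => F fun i => ω i * p.1 / ε := by fun_prop
    exact continuous_const.mul (c1.mul c2)
  · rw [abs_mul, abs_of_pos hr, perturbation, abs_mul, mul_comm]
    exact mul_le_mul_of_nonneg_right (mul_le_mul (hB _ v hv).1 (hF' _) (abs_nonneg _) hB0) hr.le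
  · have h1 := (hB (x / ε) v hv).2 (x' / ε) v' hv'
    have h2 : ‖((x / ε, v) : ℝ × ℝ) - (x' / ε, v')‖ ≤ ‖((x, v) : ℝ × ℝ) - (x', v')‖ / ε := by
      refine max_le ?_ ?_
      · simp only [Prod.fst_sub, Real.norm_eq_abs]
        rw [← sub_div, abs_div, abs_of_pos hε]
        exact div_le_div_of_nonneg_right (norm_fst_le (((x, v) : ℝ × ℝ) - (x', v'))) hε.le
      · refine (norm_snd_le (((x, v) : ℝ × ℝ) - (x', v'))).trans ?_
        rw [le_div_iff₀ hε]
        exact mul_le_of_le_one_right (norm_nonneg _) hε1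
    rw [← mul_sub, perturbation, perturbation, ← sub_mul, abs_mul, abs_mul, abs_of_pos hr]
    calc ε ^ r * (|q (x / ε) v ε - q (x' / ε) v' ε| * |F fun i => ω i * t / ε|)
        ≤ ε ^ r * ((B * (‖((x, v) : ℝ × ℝ) - (x', v')‖ / ε)) * Φ) :=
          mul_le_mul_of_nonneg_left (mul_le_mul (h1.trans (mul_le_mul_of_nonneg_left h2 hB0))
            (hF' _) (abs_nonneg _) (by positivity)) hr.le
      _ = B * Φ * ε ^ (r - 1) * ‖((x, v) : ℝ × ℝ) - (x', v')‖ := by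
          rw [Real.rpow_sub_one hε.ne']; ring

end

/-! ### Expansion of the full Melnikov integral -/

section

variable {n : ℕ} {f : ℝ → ℝ} {x₀ a a1 : ℝ → ℝ} {L : ℝ} {q : ℝ → ℝ → ℝ → ℝ} {ω : Fin n → ℝ}
  {F : (Fin n → ℝ) → ℝ} {modes : Finset (Fin n → ℤ)} {Fc : (Fin n → ℤ) → ℂ}

theorem mem_critSet {k : ℤ} (hk : k ≠ 0) {m : Fin n → ℤ} {t : ℝ} :
    t ∈ critSet x₀ ω k m ↔ k * deriv x₀ t + idot m ω = 0 := by
  have hk' : (k : ℝ) ≠ 0 := Int.cast_ne_zero.2 hk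
  change deriv x₀ t = -idot m ω / k ↔ _
  rw [eq_div_iff hk', mul_comm, eq_neg_iff_add_eq_zero]

/-- The leading term of one temporal mode in terms of the stationary points. -/
theorem exists_stationarySum_expansion
    (o : DecayingOrbit x₀ (deriv x₀) (fun t => f (x₀ t)) a a1 L)
    (hq_per : ∀ ξ v, q (ξ + 2 * Real.pi) v 0 = q ξ v 0)
    (hq_C3 : ContDiff ℝ 3 (fun y : ℝ × ℝ => q y.1 y.2 0)) {m : Fin n → ℤ} (hμ : idot m ω ≠ 0)
    {c : ℝ} (hc : 0 < c) (hc1 : c ≤ 1)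
    (hU : ∀ k : ℤ, k ≠ 0 → ∀ t, |k * deriv x₀ t + idot m ω| ≤ c → c * |deriv x₀ t| ≤ |f (x₀ t)|)
    {N : ℕ} (hcrit : ∀ k : ℤ, k ≠ 0 → (critSet x₀ ω k m).Finite ∧ (critSet x₀ ω k m).ncard ≤ N)
    (Fc : (Fin n → ℤ) → ℂ) :
    ∃ C, 0 ≤ C ∧ ∀ ε, 0 < ε →
      ‖Fc m * (∫ s, deriv x₀ s * q (x₀ s / ε) (deriv x₀ s) 0 *
          Complex.exp (Complex.I * (idot m ω * s / ε : ℝ))) -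
        √(2 * Real.pi) * √ε * stationarySum f x₀ q ω Fc ε m‖ ≤ C * ε := by
  have hT : ∀ k : ℤ, ∃ T : Finset ℝ, k ≠ 0 → (T : Set ℝ) = critSet x₀ ω k m := fun k => by
    by_cases hk : k = 0
    · exact ⟨∅, fun h => absurd hk h⟩
    · exact ⟨(hcrit k hk).1.toFinset, fun _ => (hcrit k hk).1.coe_toFinset⟩
  choose T hT using hT
  obtain ⟨C, hC, H⟩ := o.exists_mode_expansion (g := fun y => q y.1 y.2 0) hq_C3
    (fun y => by simpa using hq_per y.1 y.2) hμ hc hc1 hU T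
    (fun k hk t => by rw [← mem_critSet hk, ← hT k hk, Finset.mem_coe])
    (fun k hk => by
      have := (hcrit k hk).2
      rwa [← hT k hk, ncard_coe_finset] at this)
  refine ⟨‖Fc m‖ * C, by positivity, fun ε hε => ?_⟩
  have e : √(2 * Real.pi) * √ε * stationarySum f x₀ q ω Fc ε m =
      Fc m * ∑' k : {k : ℤ // k ≠ 0}, ∑ t ∈ T k, criticalContribution x₀ (deriv x₀)
        (fun t => f (x₀ t)) (partialFourier (fun y => q y.1 y.2 0) k) k (idot m ω) ε t := by
    rw [stationarySum, mul_left_comm, ← tsum_mul_left]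
    congr 2
    funext k
    rw [← hT k k.2, finsum_mem_coe_finset, Finset.mul_sum]
    refine Finset.sum_congr rfl fun t ht => ?_
    have ht' : deriv x₀ t = -idot m ω / (k : ℤ) := by
      have : t ∈ critSet x₀ ω k m := by rw [← hT k k.2]; exact ht
      exact this
    rw [criticalContribution_eq (Int.cast_ne_zero.2 k.2) hε ht']
    rfl
  rw [e, ← mul_sub, norm_mul, mul_assoc]
  exact mul_le_mul_of_nonneg_left (H ε hε) (norm_nonneg _)

/-- The series of the amplitudes converges absolutely. -/
theorem summable_amplitude
    (o : DecayingOrbit x₀ (deriv x₀) (fun t => f (x₀ t)) a a1 L)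
    (hq_per : ∀ ξ v, q (ξ + 2 * Real.pi) v 0 = q ξ v 0)
    (hq_C3 : ContDiff ℝ 3 (fun y : ℝ × ℝ => q y.1 y.2 0)) {m : Fin n → ℤ} (hμ : idot m ω ≠ 0)
    {c : ℝ} (hc : 0 < c)
    (hU : ∀ k : ℤ, k ≠ 0 → ∀ t, |k * deriv x₀ t + idot m ω| ≤ c → c * |deriv x₀ t| ≤ |f (x₀ t)|)
    {N : ℕ} (hcrit : ∀ k : ℤ, k ≠ 0 → (critSet x₀ ω k m).Finite ∧ (critSet x₀ ω k m).ncard ≤ N) :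
    Summable fun k : {k : ℤ // k ≠ 0} =>
      ∑ᶠ t ∈ critSet x₀ ω k m, ‖amplitude f x₀ q ω k m t‖ := by
  obtain ⟨B, hB, hB'⟩ := exists_partialFourier_bound (g := fun y => q y.1 y.2 0) hq_C3
    (fun y => by simpa using hq_per y.1 y.2) L
  set μ := idot m ω with hμd
  have hμ0 := abs_pos.2 hμ
  set A := |μ| * B / √(c * |μ|) with hA
  have hA0 : 0 ≤ A := by positivity
  have bound : ∀ k : ℤ, k ≠ 0 → ∀ t ∈ critSet x₀ ω k m,
      ‖amplitude f x₀ q ω k m t‖ ≤ A / |(k : ℝ)| ^ 3 := fun k hk t ht => by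
    have hk' : (k : ℝ) ≠ 0 := Int.cast_ne_zero.2 hk
    have hk1 : (1 : ℝ) ≤ |(k : ℝ)| := by exact_mod_cast Int.one_le_abs hk
    have hV : deriv x₀ t = -μ / k := ht
    have h1 : c * |deriv x₀ t| ≤ |f (x₀ t)| := hU k hk t (by
      rw [(mem_critSet hk).1 ht, abs_zero]; exact hc.le)
    -- At a critical point `|V| = |μ| / |k|`, so nondegeneracy bounds `|k| |f(x₀)|` below uniformly
    -- in `k`: the denominators stay away from `0` even where `f(x₀)` itself is small.
    have h2 : c * |μ| ≤ |(k : ℝ)| * |f (x₀ t)| := by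
      rw [hV, abs_div, abs_neg] at h1
      calc c * |μ| = |(k : ℝ)| * (c * (|μ| / |(k : ℝ)|)) := by field_simp
        _ ≤ _ := mul_le_mul_of_nonneg_left h1 (abs_nonneg _)
    have h3 : √(c * |μ|) ≤ √|(k : ℝ)| * √|f (x₀ t)| := by
      rw [← Real.sqrt_mul (abs_nonneg _)]; exact Real.sqrt_le_sqrt h2
    have h4 : 0 < √(c * |μ|) := Real.sqrt_pos.2 (by positivity)
    have h5 : ‖fourierCoeffQ q k (-μ / k)‖ ≤ B / |(k : ℝ)| ^ 3 :=
      ((hB' k (-μ / k) (by rw [← hV]; exact o.bV t)).2 hk).1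
    rw [amplitude, norm_div, norm_mul, norm_mul, norm_neg, norm_cexp_I_mul, mul_one,
      Complex.norm_real, Complex.norm_real, Real.norm_eq_abs, Real.norm_eq_abs, mul_assoc (k : ℝ),
      abs_mul (k : ℝ), abs_of_nonneg (by positivity : 0 ≤ √|(k : ℝ)| * √|f (x₀ t)|)]
    calc |μ| * ‖fourierCoeffQ q k (-μ / k)‖ / (|(k : ℝ)| * (√|(k : ℝ)| * √|f (x₀ t)|))
        ≤ |μ| * (B / |(k : ℝ)| ^ 3) / (1 * √(c * |μ|)) := by
          refine div_le_div₀ (by positivity) (mul_le_mul_of_nonneg_left h5 (abs_nonneg _))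
            (by positivity) (mul_le_mul hk1 h3 h4.le (abs_nonneg _))
      _ = A / |(k : ℝ)| ^ 3 := by rw [hA]; field_simp
  refine Summable.of_nonneg_of_le (fun k => finsum_nonneg fun t => finsum_nonneg fun _ => norm_nonneg _)
    (fun k => ?_) (((summable_const_div_int_pow (N * A) (p := 3) (by norm_num))).subtype _)
  obtain ⟨hfin, hcard⟩ := hcrit k k.2
  rw [finsum_mem_eq_finite_toFinset_sum _ hfin]
  refine (Finset.sum_le_card_nsmul _ _ _ fun t ht =>
    bound k k.2 t (hfin.mem_toFinset.1 ht)).trans ?_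
  rw [← ncard_eq_toFinset_card _ hfin, nsmul_eq_mul, Function.comp, mul_div_assoc]
  exact mul_le_mul_of_nonneg_right (by exact_mod_cast hcard) (by positivity)

/-- Expansion of the Melnikov integral. -/
theorem exists_melnikov_expansion
    (o : DecayingOrbit x₀ (deriv x₀) (fun t => f (x₀ t)) a a1 L)
    (hq_per : ∀ ξ v ε, 0 ≤ ε → q (ξ + 2 * Real.pi) v ε = q ξ v ε)
    (hq_C3 : ∀ ε, 0 ≤ ε → ContDiff ℝ 3 (fun y : ℝ × ℝ => q y.1 y.2 ε))
    (hq_C1 : ContDiffOn ℝ 1 (fun y : ℝ × ℝ × ℝ => q y.1 y.2.1 y.2.2) {y | 0 ≤ y.2.2})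
    (hF : ∀ θ : Fin n → ℝ,
      (F θ : ℂ) = ∑ m ∈ modes, Fc m * Complex.exp (Complex.I * idot m θ))
    (hμ : ∀ m ∈ modes, idot m ω ≠ 0) {c : ℝ} (hc : 0 < c) (hc1 : c ≤ 1)
    (hU : ∀ m ∈ modes, ∀ k : ℤ, k ≠ 0 → ∀ t, |k * deriv x₀ t + idot m ω| ≤ c →
      c * |deriv x₀ t| ≤ |f (x₀ t)|)
    {N : ℕ} (hcrit : ∀ m ∈ modes, ∀ k : ℤ, k ≠ 0 →
      (critSet x₀ ω k m).Finite ∧ (critSet x₀ ω k m).ncard ≤ N) (r : ℝ) :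
    ∃ C, 0 ≤ C ∧ ∀ ε, 0 < ε → ε ≤ 1 → ∀ t₀,
      |(∫ τ, deriv x₀ τ * (ε ^ r * perturbation q F ω ε (x₀ τ) (deriv x₀ τ) (t₀ + τ))) -
        leadingTerm f x₀ q ω modes Fc r ε t₀| ≤ C * ε ^ (r + 1) := by
  obtain ⟨B, hB0, hB⟩ := exists_uniform_bounds hq_per hq_C1 L
  have hmode : ∀ m, ∃ C, 0 ≤ C ∧ (m ∈ modes → ∀ ε, 0 < ε →
      ‖Fc m * (∫ s, deriv x₀ s * q (x₀ s / ε) (deriv x₀ s) 0 *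
          Complex.exp (Complex.I * (idot m ω * s / ε : ℝ))) -
        √(2 * Real.pi) * √ε * stationarySum f x₀ q ω Fc ε m‖ ≤ C * ε) := fun m => by
    by_cases hm : m ∈ modes
    · obtain ⟨C, hC, H⟩ := exists_stationarySum_expansion o (fun ξ v => hq_per ξ v 0 le_rfl)
        (hq_C3 0 le_rfl) (hμ m hm) hc hc1 (hU m hm) (hcrit m hm) Fc
      exact ⟨C, hC, fun _ => H⟩
    · exact ⟨0, le_rfl, fun h => absurd h hm⟩
  choose D hD0 hD using hmode
  set Φ := ∑ m ∈ modes, ‖Fc m‖ with hΦ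
  have hΦ0 : 0 ≤ Φ := Finset.sum_nonneg fun m _ => norm_nonneg _
  set In := ∫ τ, |deriv x₀ τ| with hIn
  have hIn0 : 0 ≤ In := integral_nonneg fun _ => abs_nonneg _
  have hDs : 0 ≤ ∑ m ∈ modes, D m := Finset.sum_nonneg fun m _ => hD0 m
  refine ⟨In * (B * Φ) + ∑ m ∈ modes, D m, by positivity, fun ε hε hε1 t₀ => ?_⟩
  have hr := Real.rpow_pos_of_pos hε r
  have hF' := abs_trigPolynomial_le hF
  have cF := continuous_trigPolynomial hF
  have cx := o.continuous_X
  have cv := o.continuous_V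
  have hint : ∀ e, 0 ≤ e → e ≤ 1 → Integrable fun τ =>
      deriv x₀ τ * (q (x₀ τ / ε) (deriv x₀ τ) e * F fun i => ω i * (t₀ + τ) / ε) :=
    fun e he he1 => by
      refine o.iV.mul_bdd (c := B * Φ) ?_ (Eventually.of_forall fun τ => ?_)
      · have c1 : Continuous fun τ => q (x₀ τ / ε) (deriv x₀ τ) e :=
          (hq_C3 e he).continuous.comp (by fun_prop : Continuous fun τ => (x₀ τ / ε, deriv x₀ τ))
        have c2 : Continuous fun τ => F fun i => ω i * (t₀ + τ) / ε := by fun_prop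
        exact (c1.mul c2).aestronglyMeasurable
      · rw [Real.norm_eq_abs, abs_mul]
        exact mul_le_mul (hB e he he1 _ _ (o.bV τ)).1 (hF' _) (abs_nonneg _) hB0
  set I₁ := ∫ τ, deriv x₀ τ * (q (x₀ τ / ε) (deriv x₀ τ) ε * F fun i => ω i * (t₀ + τ) / ε)
    with hI₁
  set I₀ := ∫ τ, deriv x₀ τ * (q (x₀ τ / ε) (deriv x₀ τ) 0 * F fun i => ω i * (t₀ + τ) / ε)
    with hI₀
  -- Freezing the last argument of `q` at `0` costs one power of `ε`, by the `C¹` dependence on `ε`.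
  have h1 : |I₁ - I₀| ≤ In * (B * Φ) * ε := by
    rw [hI₁, hI₀, ← integral_sub (hint ε hε.le hε1) (hint 0 le_rfl zero_le_one), mul_assoc, hIn,
      ← integral_mul_const, ← Real.norm_eq_abs]
    refine norm_integral_le_of_norm_le (o.iV.abs.mul_const _) (Eventually.of_forall fun τ => ?_)
    rw [← mul_sub, ← sub_mul, Real.norm_eq_abs, abs_mul, abs_mul]
    refine mul_le_mul_of_nonneg_left ?_ (abs_nonneg _)
    calc _ ≤ B * ε * Φ := mul_le_mul (hB ε hε.le hε1 _ _ (o.bV τ)).2.1 (hF' _) (abs_nonneg _)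
          (by positivity)
      _ = _ := by ring
  set J : (Fin n → ℤ) → ℂ := fun m => ∫ s, deriv x₀ s * q (x₀ s / ε) (deriv x₀ s) 0 *
    Complex.exp (Complex.I * (idot m ω * s / ε : ℝ)) with hJ
  have hJint : ∀ m : Fin n → ℤ, Integrable fun s : ℝ =>
      ((deriv x₀ s : ℝ) : ℂ) * q (x₀ s / ε) (deriv x₀ s) 0 *
        Complex.exp (Complex.I * (idot m ω * s / ε : ℝ)) := fun m => by
    refine (o.iV.abs.mul_const B).mono' ?_ (Eventually.of_forall fun s => ?_)
    · have c1 : Continuous fun τ => q (x₀ τ / ε) (deriv x₀ τ) 0 :=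
        (hq_C3 0 le_rfl).continuous.comp
          (by fun_prop : Continuous fun τ => (x₀ τ / ε, deriv x₀ τ))
      exact (((Complex.continuous_ofReal.comp cv).mul (Complex.continuous_ofReal.comp c1)).mul
        (by fun_prop)).aestronglyMeasurable
    · rw [norm_mul, norm_mul, norm_cexp_I_mul, mul_one, Complex.norm_real, Complex.norm_real]
      exact mul_le_mul_of_nonneg_left (hB 0 le_rfl zero_le_one _ _ (o.bV s)).1 (abs_nonneg _)
  -- The time shift `t₀` factors out of each mode as a phase of modulus one, which makes the
  -- remainder uniform in `t₀`.
  have h2 : (I₀ : ℂ) = ∑ m ∈ modes,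
      Complex.exp (Complex.I * (idot m ω * t₀ / ε : ℝ)) * (Fc m * J m) := by
    rw [hI₀, ← integral_complex_ofReal]
    have : ∀ m ∈ modes, Complex.exp (Complex.I * (idot m ω * t₀ / ε : ℝ)) * (Fc m * J m) =
        ∫ s : ℝ, Complex.exp (Complex.I * (idot m ω * t₀ / ε : ℝ)) * Fc m *
          (((deriv x₀ s : ℝ) : ℂ) * q (x₀ s / ε) (deriv x₀ s) 0 *
            Complex.exp (Complex.I * (idot m ω * s / ε : ℝ))) := fun m _ => by
      rw [hJ, ← mul_assoc, ← integral_const_mul]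
    rw [Finset.sum_congr rfl this, ← integral_finsetSum _ fun m _ => (hJint m).const_mul _]
    congr 1
    funext s
    push_cast
    rw [hF, Finset.mul_sum, Finset.mul_sum]
    refine Finset.sum_congr rfl fun m _ => ?_
    rw [idot_rescale, mul_add, add_div, cexp_I_mul_add]
    push_cast
    ring
  set S : (Fin n → ℤ) → ℂ := fun m => stationarySum f x₀ q ω Fc ε m with hS
  set trig := ∑ m ∈ modes, (coeffA f x₀ q ω Fc ε m * Real.cos (idot m ω * t₀ / ε) +
      coeffB f x₀ q ω Fc ε m * Real.sin (idot m ω * t₀ / ε)) with h_trig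
  -- The real part of `exp(iθ) S` is `cos θ Re S - sin θ Im S`; this is the origin of the minus sign
  -- in `coeffB`.
  have h3 : (∑ m ∈ modes, Complex.exp (Complex.I * (idot m ω * t₀ / ε : ℝ)) *
      (√(2 * Real.pi) * √ε * S m)).re = √ε * trig := by
    rw [Complex.re_sum, h_trig, Finset.mul_sum]
    refine Finset.sum_congr rfl fun m _ => ?_
    rw [mul_comm Complex.I, Complex.exp_mul_I, ← Complex.ofReal_cos, ← Complex.ofReal_sin, coeffA,
      coeffB]
    simp only [Complex.mul_re, Complex.mul_im, Complex.add_re, Complex.add_im, Complex.ofReal_re,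
      Complex.ofReal_im, Complex.I_re, Complex.I_im, hS]
    ring
  have h4 : |I₀ - √ε * trig| ≤ (∑ m ∈ modes, D m) * ε := by
    have e : I₀ - √ε * trig = ((I₀ : ℂ) - ∑ m ∈ modes,
        Complex.exp (Complex.I * (idot m ω * t₀ / ε : ℝ)) * (√(2 * Real.pi) * √ε * S m)).re := by
      rw [Complex.sub_re, h3, Complex.ofReal_re]
    rw [e]
    refine (Complex.abs_re_le_norm _).trans ?_
    rw [h2, ← Finset.sum_sub_distrib, Finset.sum_mul]
    refine (norm_sum_le _ _).trans (Finset.sum_le_sum fun m hm => ?_)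
    rw [← mul_sub, norm_mul, norm_cexp_I_mul, one_mul]
    exact hD m hm ε hε
  have h5 : ∫ τ, deriv x₀ τ * (ε ^ r * perturbation q F ω ε (x₀ τ) (deriv x₀ τ) (t₀ + τ)) =
      ε ^ r * I₁ := by
    rw [hI₁, ← integral_const_mul]
    congr 1
    funext τ
    simp only [perturbation]
    ring
  have h6 : leadingTerm f x₀ q ω modes Fc r ε t₀ = ε ^ r * (√ε * trig) := by
    rw [leadingTerm, Real.rpow_add hε, ← Real.sqrt_eq_rpow, mul_assoc]
  rw [h5, h6, ← mul_sub, abs_mul, abs_of_pos hr, Real.rpow_add_one hε.ne']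
  calc ε ^ r * |I₁ - √ε * trig| ≤ ε ^ r * (In * (B * Φ) * ε + (∑ m ∈ modes, D m) * ε) := by
        refine mul_le_mul_of_nonneg_left ?_ hr.le
        calc |I₁ - √ε * trig| = |(I₁ - I₀) + (I₀ - √ε * trig)| := by rw [sub_add_sub_cancel]
          _ ≤ _ := (abs_add_le _ _).trans (add_le_add h1 h4)
    _ = _ := by ring

theorem exists_pos_rpow_le {p A b : ℝ} (hp : 0 < p) (hb : 0 < b) :
    ∃ ε₀ > 0, ∀ ε, 0 < ε → ε < ε₀ → A * ε ^ p ≤ b := by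
  have h1 : Tendsto (fun ε : ℝ => A * ε ^ p) (𝓝 0) (𝓝 0) := by
    have := ((Real.continuousAt_rpow_const 0 p (Or.inr hp.le)).tendsto).const_mul A
    simpa [Real.zero_rpow hp.ne'] using this
  obtain ⟨ε₀, h0, h⟩ := Metric.eventually_nhds_iff.1 (h1.eventually (Iio_mem_nhds hb))
  refine ⟨ε₀, h0, fun ε hε hlt => (h (y := ε) ?_).le⟩
  rwa [Real.dist_eq, sub_zero, abs_of_pos hε]

end

end QPSplitting

end

/-! ### The splitting formula -/

theorem theorem3 (n : ℕ) (r : ℝ) (hr : 5 / 2 < r)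
    (f : ℝ → ℝ) (hf : ContDiff ℝ 3 f)
    (q : ℝ → ℝ → ℝ → ℝ)
    (hq_per : ∀ ξ v ε, 0 ≤ ε → q (ξ + 2 * Real.pi) v ε = q ξ v ε)
    (hq_C3 : ∀ ε, 0 ≤ ε → ContDiff ℝ 3 (fun y : ℝ × ℝ => q y.1 y.2 ε))
    (hq_C1 : ContDiffOn ℝ 1 (fun y : ℝ × ℝ × ℝ => q y.1 y.2.1 y.2.2) {y | 0 ≤ y.2.2})
    (ω : Fin n → ℝ) (hω : QPSplitting.NonResonant ω)
    (modes : Finset (Fin n → ℤ)) (hmodes : (0 : Fin n → ℤ) ∉ modes)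
    (F : (Fin n → ℝ) → ℝ) (Fc : (Fin n → ℤ) → ℂ)
    (hF : ∀ θ : Fin n → ℝ,
      (F θ : ℂ) = ∑ m ∈ modes, Fc m * Complex.exp (Complex.I * QPSplitting.idot m θ))
    (xe : ℝ) (hxe : QPSplitting.IsHyperbolicEquilibrium f xe)
    (x₀ : ℝ → ℝ) (hx₀ : QPSplitting.IsHomoclinic f xe x₀)
    (hnd : ∀ k : ℤ, k ≠ 0 → ∀ m ∈ modes, ∀ t ∈ QPSplitting.critSet x₀ ω k m, f (x₀ t) ≠ 0) :
    -- the critical sets are finite, with a bound on the cardinality that is uniform in `k`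
    (∃ N : ℕ, ∀ k : ℤ, k ≠ 0 → ∀ m ∈ modes,
      (QPSplitting.critSet x₀ ω k m).Finite ∧ (QPSplitting.critSet x₀ ω k m).ncard ≤ N) ∧
    -- the series that define the coefficients converge absolutely, uniformly in `ε`
    (∀ m ∈ modes, Summable (fun k : {k : ℤ // k ≠ 0} =>
      ∑ᶠ t ∈ QPSplitting.critSet x₀ ω k m, ‖QPSplitting.amplitude f x₀ q ω k m t‖)) ∧
    -- the displacement function is well defined and has the stated expansion
    ∃ δ₀ > 0, ∃ C : ℝ, ∀ δ, 0 < δ → δ ≤ δ₀ → ∃ ε₀ > 0, ∀ ε, 0 < ε → ε < ε₀ →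
      (∃! p : ℝ → ℝ × ℝ, QPSplitting.IsTrajectoryNear
        (QPSplitting.perturbedField f q F ω r ε) (xe, 0) δ p) ∧
      ∀ p : ℝ → ℝ × ℝ, QPSplitting.IsTrajectoryNear
        (QPSplitting.perturbedField f q F ω r ε) (xe, 0) δ p →
      ∀ t₀ : ℝ,
        (∃! Zs : ℝ × ℝ, QPSplitting.IsStableCrossing (QPSplitting.perturbedField f q F ω r ε) p
          (QPSplitting.separatrix x₀) (QPSplitting.normalSection f x₀) δ t₀ Zs) ∧
        (∃! Zu : ℝ × ℝ, QPSplitting.IsUnstableCrossing (QPSplitting.perturbedField f q F ω r ε) p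
          (QPSplitting.separatrix x₀) (QPSplitting.normalSection f x₀) δ t₀ Zu) ∧
        ∀ Zs Zu : ℝ × ℝ,
          QPSplitting.IsStableCrossing (QPSplitting.perturbedField f q F ω r ε) p
            (QPSplitting.separatrix x₀) (QPSplitting.normalSection f x₀) δ t₀ Zs →
          QPSplitting.IsUnstableCrossing (QPSplitting.perturbedField f q F ω r ε) p
            (QPSplitting.separatrix x₀) (QPSplitting.normalSection f x₀) δ t₀ Zu →
          |QPSplitting.displacement f x₀ Zu Zs -
              QPSplitting.leadingTerm f x₀ q ω modes Fc r ε t₀| ≤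
            C * (ε ^ (r + 1) + ε ^ (2 * r - 2)) := by
  have hμ : ∀ m ∈ modes, QPSplitting.idot m ω ≠ 0 := fun m hm =>
    hω m fun h0 => hmodes (h0 ▸ hm)
  obtain ⟨L, o⟩ := hx₀.exists_decayingOrbit hf hxe
  obtain ⟨c, hc, hc1, hU, N, hN⟩ := hx₀.exists_uniform_nondegeneracy hf hxe modes
    (fun m => QPSplitting.idot m ω) hμ
    (fun k hk m hm t ht => hnd k hk m hm t ((QPSplitting.mem_critSet hk).2 ht))
  have hq0 : ∀ ξ v, q (ξ + 2 * Real.pi) v 0 = q ξ v 0 := fun ξ v => hq_per ξ v 0 le_rfl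
  refine ⟨⟨N, fun k hk m hm => hN m hm k hk⟩, fun m hm =>
    QPSplitting.summable_amplitude o hq0 (hq_C3 0 le_rfl) (hμ m hm) hc (hU m hm) (hN m hm), ?_⟩
  obtain ⟨C₁, hC₁, hexp⟩ := QPSplitting.exists_melnikov_expansion o hq_per hq_C3 hq_C1 hF hμ hc hc1
    hU hN r
  obtain ⟨δ₀, hδ₀, Γ, R, C₂, hΓ, hC₂, -, hmel⟩ := hx₀.exists_melnikov hf hxe
  obtain ⟨B, hB0, hB⟩ := QPSplitting.exists_uniform_bounds hq_per hq_C1 R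
  set A := B * ∑ m ∈ modes, ‖Fc m‖ with hA
  have hA0 : 0 ≤ A := mul_nonneg hB0 (Finset.sum_nonneg fun m _ => norm_nonneg _)
  -- The constant is fixed before `δ`. Only the threshold for `ε` depends on `δ`, through the
  -- requirement `Γη ≤ δ/2`.
  refine ⟨δ₀, hδ₀, C₁ + C₂ * (2 * A ^ 2), fun δ hδ hδδ => ?_⟩
  obtain ⟨ε₁, hε₁, h1⟩ := QPSplitting.exists_pos_rpow_le (p := r - 1) (A := A) (by linarith) hδ₀
  obtain ⟨ε₂, hε₂, h2⟩ := QPSplitting.exists_pos_rpow_le (p := r) (A := Γ * A) (by linarith)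
    (half_pos hδ)
  refine ⟨min 1 (min ε₁ ε₂), by positivity, fun ε hε hlt => ?_⟩
  have hε1 : ε ≤ 1 := hlt.le.trans (min_le_left _ _)
  have hsmall := QPSplitting.isSmallForcing_perturbation (r := r) (ω := ω) hε hε1 hB0
    (fun ξ v hv => ⟨(hB ε hε.le hε1 ξ v hv).1, (hB ε hε.le hε1 ξ v hv).2.2⟩)
    (hq_C3 ε hε.le).continuous hF
  obtain ⟨hp, hcross⟩ := hmel δ hδ hδδ _ _ _ hsmall
    (h1 ε hε (hlt.trans_le ((min_le_right _ _).trans (min_le_left _ _))))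
    (by
      rw [← mul_assoc]
      exact h2 ε hε (hlt.trans_le ((min_le_right _ _).trans (min_le_right _ _))))
  refine ⟨hp, fun p hpn t₀ => ?_⟩
  obtain ⟨hs, hu, hdisp⟩ := hcross p hpn t₀
  refine ⟨hs, hu, fun Zs Zu hZs hZu => ?_⟩
  have e1 := hdisp Zs Zu hZs hZu
  have e2 := hexp ε hε hε1 t₀
  -- The terms `η²` and `ℓη` have orders `ε^(2r)` and `ε^(2r-1)`; both are absorbed into `ε^(2r-2)`
  -- since `ε ≤ 1`.
  have e3 : (A * ε ^ r) ^ 2 + A * ε ^ (r - 1) * (A * ε ^ r) ≤ 2 * A ^ 2 * ε ^ (2 * r - 2) := by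
    have q1 : (ε ^ r) ^ 2 ≤ ε ^ (2 * r - 2) := by
      rw [← Real.rpow_natCast, ← Real.rpow_mul hε.le]
      exact Real.rpow_le_rpow_of_exponent_ge hε hε1 (by push_cast; linarith)
    have q2 : ε ^ (r - 1) * ε ^ r ≤ ε ^ (2 * r - 2) := by
      rw [← Real.rpow_add hε]
      exact Real.rpow_le_rpow_of_exponent_ge hε hε1 (by linarith)
    calc _ = A ^ 2 * ((ε ^ r) ^ 2) + A ^ 2 * (ε ^ (r - 1) * ε ^ r) := by ring
      _ ≤ A ^ 2 * ε ^ (2 * r - 2) + A ^ 2 * ε ^ (2 * r - 2) := by gcongr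
      _ = _ := by ring
  have q3 : 0 ≤ ε ^ (r + 1) := (Real.rpow_pos_of_pos hε _).le
  have q4 : 0 ≤ ε ^ (2 * r - 2) := (Real.rpow_pos_of_pos hε _).le
  have e4 := e1.trans (mul_le_mul_of_nonneg_left e3 hC₂)
  refine (abs_sub_le _ _ _).trans ((add_le_add e4 e2).trans ?_)
  have q5 : 0 ≤ C₁ * ε ^ (2 * r - 2) := mul_nonneg hC₁ q4
  have q6 : 0 ≤ C₂ * (2 * A ^ 2) * ε ^ (r + 1) := by positivity
  linarith
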